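/- **Setting.** Let $\Gamma$ be the set of edges of the hexagonal lattice in $\mathbb R^2$ with edge length $1$ (hexagons centred at $(\tfrac32 q,\sqrt3(r+\tfrac q2))$, $q,r\in\mathbb Z$). Let $\mathcal A$ be the quasi-local algebra with a copy of $M_2(\mathbb C)$, with Pauli matrices $\sigma^X_x,\sigma^Z_x$, at each $x\in\Gamma$. An edge is *occupied* where $\sigma^Z=-1$. Let $\omega_0$ be the product state with $\omega_0(\sigma^Z_x)=1$ for all $x$, with GNS vector $\Omega_0$. For a finite set $\Pi$ of hexagons put $A_\Pi=\prod_{x\in\partial\Pi}\sigma^X_x$, where $\partial \Pi$ is the set of edges separating a hexagon in $\Pi$ from one not in $\Pi$, and let $\sharp\Pi$ be the number of connected components of the string configuration $\partial\Pi$. Let $\Pi_n$ be the hexagon-shaped patch of all hexagons at distance less than $n$ (in the adjacency graph of hexagons) from a fixed one, and let $\omega_n$ be the vector state of $$\Omega_n=2^{-|\Pi_n|/2}\sum_{\Pi\subset\Pi_n}(-1)^{\sharp\Pi}A_\Pi\Omega_0 .$$ **String operators.** Let $P$ be an oriented edge-self-avoiding lattice path. Wherever $P$ passes through a vertex, the third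 edge there (the *leg*) is on its right (an *R-leg*) or on its left (the vertex is then an *L-vertex*). For a finite path $P$ let $W_1[P]=1$, $W_B[P]=\prod_{\text{R-legs }j}\sigma^Z_j$ and $$W_S[P]=\Big(\prod_{j\in P}\sigma^X_j\Big)\Big(\prod_{\text{R-legs }j} i^{(1-\sigma^Z_j)/2}\Big)\Big(\prod_{\text{L-vertices }v}(-1)^{s_v}\Big),\qquad s_v=\tfrac14(1-\sigma^Z_j)(1+\sigma^Z_k),$$ where $j,k$ are the edges of $P$ into and out of $v$; $W_{\bar S}[P]$ is the same with $-i$ in place of $i$. For infinite $P$, the automorphism $w_a[P]$ of $\mathcal A$ is the pointwise norm limit of conjugation by $W_a[P']$ over finite parts $P'$ of $P$; for finite $P$ it is conjugation by $W_a[P]$. **Paths of cones.** Let $\Lambda_0$ be the open cone with apex $p\in\mathbb R^2$, axis $(0,1)$ and opening angle $\theta\in(0,2\pi)$; its right half-cone $\Lambda_0^{(R)}$ has apex $p$, axis $(0,1)$ rotated clockwise by $\theta/4$, and opening angle $\theta/2$. Let $P_{\Lambda_0}$ consist of the edges with midpoint at distance more than $n>2$ from $p$ and to the left of the axis of $\Lambda_0^{(R)}$,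 in the boundary, oriented counterclockwise, of the set of all open hexagons that meet $\Lambda_0^{(R)}$ (so $P_{\Lambda_0}$ follows the axis of $\Lambda_0$). Put $w_{a,\Lambda_0}=w_a[P_{\Lambda_0}]$ for $a\in I=\{1,S,\bar S,B\}$. **Proposition.** The states $\omega_n$ converge in the weak-$*$ topology to a state $\omega$ on $\mathcal A$ (the double semion state). Let $\pi_1$ be the GNS representation of $\omega$. Then for every $p\in\mathbb R^2$, $\theta\in(0,2\pi)$ and $n>2$, the representations $\pi_a=\pi_1\circ w_{a,\Lambda_0}$ satisfy, for all $a,b\in I$: $\pi_a$ is unitarily equivalent to $\pi_b$ if and only if $a=b$. -/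

import Mathlib

open scoped ComplexOrder InnerProductSpace Topology

noncomputable section

namespace DoubleSemion

/-! ### The hexagonal lattice -/

/-- The hexagons of the hexagonal lattice, in axial coordinates. -/
abbrev Hexagon := ℤ × ℤ

/-- The displacements to the six neighbours of a hexagon, listed counterclockwise. -/
def dir : Fin 6 → Hexagon := ![(1, 0), (0, 1), (-1, 1), (-1, 0), (0, -1), (1, -1)]

/-- Two hexagons are adjacent when they share an edge of the lattice. -/
def hexGraph : SimpleGraph Hexagon where
  Adj h h' := ∃ k, h' = h + dir k
  symm := ⟨by
    rintro h _ ⟨k, rfl⟩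
    refine ⟨k + 3, ?_⟩
    rw [add_assoc, left_eq_add]
    revert k
    decide⟩
  loopless := ⟨by
    rintro h ⟨k, hk⟩
    rw [left_eq_add] at hk
    revert k
    decide⟩

/-- The sites `Γ`: the edges of the hexagonal lattice. Every lattice edge is shared by exactly two
hexagons, and is recorded as this unordered pair of adjacent hexagons. -/
abbrev Edge := hexGraph.edgeSet

/-- An oriented lattice edge: `(h, k)` is the edge between the hexagon `h` and its `k`-th neighbour
`h + dir k`, run through counterclockwise around `h`, so that `h` is on its left. -/
abbrev Dart := Hexagon × Fin 6

/-- The hexagon to the left of an oriented edge. -/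
def Dart.left (d : Dart) : Hexagon := d.1

/-- The hexagon to the right of an oriented edge. -/
def Dart.right (d : Dart) : Hexagon := d.1 + dir d.2

/-- The lattice edge that underlies an oriented edge. -/
def Dart.edge (d : Dart) : Edge :=
  ⟨s(Dart.left d, Dart.right d), (SimpleGraph.mem_edgeSet hexGraph).2 ⟨d.2, rfl⟩⟩

/-- At the head of `d` three hexagons meet: `(h, k).left = h`, `(h, k).right = h + dir k` and the
one in front, `h + dir (k + 1)`. The oriented edge leaving the head of `d` to the left runs between
`h` and `h + dir (k + 1)`. -/
def Dart.turnLeft (d : Dart) : Dart := (d.1, d.2 + 1)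

/-- The oriented edge leaving the head of `d` to the right; it runs between the hexagon in front
(on its left) and `d.right` (on its right). -/
def Dart.turnRight (d : Dart) : Dart := (d.1 + dir (d.2 + 1), d.2 - 1)

/-- The boundary `∂Π` of a set of hexagons, as a set of oriented edges: the edges that separate a
hexagon in `Π`, on the left, from a hexagon not in `Π`, on the right (so `∂Π` runs
counterclockwise around `Π`). -/
def orientedBoundary (S : Set Hexagon) : Set Dart :=
  {d | Dart.left d ∈ S ∧ Dart.right d ∉ S}

/-- The (unoriented) boundary of a finite set of hexagons. -/
def boundary (S : Finset Hexagon) : Finset Edge :=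
  ((S ×ˢ Finset.univ).filter fun d : Dart => Dart.right d ∉ S).image Dart.edge

/-- The graph whose vertices are the edges in `c`, two of them being adjacent when they are
distinct and share an endpoint. -/
def stringGraph (c : Finset Edge) : SimpleGraph {e : Edge // e ∈ c} :=
  SimpleGraph.fromRel fun e e' => ∃ d : Dart, Dart.edge d = e ∧
    (Dart.edge (Dart.turnLeft d) = e' ∨ Dart.edge (Dart.turnRight d) = e')

/-- The number of connected components of a string configuration. -/
def numStrings (c : Finset Edge) : ℕ := Nat.card (stringGraph c).ConnectedComponent

/-- The hexagon-shaped patch of all hexagons at graph distance less than `n` from a fixed one. -/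
def patch (n : ℕ) : Finset Hexagon :=
  (Finset.Icc (-(n : ℤ)) n ×ˢ Finset.Icc (-(n : ℤ)) n).filter
    fun h => |h.1| < n ∧ |h.2| < n ∧ |h.1 + h.2| < n

/-! ### Pauli operators and the quasi-local algebra -/

/-- A string configuration with finitely many occupied edges (those with `σᶻ = -1`). -/
abbrev Config := Finset Edge

/-- The GNS space `H₀` of the product state `ω₀` without strings: it has an orthonormal basis
labelled by the string configurations with finitely many occupied edges. -/
abbrev H₀ := lp (fun _ : Config => ℂ) 2

/-- The bounded operators on `H₀`. -/
abbrev B₀ := H₀ →L[ℂ] H₀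

/-- The basis vector `|c⟩` of `H₀`. -/
def ket (c : Config) : H₀ := lp.single 2 c 1

/-- The isometry `ψ ↦ (c ↦ f c * ψ (e c))` of `H₀`. -/
def monomial (e : Equiv.Perm Config) (f : Config → Circle) : H₀ →ₗᵢ[ℂ] H₀ where
  toFun ψ := ⟨fun c => (f c : ℂ) * ψ (e c), by
    have h := (lp.memℓp ψ).summable (by norm_num)
    refine memℓp_gen ?_
    simpa [Function.comp_def, Circle.norm_coe] using (e.summable_iff.2 h)⟩
  map_add' ψ χ := by ext c; exact mul_add _ _ _
  map_smul' r ψ := by ext c; exact mul_left_comm _ _ _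
  norm_map' ψ := by
    rw [lp.norm_eq_tsum_rpow (by norm_num), lp.norm_eq_tsum_rpow (by norm_num)]
    congr 1
    simpa [Circle.norm_coe] using e.tsum_eq (fun c => ‖ψ c‖ ^ (ENNReal.toReal 2))

theorem monomial_apply (e : Equiv.Perm Config) (f : Config → Circle) (ψ : H₀) (c : Config) :
    monomial e f ψ c = (f c : ℂ) * ψ (e c) := rfl

/-- The operator `f(σᶻ)`, diagonal in the basis of the `|c⟩` with eigenvalues `f c`. -/
def diag (f : Config → Circle) : unitary B₀ :=
  Unitary.linearIsometryEquiv.symm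
    (LinearIsometryEquiv.ofSurjective (monomial 1 f) fun ψ => ⟨monomial 1 f⁻¹ ψ, by
      ext c; simp [monomial_apply]⟩)

/-- The permutation `c ↦ c ∆ F` of the configurations. -/
def flipPerm (F : Finset Edge) : Equiv.Perm Config where
  toFun c := symmDiff c F
  invFun c := symmDiff c F
  left_inv c := by simp
  right_inv c := by simp

/-- The operator `∏_{x ∈ F} σˣ_x`, which maps `|c⟩` to `|c ∆ F⟩`. -/
def flipX (F : Finset Edge) : unitary B₀ :=
  Unitary.linearIsometryEquiv.symm
    (LinearIsometryEquiv.ofSurjective (monomial (flipPerm F) 1)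
      fun ψ => ⟨monomial (flipPerm F) 1 ψ, by
        ext c; simp [monomial_apply, flipPerm]⟩)

theorem diag_apply (f : Config → Circle) (ψ : H₀) (c : Config) :
    (diag f : B₀) ψ c = (f c : ℂ) * ψ c := rfl

theorem flip_apply (F : Finset Edge) (ψ : H₀) (c : Config) :
    (flipX F : B₀) ψ c = ψ (symmDiff c F) := by
  change ((1 : Circle) : ℂ) * ψ (symmDiff c F) = _
  simp

/-- The Pauli matrix `σˣ` at the site `x`. -/
def σX (x : Edge) : unitary B₀ := flipX {x}

/-- The Pauli matrix `σᶻ` at the site `x`: it is `-1` on configurations in which `x` is occupied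
and `1` on the others. -/
def σZ (x : Edge) : unitary B₀ := diag fun c => if x ∈ c then -1 else 1

/-- The quasi-local algebra: the C⋆-algebra generated by the Pauli matrices of all sites (in the
faithful GNS representation of the product state `ω₀`). -/
def quasiLocal : StarSubalgebra ℂ B₀ :=
  (StarAlgebra.adjoin ℂ {T : B₀ | ∃ x, T = σX x ∨ T = σZ x}).topologicalClosure

/-- The quasi-local algebra as a type. -/
abbrev 𝒜 := ↥quasiLocal

theorem isClosed_quasiLocal : IsClosed (quasiLocal : Set B₀) :=
  StarSubalgebra.isClosed_topologicalClosure _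

instance : CStarAlgebra 𝒜 :=
  StarSubalgebra.cstarAlgebra quasiLocal (h_closed := isClosed_quasiLocal)

instance : PartialOrder 𝒜 := CStarAlgebra.spectralOrder 𝒜

instance : StarOrderedRing 𝒜 := CStarAlgebra.spectralOrderedRing 𝒜

/-! ### The double semion state -/

/-- The vector `Ω_n = 2^{-|Π_n|/2} ∑_{Π ⊆ Π_n} (-1)^{♯Π} A_Π Ω₀`, where `A_Π = ∏_{x ∈ ∂Π} σˣ_x`,
`Ω₀ = |∅⟩`, and `♯Π` is the number of connected components of the string configuration `∂Π`. -/
def stringVector (n : ℕ) : H₀ :=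
  (Real.sqrt (1 / 2 ^ (patch n).card) : ℂ) •
    ∑ S ∈ (patch n).powerset,
      ((-1 : ℂ) ^ numStrings (boundary S)) • (flipX (boundary S) : B₀) (ket ∅)

/-- `ω` is the double semion state: the weak-⋆ limit of the vector states of the `Ω_n`. -/
def IsDoubleSemionState (ω : 𝒜 →ₚ[ℂ] ℂ) : Prop :=
  ∀ O : 𝒜, Filter.Tendsto (fun n => ⟪stringVector n, (O : B₀) (stringVector n)⟫_ℂ)
    Filter.atTop (𝓝 (ω O))

/-! ### String operators -/

/-- The four anyon labels `1, S, S̄, B`. -/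
inductive Anyon
  | vacuum
  | semion
  | antisemion
  | bound

/-- `i` as a point of the unit circle. -/
def circleI : Circle := ⟨Complex.I, by simp [Submonoid.unitSphere]⟩

/-- The eigenvalue with which an occupied R-leg contributes to the string operator. -/
def Anyon.legPhase : Anyon → Circle
  | .vacuum => 1
  | .semion => circleI
  | .antisemion => -circleI
  | .bound => -1

/-- Whether the string operator contains the factors `∏ σˣ_j` and `∏ (-1)^{s_v}`. -/
def Anyon.isSemionic : Anyon → Prop
  | .vacuum => False
  | .semion => True
  | .antisemion => True
  | .bound => False

open Classical in
/-- `∏_{j ∈ P} σˣ_j` for `a = S, S̄`, and `1` otherwise. -/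
def edgeFactor (a : Anyon) (P : Finset Dart) : unitary B₀ :=
  flipX (if a.isSemionic then P.image Dart.edge else ∅)

open Classical in
/-- The product over the R-legs `j` of the path `P` of `i^{(1-σᶻ_j)/2}` for `a = S`, of
`(-i)^{(1-σᶻ_j)/2}` for `a = S̄`, of `σᶻ_j` for `a = B`, and of `1` for the vacuum. The path has an
R-leg where it turns left: the leg is the third edge at that vertex. -/
def legFactor (a : Anyon) (P : Finset Dart) : unitary B₀ :=
  diag fun c => ∏ d ∈ P,
    if Dart.turnLeft d ∈ P ∧ Dart.edge (Dart.turnRight d) ∈ c then a.legPhase else 1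

open Classical in
/-- `∏_v (-1)^{s_v}` over the L-vertices `v` of the path `P` for `a = S, S̄`, and `1` otherwise.
Here `s_v = (1 - σᶻ_j)(1 + σᶻ_k)/4`, with `j` and `k` the edges of `P` into and out of `v`, is `1`
if `j` is occupied and `k` is not, and `0` otherwise. The L-vertices are those where the path turns
right, so that the third edge is on the left. -/
def vertexFactor (a : Anyon) (P : Finset Dart) : unitary B₀ :=
  diag fun c => ∏ d ∈ P,
    if a.isSemionic ∧ Dart.turnRight d ∈ P ∧ Dart.edge d ∈ c ∧
      Dart.edge (Dart.turnRight d) ∉ c then -1 else 1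

/-- The string operator `W_a[P]` of a finite oriented path `P`, given by its set of oriented
edges. -/
def stringOperator (a : Anyon) (P : Finset Dart) : unitary B₀ :=
  edgeFactor a P * legFactor a P * vertexFactor a P

/-! ### Conjugation by formal infinite products of unitaries -/

section ConjLimit

variable {B ι : Type*} [CStarAlgebra B] (u : ι → unitary B) (l : Filter ι)

/-- The limit of `u i * T * star (u i)` along `l`. -/
def conjLimit (T : B) : B := Filter.limUnder l fun i => (u i : B) * T * star (u i : B)

variable {u l}

theorem tendsto_conjLimit {T : B}
    (h : ∃ L, Filter.Tendsto (fun i => (u i : B) * T * star (u i : B)) l (𝓝 L)) :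
    Filter.Tendsto (fun i => (u i : B) * T * star (u i : B)) l (𝓝 (conjLimit u l T)) :=
  tendsto_nhds_limUnder h

theorem norm_conj (v : unitary B) (T : B) : ‖(v : B) * T * star (v : B)‖ = ‖T‖ := by
  rw [mul_assoc, CStarRing.norm_coe_unitary_mul]
  exact CStarRing.norm_mul_coe_unitary T (star v)

theorem conj_mul (v : unitary B) (S T : B) :
    (v : B) * (S * T) * star (v : B)
      = ((v : B) * S * star (v : B)) * ((v : B) * T * star (v : B)) := by
  have h : star (v : B) * (v : B) = 1 := Unitary.coe_star_mul_self v
  calc (v : B) * (S * T) * star (v : B) = (v : B) * S * 1 * T * star (v : B) := by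
        simp only [mul_one, mul_assoc]
    _ = _ := by rw [← h]; simp only [mul_assoc]

/-- Convergence of the conjugations on generators gives convergence on the closed ⋆-algebra that
they generate. -/
theorem exists_conjLimit [l.NeBot] {s : Set B}
    (h : ∀ T ∈ s, ∃ L, Filter.Tendsto (fun i => (u i : B) * T * star (u i : B)) l (𝓝 L)) :
    ∀ T ∈ (StarAlgebra.adjoin ℂ s).topologicalClosure,
      ∃ L, Filter.Tendsto (fun i => (u i : B) * T * star (u i : B)) l (𝓝 L) := by
  let C : StarSubalgebra ℂ B :=
    { carrier := {T | ∃ L, Filter.Tendsto (fun i => (u i : B) * T * star (u i : B)) l (𝓝 L)}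
      mul_mem' := by
        rintro S T ⟨L, hL⟩ ⟨M, hM⟩
        exact ⟨L * M, by simpa only [conj_mul] using hL.mul hM⟩
      add_mem' := by
        rintro S T ⟨L, hL⟩ ⟨M, hM⟩
        exact ⟨L + M, by simpa only [mul_add, add_mul] using hL.add hM⟩
      algebraMap_mem' := by
        intro r
        refine ⟨algebraMap ℂ B r, ?_⟩
        have : ∀ i, (u i : B) * algebraMap ℂ B r * star (u i : B) = algebraMap ℂ B r := by
          intro i
          rw [← Algebra.commutes, mul_assoc, ← Unitary.coe_star, Unitary.coe_mul_star_self, mul_one]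
        simpa only [this] using tendsto_const_nhds
      star_mem' := by
        rintro T ⟨L, hL⟩
        exact ⟨star L, by simpa only [star_mul, star_star, mul_assoc] using hL.star⟩ }
  have hC : IsClosed (C : Set B) := by
    refine isClosed_of_closure_subset fun T hT => ?_
    change ∃ L, Filter.Tendsto (fun i => (u i : B) * T * star (u i : B)) l (𝓝 L)
    rw [← cauchy_map_iff_exists_tendsto, Metric.cauchy_iff]
    refine ⟨inferInstance, fun ε hε => ?_⟩
    obtain ⟨S, ⟨L, hL⟩, hS⟩ := Metric.mem_closure_iff.1 hT (ε / 4) (by positivity)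
    refine ⟨Metric.ball L (ε / 2), ?_, ?_⟩
    · rw [Filter.mem_map]
      filter_upwards [Metric.tendsto_nhds.1 hL (ε / 4) (by positivity)] with i hi
      have h1 : dist ((u i : B) * T * star (u i : B)) ((u i : B) * S * star (u i : B)) < ε / 4 := by
        rw [dist_eq_norm, ← sub_mul, ← mul_sub, norm_conj, ← dist_eq_norm]
        exact hS
      have h2 := dist_triangle ((u i : B) * T * star (u i : B)) ((u i : B) * S * star (u i : B)) L
      simp only [Set.mem_preimage, Metric.mem_ball]
      linarith
    · intro x hx y hy
      have := dist_triangle_right x y L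
      simp only [Metric.mem_ball] at hx hy
      linarith
  have hle : (StarAlgebra.adjoin ℂ s).topologicalClosure ≤ C :=
    StarSubalgebra.topologicalClosure_minimal (StarAlgebra.adjoin_le h) hC
  exact fun T hT => hle hT

theorem conjLimit_conjLimit_star [l.NeBot] {T : B}
    (h : ∃ L, Filter.Tendsto (fun i => (u i : B) * T * star (u i : B)) l (𝓝 L)) :
    conjLimit (fun i => star (u i)) l (conjLimit u l T) = T := by
  refine Filter.Tendsto.limUnder_eq ?_
  rw [tendsto_iff_norm_sub_tendsto_zero]
  have h0 := tendsto_iff_norm_sub_tendsto_zero.1 (tendsto_conjLimit h)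
  refine h0.congr fun i => ?_
  rw [← norm_conj (star (u i)) ((u i : B) * T * star (u i : B) - conjLimit u l T), norm_sub_rev,
    mul_sub, sub_mul]
  congr 2
  have h1 : star (u i : B) * (u i : B) = 1 := Unitary.coe_star_mul_self (u i)
  simp only [Unitary.coe_star, star_star]
  calc star (u i : B) * ((u i : B) * T * star (u i : B)) * (u i : B)
      = (star (u i : B) * (u i : B)) * T * (star (u i : B) * (u i : B)) := by
        simp only [mul_assoc]
    _ = T := by rw [h1, one_mul, mul_one]

/-- The automorphism `T ↦ lim u i * T * star (u i)` of a closed ⋆-subalgebra that contains the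
unitaries `u i` and on which the limits exist. -/
def conjLimitAut [l.NeBot] (S : StarSubalgebra ℂ B) (hS : IsClosed (S : Set B))
    (hu : ∀ i, (u i : B) ∈ S)
    (h : ∀ T ∈ S, ∃ L, Filter.Tendsto (fun i => (u i : B) * T * star (u i : B)) l (𝓝 L))
    (h' : ∀ T ∈ S, ∃ L, Filter.Tendsto
      (fun i => ((star (u i) : unitary B) : B) * T * star ((star (u i) : unitary B) : B)) l (𝓝 L)) :
    S ≃⋆ₐ[ℂ] S where
  toFun T := ⟨conjLimit u l T, hS.mem_of_tendsto (tendsto_conjLimit (h T T.2))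
    (Filter.Eventually.of_forall fun i => mul_mem (mul_mem (hu i) T.2) (star_mem (hu i)))⟩
  invFun T := ⟨conjLimit (fun i => star (u i)) l T, hS.mem_of_tendsto (tendsto_conjLimit (h' T T.2))
    (Filter.Eventually.of_forall fun i =>
      mul_mem (mul_mem (star_mem (hu i)) T.2) (star_mem (star_mem (hu i))))⟩
  left_inv T := Subtype.ext (conjLimit_conjLimit_star (h T T.2))
  right_inv T := Subtype.ext (by
    have := conjLimit_conjLimit_star (h' T T.2)
    simpa only [star_star] using this)
  map_mul' T R := Subtype.ext (by
    refine Filter.Tendsto.limUnder_eq ?_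
    have := (tendsto_conjLimit (h T T.2)).mul (tendsto_conjLimit (h R R.2))
    exact this.congr fun i => (conj_mul _ _ _).symm)
  map_add' T R := Subtype.ext (by
    refine Filter.Tendsto.limUnder_eq ?_
    have := (tendsto_conjLimit (h T T.2)).add (tendsto_conjLimit (h R R.2))
    refine this.congr fun i => ?_
    change _ = (u i : B) * ((T : B) + (R : B)) * star (u i : B)
    rw [mul_add, add_mul])
  map_star' T := Subtype.ext (by
    refine Filter.Tendsto.limUnder_eq ?_
    have := (tendsto_conjLimit (h T T.2)).star
    refine this.congr fun i => ?_
    change _ = (u i : B) * star (T : B) * star (u i : B)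
    rw [star_mul, star_mul, star_star, mul_assoc])
  map_smul' r T := Subtype.ext (by
    refine Filter.Tendsto.limUnder_eq ?_
    have := (tendsto_conjLimit (h T T.2)).const_smul r
    refine this.congr fun i => ?_
    change _ = (u i : B) * (r • (T : B)) * star (u i : B)
    rw [mul_smul_comm, smul_mul_assoc])

end ConjLimit

/-! ### The string automorphisms -/

theorem star_diag_apply (f : Config → Circle) (ψ : H₀) (c : Config) :
    (star (diag f : B₀)) ψ c = ((f c)⁻¹ : ℂ) * ψ c := by
  have h1 : diag f⁻¹ * diag f = 1 := by
    refine Subtype.ext (ContinuousLinearMap.ext fun ψ => lp.ext (funext fun c => ?_))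
    change ((f c)⁻¹ : Circle) * ((f c : ℂ) * ψ c) = ψ c
    simp
  have h2 : star (diag f) = diag f⁻¹ := (eq_inv_of_mul_eq_one_left h1).symm
  have h3 : star (diag f : B₀) = (diag f⁻¹ : unitary B₀) := congrArg Subtype.val h2
  rw [h3, diag_apply]
  simp

theorem star_flip (F : Finset Edge) : star (flipX F : B₀) = flipX F := by
  have h1 : flipX F * flipX F = 1 := by
    refine Subtype.ext (ContinuousLinearMap.ext fun ψ => lp.ext (funext fun c => ?_))
    change (flipX F : B₀) ((flipX F : B₀) ψ) c = ψ c
    rw [flip_apply, flip_apply, symmDiff_symmDiff_cancel_right]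
  exact congrArg Subtype.val (eq_inv_of_mul_eq_one_left h1).symm

open Classical in
/-- The diagonal part of the string operator. -/
def phase (a : Anyon) (P : Finset Dart) (c : Config) : Circle :=
  ∏ d ∈ P, ((if Dart.turnLeft d ∈ P ∧ Dart.edge (Dart.turnRight d) ∈ c then a.legPhase else 1) *
    (if a.isSemionic ∧ Dart.turnRight d ∈ P ∧ Dart.edge d ∈ c ∧
      Dart.edge (Dart.turnRight d) ∉ c then -1 else 1))

open Classical in
/-- The edges of `P` if the string operator flips them. -/
def flipped (a : Anyon) (P : Finset Dart) : Finset Edge :=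
  if a.isSemionic then P.image Dart.edge else ∅

theorem stringOperator_eq (a : Anyon) (P : Finset Dart) :
    stringOperator a P = flipX (flipped a P) * diag (phase a P) := by
  refine Subtype.ext (ContinuousLinearMap.ext fun ψ => lp.ext (funext fun c => ?_))
  change (flipX (flipped a P) : B₀) ((legFactor a P : B₀) ((vertexFactor a P : B₀) ψ)) c
    = (flipX (flipped a P) : B₀) ((diag (phase a P) : B₀) ψ) c
  rw [flip_apply, flip_apply, legFactor, vertexFactor, diag_apply, diag_apply, diag_apply, phase,
    Finset.prod_mul_distrib, Circle.coe_mul, mul_assoc]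

theorem finite_edge_eq (y : Edge) : {d : Dart | Dart.edge d = y}.Finite := by
  refine ((y.1.toFinset ×ˢ (Finset.univ : Finset (Fin 6))).finite_toSet).subset ?_
  rintro d rfl
  simp [Dart.edge, Dart.left]

theorem turnRight_injective : Function.Injective Dart.turnRight := by
  rintro ⟨h, k⟩ ⟨h', k'⟩ e
  simp only [Dart.turnRight, Prod.mk.injEq, sub_left_inj] at e
  obtain ⟨e1, rfl⟩ := e
  simpa using e1

/-- The oriented edges whose contribution to the string operator involves the site `x`. -/
def near (x : Edge) : Set Dart := {d | Dart.edge d = x ∨ Dart.edge (Dart.turnRight d) = x}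

theorem finite_near (x : Edge) : (near x).Finite :=
  (finite_edge_eq x).union ((finite_edge_eq x).preimage turnRight_injective.injOn)

/-- All oriented edges that matter for the conjugation of a Pauli matrix at `x`. -/
def hood (x : Edge) : Set Dart :=
  near x ∪ Dart.turnLeft '' near x ∪ Dart.turnRight '' near x ∪
    ⋃ d ∈ near x, ({e | Dart.edge e = Dart.edge d} ∪
      {e | Dart.edge e = Dart.edge (Dart.turnRight d)})

theorem finite_hood (x : Edge) : (hood x).Finite :=
  ((((finite_near x).union ((finite_near x).image _)).union ((finite_near x).image _))).union
    ((finite_near x).biUnion fun _ _ => (finite_edge_eq _).union (finite_edge_eq _))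

theorem mem_flipped_congr {a : Anyon} {P Q : Finset Dart} {y : Edge}
    (h : ∀ d, Dart.edge d = y → (d ∈ P ↔ d ∈ Q)) : y ∈ flipped a P ↔ y ∈ flipped a Q := by
  unfold flipped
  split_ifs
  · simp only [Finset.mem_image]
    constructor <;> rintro ⟨d, hd, rfl⟩
    · exact ⟨d, (h d rfl).1 hd, rfl⟩
    · exact ⟨d, (h d rfl).2 hd, rfl⟩
  · rfl

open Classical in
theorem phase_ratio_congr (a : Anyon) {P Q : Finset Dart} {x : Edge} {c c' : Config}
    (h : ∀ d ∈ hood x, (d ∈ P ↔ d ∈ Q))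
    (hc : ∀ d ∈ near x, (Dart.edge d ∈ c ↔ Dart.edge d ∈ c') ∧
      (Dart.edge (Dart.turnRight d) ∈ c ↔ Dart.edge (Dart.turnRight d) ∈ c')) :
    phase a P c / phase a P (symmDiff c {x}) = phase a Q c' / phase a Q (symmDiff c' {x}) := by
  unfold phase
  rw [← Finset.prod_div_distrib, ← Finset.prod_div_distrib]
  have hx : ∀ (b : Config) (y : Edge), y ≠ x → (y ∈ symmDiff b {x} ↔ y ∈ b) := by
    intro b y hy
    simp [Finset.mem_symmDiff, hy]
  have hx' : ∀ (b : Config), x ∈ symmDiff b {x} ↔ x ∉ b := by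
    intro b
    simp [Finset.mem_symmDiff]
  have hfil : P.filter (· ∈ near x) = Q.filter (· ∈ near x) := by
    ext d
    simp only [Finset.mem_filter]
    constructor <;> rintro ⟨h1, h2⟩
    · exact ⟨(h d (Or.inl (Or.inl (Or.inl h2)))).1 h1, h2⟩
    · exact ⟨(h d (Or.inl (Or.inl (Or.inl h2)))).2 h1, h2⟩
  have far : ∀ (R : Finset Dart) (b : Config), ∀ d ∈ R, d ∉ near x →
      ((if Dart.turnLeft d ∈ R ∧ Dart.edge (Dart.turnRight d) ∈ b then a.legPhase else 1) *
        (if a.isSemionic ∧ Dart.turnRight d ∈ R ∧ Dart.edge d ∈ b ∧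
          Dart.edge (Dart.turnRight d) ∉ b then -1 else 1)) /
      ((if Dart.turnLeft d ∈ R ∧ Dart.edge (Dart.turnRight d) ∈ symmDiff b {x}
          then a.legPhase else 1) *
        (if a.isSemionic ∧ Dart.turnRight d ∈ R ∧ Dart.edge d ∈ symmDiff b {x} ∧
          Dart.edge (Dart.turnRight d) ∉ symmDiff b {x} then -1 else 1)) = (1 : Circle) := by
    intro R b d _ hd
    simp only [near, Set.mem_ofPred_eq, not_or] at hd
    simp only [hx b _ hd.1, hx b _ hd.2]
    exact div_self' _
  rw [← Finset.prod_filter_mul_prod_filter_not P (· ∈ near x),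
    ← Finset.prod_filter_mul_prod_filter_not Q (· ∈ near x),
    Finset.prod_eq_one (s := P.filter (¬ · ∈ near x)), mul_one,
    Finset.prod_eq_one (s := Q.filter (¬ · ∈ near x)), mul_one, hfil]
  · refine Finset.prod_congr rfl fun d hd => ?_
    have hd' : d ∈ near x := (Finset.mem_filter.1 hd).2
    have hL := h _ (Or.inl (Or.inl (Or.inr ⟨d, hd', rfl⟩)))
    have hR := h _ (Or.inl (Or.inr ⟨d, hd', rfl⟩))
    obtain ⟨h1, h2⟩ := hc d hd'
    have hs : ∀ y : Edge, (y ∈ c ↔ y ∈ c') → (y ∈ symmDiff c {x} ↔ y ∈ symmDiff c' {x}) := by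
      intro y hy
      simp only [Finset.mem_symmDiff, hy]
    simp only [hL, hR, h1, h2, hs _ h1, hs _ h2]
  · intro d hd
    exact far Q c' d (Finset.mem_filter.1 hd).1 (Finset.mem_filter.1 hd).2
  · intro d hd
    exact far P c d (Finset.mem_filter.1 hd).1 (Finset.mem_filter.1 hd).2

/-- The conjugate of a Pauli matrix at `x` only depends on the part of the path near `x`. -/
theorem conj_congr (a : Anyon) {P Q : Finset Dart} {x : Edge}
    (h : ∀ d ∈ hood x, (d ∈ P ↔ d ∈ Q)) {T : B₀} (hT : T = σX x ∨ T = σZ x) :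
    (stringOperator a P : B₀) * T * star (stringOperator a P : B₀)
        = (stringOperator a Q : B₀) * T * star (stringOperator a Q : B₀) ∧
      star (stringOperator a P : B₀) * T * (stringOperator a P : B₀)
        = star (stringOperator a Q : B₀) * T * (stringOperator a Q : B₀) := by
  have hfl : ∀ d ∈ near x, (Dart.edge d ∈ flipped a P ↔ Dart.edge d ∈ flipped a Q) ∧
      (Dart.edge (Dart.turnRight d) ∈ flipped a P ↔
        Dart.edge (Dart.turnRight d) ∈ flipped a Q) := by
    intro d hd
    constructor
    · exact mem_flipped_congr fun e he => h e (Or.inr (Set.mem_biUnion hd (Or.inl he)))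
    · exact mem_flipped_congr fun e he => h e (Or.inr (Set.mem_biUnion hd (Or.inr he)))
  have hx : x ∈ flipped a P ↔ x ∈ flipped a Q :=
    mem_flipped_congr fun e he => h e (Or.inl (Or.inl (Or.inl (Or.inl he))))
  have hsd : ∀ (c : Config) (y : Edge), (y ∈ flipped a P ↔ y ∈ flipped a Q) →
      (y ∈ symmDiff c (flipped a P) ↔ y ∈ symmDiff c (flipped a Q)) := by
    intro c y hy
    simp only [Finset.mem_symmDiff, hy]
  have e1 : ∀ (R : Finset Dart) (S : B₀) (ψ : H₀) (c : Config),
      ((stringOperator a R : B₀) * S * star (stringOperator a R : B₀)) ψ c =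
      (flipX (flipped a R) : B₀) ((diag (phase a R) : B₀) (S (star (diag (phase a R) : B₀)
        ((flipX (flipped a R) : B₀) ψ)))) c := by
    intro R S ψ c
    rw [stringOperator_eq]
    simp only [Submonoid.coe_mul, star_mul, star_flip]
    rfl
  have e2 : ∀ (R : Finset Dart) (S : B₀) (ψ : H₀) (c : Config),
      (star (stringOperator a R : B₀) * S * (stringOperator a R : B₀)) ψ c =
      star (diag (phase a R) : B₀) ((flipX (flipped a R) : B₀) (S ((flipX (flipped a R) : B₀)
        ((diag (phase a R) : B₀) ψ)))) c := by
    intro R S ψ c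
    rw [stringOperator_eq]
    simp only [Submonoid.coe_mul, star_mul, star_flip]
    rfl
  have sd : ∀ (c F : Config), symmDiff (symmDiff (symmDiff c F) {x}) F = symmDiff c {x} := by
    intro c F
    rw [symmDiff_right_comm c F {x}, symmDiff_symmDiff_cancel_right]
  rcases hT with rfl | rfl
  · constructor
    · refine ContinuousLinearMap.ext fun ψ => lp.ext (funext fun c => ?_)
      rw [e1, e1]
      simp only [σX, flip_apply, diag_apply, star_diag_apply, sd, ← mul_assoc, ← Circle.coe_inv,
        ← Circle.coe_mul, ← div_eq_mul_inv]
      rw [phase_ratio_congr a h fun d hd =>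
        ⟨hsd c _ (hfl d hd).1, hsd c _ (hfl d hd).2⟩]
    · refine ContinuousLinearMap.ext fun ψ => lp.ext (funext fun c => ?_)
      rw [e2, e2]
      simp only [σX, flip_apply, diag_apply, star_diag_apply, sd, ← mul_assoc, ← Circle.coe_inv,
        ← Circle.coe_mul]
      have h1 := phase_ratio_congr a (c := c) (c' := c) h fun d hd => ⟨Iff.rfl, Iff.rfl⟩
      have h2 : (phase a P c)⁻¹ * phase a P (symmDiff c {x}) =
          (phase a Q c)⁻¹ * phase a Q (symmDiff c {x}) := by
        rw [← inv_inj, mul_inv_rev, mul_inv_rev, inv_inv, inv_inv, ← div_eq_inv_mul,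
          ← div_eq_inv_mul]
        exact h1
      exact congrArg (fun z : Circle => (z : ℂ) * ψ (symmDiff c {x})) h2
  · constructor
    · refine ContinuousLinearMap.ext fun ψ => lp.ext (funext fun c => ?_)
      rw [e1, e1]
      simp only [σZ, flip_apply, diag_apply, star_diag_apply, symmDiff_symmDiff_cancel_right,
        hsd c x hx]
      rw [mul_left_comm, mul_left_comm (phase a Q _ : ℂ), mul_inv_cancel_left₀ (Circle.coe_ne_zero _),
        mul_inv_cancel_left₀ (Circle.coe_ne_zero _)]
    · refine ContinuousLinearMap.ext fun ψ => lp.ext (funext fun c => ?_)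
      rw [e2, e2]
      simp only [σZ, flip_apply, diag_apply, star_diag_apply, symmDiff_symmDiff_cancel_right,
        hsd c x hx]
      rw [mul_left_comm, mul_left_comm ((phase a Q _ : ℂ)⁻¹),
        inv_mul_cancel_left₀ (Circle.coe_ne_zero _), inv_mul_cancel_left₀ (Circle.coe_ne_zero _)]

theorem σX_mem (x : Edge) : (σX x : B₀) ∈ quasiLocal :=
  StarSubalgebra.le_topologicalClosure _ (StarAlgebra.subset_adjoin ℂ _ ⟨x, Or.inl rfl⟩)

theorem σZ_mem (x : Edge) : (σZ x : B₀) ∈ quasiLocal :=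
  StarSubalgebra.le_topologicalClosure _ (StarAlgebra.subset_adjoin ℂ _ ⟨x, Or.inr rfl⟩)

theorem flip_mem (F : Finset Edge) : (flipX F : B₀) ∈ quasiLocal := by
  induction F using Finset.induction_on with
  | empty =>
    convert one_mem quasiLocal
    refine ContinuousLinearMap.ext fun ψ => lp.ext (funext fun c => ?_)
    rw [flip_apply, ← Finset.bot_eq_empty, symmDiff_bot]
    rfl
  | insert x F hx ih =>
    convert mul_mem (σX_mem x) ih
    refine ContinuousLinearMap.ext fun ψ => lp.ext (funext fun c => ?_)
    change (flipX _ : B₀) ψ c = (flipX {x} : B₀) ((flipX F : B₀) ψ) c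
    rw [flip_apply, flip_apply, flip_apply, symmDiff_assoc]
    have h2 : symmDiff {x} F = insert x F := by
      rw [Disjoint.symmDiff_eq_sup (Finset.disjoint_singleton_left.2 hx)]
      rfl
    rw [h2]

theorem diag_prod_mem (P : Finset Dart) (f : Dart → Config → Circle)
    (h : ∀ d, (diag (f d) : B₀) ∈ quasiLocal) :
    (diag (fun c => ∏ d ∈ P, f d c) : B₀) ∈ quasiLocal := by
  induction P using Finset.induction_on with
  | empty =>
    convert one_mem quasiLocal
    refine ContinuousLinearMap.ext fun ψ => lp.ext (funext fun c => ?_)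
    rw [diag_apply]
    simp
  | insert x F hx ih =>
    convert mul_mem (h x) ih
    refine ContinuousLinearMap.ext fun ψ => lp.ext (funext fun c => ?_)
    change (diag _ : B₀) ψ c = (diag (f x) : B₀) ((diag _ : B₀) ψ) c
    rw [diag_apply, diag_apply, diag_apply, Finset.prod_insert hx, Circle.coe_mul, mul_assoc]

theorem diag_one_mem : (diag (fun _ => 1) : B₀) ∈ quasiLocal := by
  convert one_mem quasiLocal
  refine ContinuousLinearMap.ext fun ψ => lp.ext (funext fun c => ?_)
  rw [diag_apply]
  simp

open Classical in
theorem diag_leg_mem (z : Circle) (y : Edge) :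
    (diag (fun c => if y ∈ c then z else 1) : B₀) ∈ quasiLocal := by
  have h : (diag (fun c => if y ∈ c then z else 1) : B₀) =
      ((1 + (z : ℂ)) / 2) • (1 : B₀) + ((1 - (z : ℂ)) / 2) • (σZ y : B₀) := by
    refine ContinuousLinearMap.ext fun ψ => lp.ext (funext fun c => ?_)
    change (diag _ : B₀) ψ c = ((1 + (z : ℂ)) / 2) * ψ c + ((1 - (z : ℂ)) / 2) * (σZ y : B₀) ψ c
    rw [σZ, diag_apply, diag_apply]
    split_ifs <;> simp <;> ring
  rw [h]
  exact add_mem (SMulMemClass.smul_mem _ (one_mem _)) (SMulMemClass.smul_mem _ (σZ_mem y))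

open Classical in
theorem diag_vertex_mem (y z : Edge) :
    (diag (fun c => if y ∈ c ∧ z ∉ c then -1 else 1) : B₀) ∈ quasiLocal := by
  have h : (diag (fun c => if y ∈ c ∧ z ∉ c then -1 else 1) : B₀) =
      1 - (1 / 2 : ℂ) • ((1 - (σZ y : B₀)) * (1 + (σZ z : B₀))) := by
    refine ContinuousLinearMap.ext fun ψ => lp.ext (funext fun c => ?_)
    change (diag _ : B₀) ψ c = ψ c - (1 / 2 : ℂ) *
      ((ψ c + (σZ z : B₀) ψ c) - (σZ y : B₀) (ψ + (σZ z : B₀) ψ) c)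
    rw [σZ, σZ, diag_apply, diag_apply, diag_apply]
    change _ = ψ c - (1 / 2 : ℂ) * ((ψ c + _) - _ * (ψ c + (diag _ : B₀) ψ c))
    rw [diag_apply]
    by_cases hy : y ∈ c <;> by_cases hz : z ∈ c <;> simp [hy, hz]; ring
  rw [h]
  exact sub_mem (one_mem _) (SMulMemClass.smul_mem _
    (mul_mem (sub_mem (one_mem _) (σZ_mem y)) (add_mem (one_mem _) (σZ_mem z))))

open Classical in
/-- The string operators are local observables. -/
theorem stringOperator_mem (a : Anyon) (P : Finset Dart) :
    (stringOperator a P : B₀) ∈ quasiLocal := by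
  refine mul_mem (mul_mem (flip_mem _) (diag_prod_mem _ _ fun d => ?_))
    (diag_prod_mem _ _ fun d => ?_)
  · by_cases h : Dart.turnLeft d ∈ P
    · simpa only [h, true_and] using diag_leg_mem _ _
    · simpa only [h, false_and, if_false] using diag_one_mem
  · by_cases h : a.isSemionic ∧ Dart.turnRight d ∈ P
    · simpa only [h.1, h.2, true_and] using diag_vertex_mem _ _
    · simpa only [← and_assoc, h, false_and, if_false] using diag_one_mem

open Classical in
/-- The part of the (possibly infinite) path `P` inside a finite set of oriented edges. -/
def truncate (P : Set Dart) (F : Finset Dart) : Finset Dart := F.filter (· ∈ P)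

theorem exists_limit_generator (a : Anyon) (P : Set Dart) {T : B₀}
    (hT : ∃ x, T = σX x ∨ T = σZ x) :
    (∃ L, Filter.Tendsto (fun F => (stringOperator a (truncate P F) : B₀) * T *
        star (stringOperator a (truncate P F) : B₀)) Filter.atTop (𝓝 L)) ∧
      ∃ L, Filter.Tendsto (fun F => star (stringOperator a (truncate P F) : B₀) * T *
        (stringOperator a (truncate P F) : B₀)) Filter.atTop (𝓝 L) := by
  obtain ⟨x, hx⟩ := hT
  have h : ∀ F, (finite_hood x).toFinset ≤ F →
      ∀ d ∈ hood x, (d ∈ truncate P (finite_hood x).toFinset ↔ d ∈ truncate P F) := by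
    intro F hF d hd
    have h1 : d ∈ (finite_hood x).toFinset := (Set.Finite.mem_toFinset _).2 hd
    simp [truncate, hd, hF h1]
  constructor
  · refine ⟨(stringOperator a (truncate P (finite_hood x).toFinset) : B₀) * T *
        star (stringOperator a (truncate P (finite_hood x).toFinset) : B₀),
      tendsto_const_nhds.congr' ?_⟩
    filter_upwards [Filter.eventually_ge_atTop (finite_hood x).toFinset] with F hF
    exact (conj_congr a (h F hF) hx).1
  · refine ⟨star (stringOperator a (truncate P (finite_hood x).toFinset) : B₀) * T *
        (stringOperator a (truncate P (finite_hood x).toFinset) : B₀),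
      tendsto_const_nhds.congr' ?_⟩
    filter_upwards [Filter.eventually_ge_atTop (finite_hood x).toFinset] with F hF
    exact (conj_congr a (h F hF) hx).2

/-- The automorphism `w_a[P]` of the quasi-local algebra: conjugation by the (for infinite `P`
formal) unitary `W_a[P]`, that is, the pointwise norm limit of the conjugations by the string
operators of the finite parts of `P`. -/
def stringAut (a : Anyon) (P : Set Dart) : 𝒜 ≃⋆ₐ[ℂ] 𝒜 :=
  conjLimitAut (u := fun F => stringOperator a (truncate P F)) (l := Filter.atTop)
    quasiLocal isClosed_quasiLocal (fun _ => stringOperator_mem _ _)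
    (exists_conjLimit fun _ hT => (exists_limit_generator a P hT).1)
    (exists_conjLimit fun _ hT => by
      simpa only [Unitary.coe_star, star_star] using (exists_limit_generator a P hT).2)

/-! ### Cones and the half-infinite paths along their axes -/

/-- The plane `ℝ²`. -/
abbrev Plane := EuclideanSpace ℝ (Fin 2)

/-- The centre of a hexagon; the edges of the lattice have length `1`, and the centres of the six
neighbours of a hexagon lie at distance `√3` in the directions `30°, 90°, …, 330°`. -/
def center (h : Hexagon) : Plane :=
  !₂[(3 / 2 : ℝ) * (h.1 : ℝ), Real.sqrt 3 * ((h.2 : ℝ) + (h.1 : ℝ) / 2)]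

/-- A hexagon as an open subset of the plane: the points that are closer to its centre than to the
centre of any neighbour. -/
def openHexagon (h : Hexagon) : Set Plane :=
  {x | ∀ k, dist x (center h) < dist x (center (h + dir k))}

/-- The midpoint of an edge. -/
def Dart.mid (d : Dart) : Plane := midpoint ℝ (center (Dart.left d)) (center (Dart.right d))

/-- `Π_S`: the set of hexagons that overlap with `S`. -/
def overlapping (S : Set Plane) : Set Hexagon := {h | (openHexagon h ∩ S).Nonempty}

/-- The cone with apex `p`, axis `v` (a unit vector) and opening angle `θ`. -/
def cone (p v : Plane) (θ : ℝ) : Set Plane :=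
  {x | ‖x - p‖ * Real.cos (θ / 2) < ⟪x - p, v⟫_ℝ}

/-- Counterclockwise rotation by the angle `φ`. -/
def rotate (φ : ℝ) (v : Plane) : Plane :=
  !₂[Real.cos φ * v 0 - Real.sin φ * v 1, Real.sin φ * v 0 + Real.cos φ * v 1]

/-- For a cone `Λ` with opening angle less than `π` and `n > 2`: the half-infinite path
`P^{(n)}_{Λ,+}` along the left leg of `Λ`. It consists of the edges of `∂Π_Λ` whose midpoint is
further than `n` from the apex and lies to the left of the axis. -/
def leftLegPath (p v : Plane) (θ n : ℝ) : Set Dart :=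
  {d | d ∈ orientedBoundary (overlapping (cone p v θ)) ∧ n < dist (Dart.mid d) p ∧
    0 < v 0 * (Dart.mid d - p) 1 - v 1 * (Dart.mid d - p) 0}

/-- The path `P_Λ = P^{(n)}_{Λ^{(R)},+}`, which follows the axis of `Λ`: the left-leg path of the
right half-cone `Λ^{(R)}` of `Λ`, which has the same apex, an axis turned clockwise by `θ/4`, and
opening angle `θ/2`. -/
def axisPath (p v : Plane) (θ n : ℝ) : Set Dart :=
  leftLegPath p (rotate (-(θ / 4)) v) (θ / 2) n

/-! ### Sectors -/

/-- The representation `π_a = π₁ ∘ w_{a,Λ}`, where `π₁` is the GNS representation of `ω` and `Λ` is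
the cone with apex `p`, axis `v` and opening angle `θ`. -/
def sector (ω : 𝒜 →ₚ[ℂ] ℂ) (p v : Plane) (θ n : ℝ) (a : Anyon) :
    𝒜 →⋆ₐ[ℂ] (ω.GNS →L[ℂ] ω.GNS) :=
  ω.gnsStarAlgHom.comp (stringAut a (axisPath p v θ n) : 𝒜 →⋆ₐ[ℂ] 𝒜)

/-- Unitary equivalence of representations. -/
def UnitarilyEquivalent {H K : Type*} [NormedAddCommGroup H] [InnerProductSpace ℂ H]
    [CompleteSpace H] [NormedAddCommGroup K] [InnerProductSpace ℂ K] [CompleteSpace K]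
    (π : 𝒜 →⋆ₐ[ℂ] (H →L[ℂ] H)) (ρ : 𝒜 →⋆ₐ[ℂ] (K →L[ℂ] K)) : Prop :=
  ∃ U : H ≃ₗᵢ[ℂ] K, ∀ (O : 𝒜) (ψ : H), U (π O ψ) = ρ O (U ψ)

end DoubleSemion

end

/-!
The proof rests on one combinatorial fact: the parity of the number of strings `♯Π` is that of the
Euler characteristic of `Π`, a sum of local terms (`stringSign_eq`). To see it, one walks along the
boundary: the oriented edges with a hexagon of `Π` on their left are permuted by reversing inner
edges and then turning around the hexagon on the left. The cycles of this permutation `walk` are the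
strings of `∂Π` and short cycles around inner vertices, so that its sign is `(-1)^{♯Π}` up to the
parity of the number of these vertices (`sign_walk`); it is also a product of two permutations whose
signs count hexagons and inner edges. Consequently, flipping one hexagon changes `(-1)^{♯Π}` by a
factor that depends only on which of its six neighbours belong to `Π`, and that is unchanged when
these neighbours are complemented (`stringSign_symmDiff_singleton`, `flipSign_not`). Hence the
relative sign `(-1)^{♯Π + ♯(Π ∆ T)}` depends only on the part of `Π` in the collar of `T`
(`relSign_congr`), and it is unchanged when `Π` is complemented in a large region
(`relSign_symmDiff_of_disjoint`).

Existence of the state. Local observables are linear combinations of monomials: a flip of finitely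
many edges times a diagonal unitary that depends on finitely many edges. If the flipped edges are
not a boundary, the expectation value of the monomial in `Ω_n` vanishes. If they are `∂T`, it is the
average over `Π ⊆ Π_n` of a relative sign times a phase, a function of finitely many hexagons of
`Π`, and so it does not depend on `n` once `n` is large (`exists_tendsto_of_mem_monomials`). Density
of the local observables does the rest.

Inequivalence of the sectors. Suppose that arbitrarily far away there are unitaries `L` that fix
`Ω_n` for large `n`, and which two automorphisms multiply by opposite signs. Then the two sectors
are inequivalent (`not_unitarilyEquivalent`): every vector of the GNS space is approximated by `X Ω`
with `X` local, and `L X Ω = X L Ω = X Ω` if `L` is far from `X`, whereas an intertwining unitary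
would send the GNS vector to an eigenvector of `L` for the eigenvalue `-1`. Two kinds of loops
around a large box are used. The product of the `σᶻ` crossed by a loop is `1` on all boundaries, and
it changes sign under the semion and the antisemion, whose string crosses the loop once
(`not_unitarilyEquivalent_of_isSemionic`). The product of the `σˣ` around the box, with phases that
make it fix `Ω_n`, changes sign under the bound state, one of whose legs lies on the loop
(`not_unitarilyEquivalent_vacuum_bound`). The phases are relative signs, and they can be chosen to
depend only on the edges of an annulus, since the occupied edges of the annulus determine `Π` there
up to complementation (`relSign_box_congr`). Finally, the automorphism of the antisemion is the
composite of those of the semion and the bound state (`stringAut_antisemion`), which reduces semion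
against antisemion to vacuum against bound state.

The path along the axis of the cone is a vertical zigzag between two columns of hexagons
(`exists_axisPath_eq_rayPath`), and the loops are only compared with such zigzags.
-/

noncomputable section

namespace DoubleSemion

/-! ### Signs and numbers of cycles -/

section Sign

open Equiv

variable {α C : Type*} [Fintype α] [DecidableEq α] [Fintype C]

/-- The sign of a permutation without fixed points is the parity of its degree plus the number of
its cycles, which are labelled here by the elements of `C`. -/
theorem sign_eq_neg_one_pow_card_add (σ : Perm α) (hσ : ∀ x, σ x ≠ x) (f : α → C)
    (hf : Function.Surjective f) (h : ∀ x y, f x = f y ↔ σ.SameCycle x y) :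
    Perm.sign σ = (-1) ^ (Fintype.card α + Fintype.card C) := by
  classical
  have hsupp : σ.support = Finset.univ := by
    ext x; simp [hσ x]
  obtain ⟨s, hs⟩ := hf.hasRightInverse
  have hC : (Finset.univ : Finset C).card = σ.cycleFactorsFinset.card := by
    refine Finset.card_bij (fun c _ => σ.cycleOf (s c)) (fun c _ => ?_) (fun c _ d _ hcd => ?_) ?_
    · exact Perm.cycleOf_mem_cycleFactorsFinset_iff.2 (by simp [hsupp])
    · rw [← hs c, ← hs d, h]
      exact (Perm.sameCycle_iff_cycleOf_eq_of_mem_support (by simp [hsupp]) (by simp [hsupp])).2 hcd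
    · intro τ hτ
      have hcyc := (Perm.mem_cycleFactorsFinset_iff.1 hτ).1
      obtain ⟨x, hx⟩ := hcyc.nonempty_support
      refine ⟨f x, Finset.mem_univ _, ?_⟩
      rw [Perm.cycle_is_cycleOf hx hτ]
      exact Perm.SameCycle.cycleOf_eq ((h _ _).1 (hs (f x)))
  have h1 : Multiset.card σ.cycleType = Fintype.card C := by
    rw [Perm.cycleType_def, Multiset.card_map]
    exact hC.symm
  rw [Perm.sign_of_cycleType, Perm.sum_cycleType, h1, hsupp]
  rfl

/-- If the cube of `σ` fixes all points outside an invariant set, then these points do not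
contribute to the sign of `σ`. -/
theorem sign_eq_sign_subtypePerm (σ : Perm α) (p : α → Prop) [DecidablePred p]
    (hp : ∀ x, p (σ x) ↔ p x) (h3 : ∀ x, ¬ p x → σ (σ (σ x)) = x) :
    Perm.sign σ = Perm.sign (σ.subtypePerm hp) := by
  have hn : ∀ x, ¬ p (σ x) ↔ ¬ p x := fun x => not_congr (hp x)
  have h1 : σ = (σ.subtypePerm hp).subtypeCongr (σ.subtypePerm (p := fun x => ¬ p x) hn) := by
    ext x
    by_cases hx : p x
    · rw [Perm.subtypeCongr.left_apply _ _ hx]; rfl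
    · rw [Perm.subtypeCongr.right_apply _ _ hx]; rfl
  have h2 : (σ.subtypePerm (p := fun x => ¬ p x) hn) ^ 3 = 1 := by
    ext x
    exact h3 x x.2
  have h4 : Perm.sign (σ.subtypePerm (p := fun x => ¬ p x) hn) = 1 := by
    have h5 : Perm.sign (σ.subtypePerm (p := fun x => ¬ p x) hn) ^ 3 = 1 := by
      rw [← map_pow, h2, map_one]
    rcases Int.units_eq_one_or (Perm.sign (σ.subtypePerm (p := fun x => ¬ p x) hn)) with h | h
    · exact h
    · rw [h] at h5
      exact absurd h5 (by decide)
  conv_lhs => rw [h1]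
  rw [Perm.sign_subtypeCongr, h4, mul_one]

/-- The sign of an involution. -/
theorem sign_of_involutive (σ : Perm α) (hσ : ∀ x, σ (σ x) = x) (m : ℕ)
    (hm : σ.support.card = 2 * m) : Perm.sign σ = (-1) ^ m := by
  have h2 : σ ^ 2 = 1 := by
    ext x
    exact hσ x
  have : Fact (Nat.Prime 2) := ⟨Nat.prime_two⟩
  have hc := Perm.cycleType_of_pow_prime_eq_one h2
  have hs := σ.sum_cycleType
  rw [hc, Multiset.sum_replicate, smul_eq_mul, hm, mul_comm] at hs
  have hk : Multiset.card σ.cycleType = m := by omega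
  rw [Perm.sign_of_cycleType, hc, Multiset.sum_replicate, Multiset.card_replicate, hk, smul_eq_mul,
    mul_comm, pow_add, pow_mul]
  simp

end Sign

/-! ### The parity of the number of strings -/

theorem dir_add_three : ∀ k, dir (k + 3) = -dir k := by decide

theorem dir_injective : Function.Injective dir := by
  unfold Function.Injective; decide

theorem dir_add_one_add_dir_sub_one : ∀ k, dir (k + 1) + dir (k - 1) = dir k := by decide

theorem edge_eq_edge_iff {d d' : Dart} : Dart.edge d = Dart.edge d' ↔
    (Dart.left d = Dart.left d' ∧ Dart.right d = Dart.right d') ∨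
      (Dart.left d = Dart.right d' ∧ Dart.right d = Dart.left d') := by
  unfold Dart.edge
  rw [Subtype.mk.injEq, Sym2.eq_iff]

theorem dart_ext {d d' : Dart} (h1 : Dart.left d = Dart.left d')
    (h2 : Dart.right d = Dart.right d') : d = d' := by
  obtain ⟨h, k⟩ := d
  obtain ⟨h', k'⟩ := d'
  simp only [Dart.left, Dart.right] at h1 h2
  subst h1
  rw [dir_injective (add_left_cancel h2)]

theorem edge_mem_boundary {S : Finset Hexagon} {d : Dart} : Dart.edge d ∈ boundary S ↔
    ¬ (Dart.left d ∈ S ↔ Dart.right d ∈ S) := by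
  unfold boundary
  simp only [Finset.mem_image, Finset.mem_filter, Finset.mem_product, Finset.mem_univ, and_true]
  constructor
  · rintro ⟨d', ⟨h1, h2⟩, h3⟩
    rcases edge_eq_edge_iff.1 h3 with ⟨h4, h5⟩ | ⟨h4, h5⟩
    · rw [← h4, ← h5]
      exact fun h => h2 (h.1 h1)
    · rw [← h4, ← h5]
      exact fun h => h2 (h.2 h1)
  · intro h
    by_cases hl : Dart.left d ∈ S
    · exact ⟨d, ⟨hl, fun hr => h ⟨fun _ => hr, fun _ => hl⟩⟩, rfl⟩
    · have hr : Dart.right d ∈ S := by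
        by_contra hr
        exact h ⟨fun h => absurd h hl, fun h => absurd h hr⟩
      have e : d.1 + dir d.2 + dir (d.2 + 3) = d.1 := by rw [dir_add_three]; abel
      refine ⟨(d.1 + dir d.2, d.2 + 3), ⟨hr, ?_⟩, ?_⟩
      · change d.1 + dir d.2 + dir (d.2 + 3) ∉ S
        rwa [e]
      · rw [edge_eq_edge_iff]
        exact Or.inr ⟨rfl, e⟩

/-- An edge of `∂S` has only one orientation with `S` on its left. -/
theorem eq_of_edge_eq {S : Finset Hexagon} {d d' : Dart} (h : Dart.edge d = Dart.edge d')
    (h1 : Dart.left d ∈ S) (h2 : Dart.right d' ∉ S) : d = d' := by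
  rcases edge_eq_edge_iff.1 h with ⟨h4, h5⟩ | ⟨h4, h5⟩
  · exact dart_ext h4 h5
  · exact absurd (h4 ▸ h1) h2

section Walk

variable (S : Finset Hexagon)

/-- The oriented edges with a hexagon of `S` on their left. -/
abbrev DartOf := {h // h ∈ S} × Fin 6

variable {S}

/-- Forget that the hexagon on the left lies in `S`. -/
def DartOf.dart (d : DartOf S) : Dart := (d.1.1, d.2)

theorem DartOf.dart_injective : Function.Injective (DartOf.dart (S := S)) := by
  rintro ⟨⟨h, hS⟩, k⟩ ⟨⟨h', hS'⟩, k'⟩ e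
  simpa [DartOf.dart] using e

variable (S)

/-- The involution that reverses the oriented edges between two hexagons of `S` and fixes those of
the boundary of `S`. -/
def reverseInner : Equiv.Perm (DartOf S) :=
  Function.Involutive.toPerm
    (fun d => if h : Dart.right d.dart ∈ S then (⟨_, h⟩, d.2 + 3) else d) (by
      intro d
      dsimp only
      split_ifs with h1 h2
      · refine DartOf.dart_injective (Prod.ext ?_ ?_)
        · change d.1.1 + dir d.2 + dir (d.2 + 3) = d.1.1
          rw [dir_add_three]; abel
        · change d.2 + 3 + 3 = d.2
          rw [add_assoc]; exact add_zero _
      · exfalso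
        apply h2
        change d.1.1 + dir d.2 + dir (d.2 + 3) ∈ S
        rw [dir_add_three, add_neg_cancel_right]
        exact d.1.2
      · rfl)

/-- The permutation that turns every oriented edge counterclockwise around the hexagon on its
left. -/
def turnAround : Equiv.Perm (DartOf S) := Equiv.prodCongrRight fun _ => Equiv.addRight 1

/-- The permutation that reverses an oriented edge if it is an inner one, and then turns it around
the hexagon on its left. It moves along the boundary of `S` (with an intermediate step at the
inner edge wherever the boundary turns right) and around the inner vertices of `S`. -/
def walk : Equiv.Perm (DartOf S) := turnAround S * reverseInner S

variable {S}

theorem walk_of_right_notMem {d : DartOf S} (h : Dart.right d.dart ∉ S) :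
    (walk S d).dart = Dart.turnLeft d.dart := by
  have : reverseInner S d = d := dif_neg h
  rw [walk, Equiv.Perm.mul_apply, this]
  rfl

theorem walk_of_right_mem {d : DartOf S} (h : Dart.right d.dart ∈ S) :
    (walk S d).dart = (Dart.right d.dart, d.2 + 4) := by
  have : reverseInner S d = (⟨_, h⟩, d.2 + 3) := dif_pos h
  rw [walk, Equiv.Perm.mul_apply, this]
  change ((Dart.right d.dart, d.2 + 3 + 1) : Dart) = _
  rw [add_assoc]
  rfl

/-- `d` starts at a vertex of the boundary of `S`: of the two hexagons other than the one on its
left that meet at its tail, at least one does not belong to `S`. -/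
def OnBoundary (d : DartOf S) : Prop :=
  ¬ (Dart.right d.dart ∈ S ∧ d.1.1 + dir (d.2 - 1) ∈ S)

instance : DecidablePred (OnBoundary (S := S)) := fun _ => inferInstanceAs (Decidable (¬ _))

theorem right_walk_of_right_mem {d : DartOf S} (h : Dart.right d.dart ∈ S) :
    Dart.right (walk S d).dart = d.1.1 + dir (d.2 - 1) := by
  rw [walk_of_right_mem h]
  change d.1.1 + dir d.2 + dir (d.2 + 4) = _
  rw [add_assoc]
  congr 1
  generalize d.2 = k
  revert k
  decide

theorem tail_walk_of_right_mem {d : DartOf S} (h : Dart.right d.dart ∈ S) :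
    (walk S d).1.1 + dir ((walk S d).2 - 1) = d.1.1 := by
  have e := walk_of_right_mem h
  have e1 : (walk S d).1.1 = Dart.right d.dart := congrArg Prod.fst e
  have e2 : (walk S d).2 = d.2 + 4 := congrArg Prod.snd e
  rw [e1, e2]
  change d.1.1 + dir d.2 + dir (d.2 + 4 - 1) = _
  rw [add_assoc]
  convert add_zero _
  generalize d.2 = k
  revert k
  decide

theorem tail_walk_of_right_notMem {d : DartOf S} (h : Dart.right d.dart ∉ S) :
    (walk S d).1.1 + dir ((walk S d).2 - 1) = Dart.right d.dart := by
  have e := walk_of_right_notMem h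
  have e1 : (walk S d).1.1 = d.1.1 := congrArg Prod.fst e
  have e2 : (walk S d).2 = d.2 + 1 := congrArg Prod.snd e
  rw [e1, e2, add_sub_cancel_right]
  rfl

theorem onBoundary_walk (d : DartOf S) : OnBoundary (walk S d) ↔ OnBoundary d := by
  unfold OnBoundary
  rw [not_iff_not]
  by_cases h : Dart.right d.dart ∈ S
  · rw [right_walk_of_right_mem h, tail_walk_of_right_mem h]
    exact ⟨fun h' => ⟨h, h'.1⟩, fun h' => ⟨h'.2, d.1.2⟩⟩
  · rw [tail_walk_of_right_notMem h]
    exact ⟨fun h' => absurd h'.2 h, fun h' => absurd h'.1 h⟩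

theorem walk_ne (d : DartOf S) : walk S d ≠ d := by
  intro e
  by_cases h : Dart.right d.dart ∈ S
  · have := congrArg Prod.snd (walk_of_right_mem h)
    rw [e] at this
    change d.2 = d.2 + 4 at this
    rw [left_eq_add] at this
    exact absurd this (by decide)
  · have := congrArg Prod.snd (walk_of_right_notMem h)
    rw [e] at this
    change d.2 = d.2 + 1 at this
    rw [left_eq_add] at this
    exact absurd this (by decide)

/-- Away from the boundary, `walk S` goes around a vertex. -/
theorem walk_walk_walk {d : DartOf S} (h : ¬ OnBoundary d) :
    walk S (walk S (walk S d)) = d := by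
  have hr : ∀ {d : DartOf S}, ¬ OnBoundary d → Dart.right d.dart ∈ S :=
    fun h => (not_not.1 h).1
  have h1 : ¬ OnBoundary (walk S d) := by rwa [onBoundary_walk]
  have h2 : ¬ OnBoundary (walk S (walk S d)) := by rwa [onBoundary_walk]
  have e1 := walk_of_right_mem (hr h)
  have e2 := walk_of_right_mem (hr h1)
  have e3 := walk_of_right_mem (hr h2)
  have k1 : (walk S d).2 = d.2 + 4 := congrArg Prod.snd e1
  have k2 : (walk S (walk S d)).2 = d.2 + 4 + 4 := by rw [← k1]; exact congrArg Prod.snd e2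
  refine DartOf.dart_injective ?_
  rw [e3, e2, e1, k2]
  refine Prod.ext ?_ ?_
  · change d.1.1 + dir d.2 + dir (d.2 + 4) + dir ((walk S d).2 + 4) = d.1.1
    rw [k1, add_assoc, add_assoc]
    convert add_zero _
    generalize d.2 = k
    revert k
    decide
  · change d.2 + 4 + 4 + 4 = d.2
    generalize d.2 = k
    revert k
    decide

theorem sameCycle_of_walk_eq {d d' : DartOf S} (h : walk S d = d') : (walk S).SameCycle d d' :=
  ⟨1, by simpa using h⟩

theorem edge_mem_boundary_of_right_notMem {d : DartOf S} (h : Dart.right d.dart ∉ S) :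
    Dart.edge d.dart ∈ boundary S :=
  edge_mem_boundary.2 fun h' => h (h'.1 d.1.2)

/-- The edge of the boundary along which `walk S` has arrived at `d`. -/
def lastDart (d : DartOf S) : DartOf S :=
  if Dart.right d.dart ∈ S then (d.1, d.2 - 1) else d

theorem right_lastDart {d : DartOf S} (hd : OnBoundary d) :
    Dart.right (lastDart d).dart ∉ S := by
  unfold lastDart
  split_ifs with h
  · exact fun h' => hd ⟨h, h'⟩
  · exact h

theorem walk_lastDart {d : DartOf S} (hd : OnBoundary d) (h : Dart.right d.dart ∈ S) :
    walk S (lastDart d) = d := by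
  refine DartOf.dart_injective ?_
  rw [walk_of_right_notMem (right_lastDart hd), lastDart, if_pos h]
  refine Prod.ext rfl ?_
  exact sub_add_cancel _ _

theorem sameCycle_lastDart {d : DartOf S} (hd : OnBoundary d) :
    (walk S).SameCycle (lastDart d) d := by
  by_cases h : Dart.right d.dart ∈ S
  · exact sameCycle_of_walk_eq (walk_lastDart hd h)
  · rw [lastDart, if_neg h]

/-- The string that `walk S` follows. -/
def component (d : {d : DartOf S // OnBoundary d}) :
    (stringGraph (boundary S)).ConnectedComponent :=
  (stringGraph (boundary S)).connectedComponentMk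
    ⟨Dart.edge (lastDart d.1).dart, edge_mem_boundary_of_right_notMem (right_lastDart d.2)⟩

theorem reachable_of_turn {c : Finset Edge} {e e' : {e : Edge // e ∈ c}} {d : Dart}
    (h : Dart.edge d = e) (h' : Dart.edge (Dart.turnLeft d) = e' ∨
      Dart.edge (Dart.turnRight d) = e') : (stringGraph c).Reachable e e' := by
  by_cases hne : e = e'
  · rw [hne]
  · exact SimpleGraph.Adj.reachable ((SimpleGraph.fromRel_adj _ _ _).2 ⟨hne, Or.inl ⟨d, h, h'⟩⟩)

theorem component_walk (d : {d : DartOf S // OnBoundary d}) :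
    component (⟨walk S d.1, (onBoundary_walk d.1).2 d.2⟩ : {d : DartOf S // OnBoundary d})
      = component d := by
  obtain ⟨d, hd⟩ := d
  unfold component
  rw [SimpleGraph.ConnectedComponent.eq]
  refine SimpleGraph.Reachable.symm ?_
  by_cases h : Dart.right d.dart ∈ S
  · have h2 : Dart.right (walk S d).dart ∉ S := by
      rw [right_walk_of_right_mem h]
      exact fun h' => hd ⟨h, h'⟩
    refine reachable_of_turn rfl (Or.inr (congrArg Dart.edge ?_))
    dsimp only
    rw [lastDart, if_pos h, lastDart, if_neg h2, walk_of_right_mem h]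
    refine Prod.ext ?_ ?_
    · change d.1.1 + dir (d.2 - 1 + 1) = d.1.1 + dir d.2
      rw [sub_add_cancel]
    · change d.2 - 1 - 1 = d.2 + 4
      generalize d.2 = k
      revert k
      decide
  · by_cases h2 : Dart.right (walk S d).dart ∈ S
    · have : lastDart (walk S d) = lastDart d := by
        refine (walk S).injective ?_
        rw [walk_lastDart ((onBoundary_walk d).2 hd) h2, lastDart, if_neg h]
      simp only [this]
      exact SimpleGraph.Reachable.refl _
    · refine reachable_of_turn rfl (Or.inl (congrArg Dart.edge ?_))
      dsimp only
      rw [lastDart, if_neg h, lastDart, if_neg h2, walk_of_right_notMem h]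

theorem component_eq_of_sameCycle {d d' : {d : DartOf S // OnBoundary d}}
    (h : (walk S).SameCycle d.1 d'.1) : component d = component d' := by
  obtain ⟨n, -, -, hn⟩ := h.exists_pow_eq''
  suffices ∀ n : ℕ, ∀ d' : {d : DartOf S // OnBoundary d}, (walk S ^ n) d.1 = d'.1 →
      component d = component d' from this n d' hn
  intro n
  induction n with
  | zero => exact fun d' h => congrArg component (Subtype.ext h)
  | succ n ih =>
    intro d' h
    rw [pow_succ', Equiv.Perm.mul_apply] at h
    have h1 : OnBoundary ((walk S ^ n) d.1) := by
      rw [← onBoundary_walk, h]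
      exact d'.2
    rw [ih ⟨_, h1⟩ rfl, ← component_walk]
    exact congrArg component (Subtype.ext h)

/-- Consecutive edges of a string belong to the same cycle of `walk S`: at the common vertex
the boundary turns left or right, and it runs either from the first edge to the second or back. -/
theorem sameCycle_of_turn {d d' : DartOf S} (hd : Dart.right d.dart ∉ S)
    (hd' : Dart.right d'.dart ∉ S) {x : Dart} (hx : Dart.edge x = Dart.edge d.dart)
    (hx' : Dart.edge (Dart.turnLeft x) = Dart.edge d'.dart ∨
      Dart.edge (Dart.turnRight x) = Dart.edge d'.dart) : (walk S).SameCycle d d' := by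
  have key : ∀ {d d' : DartOf S}, Dart.right d.dart ∉ S → Dart.right d'.dart ∉ S →
      (Dart.turnLeft d.dart = d'.dart ∨ Dart.turnRight d.dart = d'.dart) →
      (walk S).SameCycle d d' := by
    intro d d' hd hd' h
    rcases h with h | h
    · exact sameCycle_of_walk_eq (DartOf.dart_injective ((walk_of_right_notMem hd).trans h))
    · have e := walk_of_right_notMem hd
      have hr : Dart.right (walk S d).dart ∈ S := by
        rw [e]
        have h1 : d'.1.1 = Dart.right (Dart.turnLeft d.dart) := (congrArg Prod.fst h).symm
        exact h1 ▸ d'.1.2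
      refine (sameCycle_of_walk_eq rfl).trans (sameCycle_of_walk_eq (d := walk S d)
        (DartOf.dart_injective ?_))
      rw [walk_of_right_mem hr, ← h, e]
      have k1 : (walk S d).2 = d.2 + 1 := congrArg Prod.snd e
      refine Prod.ext rfl ?_
      change (walk S d).2 + 4 = d.2 - 1
      rw [k1]
      generalize d.2 = k
      revert k
      decide
  obtain ⟨a, j⟩ := x
  -- the hexagon in front of `x`
  set f : Hexagon := a + dir (j + 1) with hf
  have e0 : f + dir (j - 1) = a + dir j := by
    rw [hf, add_assoc, dir_add_one_add_dir_sub_one]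
  rcases edge_eq_edge_iff.1 hx with ⟨h1, h2⟩ | ⟨h1, h2⟩
  · have hxd : ((a, j) : Dart) = d.dart := dart_ext h1 h2
    rw [hxd] at hx'
    refine key hd hd' (hx'.imp (fun h => ?_) fun h => ?_)
    · exact eq_of_edge_eq h d.1.2 hd'
    · refine (eq_of_edge_eq h.symm d'.1.2 ?_).symm
      rw [← hxd]
      change f + dir (j - 1) ∉ S
      rw [e0]
      rw [← hxd] at hd
      exact hd
  · -- here `x` is the reverse of `d`, and the boundary runs from `d'` to `d`
    refine Equiv.Perm.SameCycle.symm (key hd' hd ?_)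
    have hb : a + dir j = d.1.1 := h2
    have ha : a = Dart.right d.dart := h1
    have hk : d.2 = j + 3 := by
      have : d.1.1 + dir d.2 = d.1.1 + dir (j + 3) := by
        rw [dir_add_three, ← hb, add_neg_cancel_right, hb]
        exact ha.symm
      exact dir_injective (add_left_cancel this)
    have hdd : d.dart = (a + dir j, j + 3) := Prod.ext hb.symm hk
    rcases hx' with h | h
    · right
      have hd1 : d'.dart = (f, j + 4) := by
        refine eq_of_edge_eq (h.symm.trans ?_) d'.1.2 ?_
        · rw [edge_eq_edge_iff]
          refine Or.inr ⟨?_, rfl⟩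
          change a = f + dir (j + 4)
          rw [show j + 4 = j + 1 + 3 by rw [add_assoc]; rfl, dir_add_three, hf,
            add_neg_cancel_right]
        · change f + dir (j + 4) ∉ S
          rw [show j + 4 = j + 1 + 3 by rw [add_assoc]; rfl, dir_add_three, hf,
            add_neg_cancel_right, ha]
          exact hd
      rw [hd1, hdd]
      refine Prod.ext ?_ ?_
      · change f + dir (j + 4 + 1) = a + dir j
        rw [← e0]
        congr 2
        exact (show ∀ j : Fin 6, j + 4 + 1 = j - 1 by decide) j
      · exact (show ∀ j : Fin 6, j + 4 - 1 = j + 3 by decide) j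
    · left
      have hfS : f ∉ S := by
        intro hfS
        have := eq_of_edge_eq h hfS hd'
        have h3 : Dart.right d'.dart = a + dir j := by rw [← this]; exact e0
        exact hd' (h3 ▸ hb ▸ d.1.2)
      have hd1 : d'.dart = (a + dir j, j + 2) := by
        have e3 : a + dir j + dir (j + 2) = f := by
          rw [hf, add_assoc]
          congr 1
          exact (show ∀ j, dir j + dir (j + 2) = dir (j + 1) by decide) j
        refine eq_of_edge_eq (h.symm.trans ?_) d'.1.2 ?_
        · rw [edge_eq_edge_iff]
          exact Or.inr ⟨e3.symm, e0⟩
        · change a + dir j + dir (j + 2) ∉ S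
          rwa [e3]
      rw [hd1, hdd]
      refine Prod.ext rfl ?_
      change j + 2 + 1 = j + 3
      rw [add_assoc]
      rfl

theorem exists_dartOf {e : Edge} (he : e ∈ boundary S) :
    ∃ d : DartOf S, Dart.right d.dart ∉ S ∧ Dart.edge d.dart = e := by
  unfold boundary at he
  simp only [Finset.mem_image, Finset.mem_filter, Finset.mem_product, Finset.mem_univ,
    and_true] at he
  obtain ⟨d, ⟨h1, h2⟩, h3⟩ := he
  exact ⟨(⟨d.1, h1⟩, d.2), h2, h3⟩

theorem sameCycle_of_reachable {e e' : {e : Edge // e ∈ boundary S}}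
    (h : (stringGraph (boundary S)).Reachable e e') {d d' : DartOf S}
    (hd : Dart.right d.dart ∉ S) (hd' : Dart.right d'.dart ∉ S)
    (he : Dart.edge d.dart = e) (he' : Dart.edge d'.dart = e') : (walk S).SameCycle d d' := by
  obtain ⟨w⟩ := h
  induction w generalizing d with
  | nil =>
    rw [DartOf.dart_injective (eq_of_edge_eq (he.trans he'.symm) d.1.2 hd')]
  | cons hadj w ih =>
    rename_i e1 e2 e3
    obtain ⟨d2, hd2, he2⟩ := exists_dartOf e2.2
    refine Equiv.Perm.SameCycle.trans ?_ (ih hd2 he2 he')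
    obtain ⟨-, ⟨x, h1, h2⟩ | ⟨x, h1, h2⟩⟩ := (SimpleGraph.fromRel_adj _ _ _).1 hadj
    · exact sameCycle_of_turn hd hd2 (h1.trans he.symm) (by rwa [he2])
    · exact (sameCycle_of_turn hd2 hd (h1.trans he2.symm) (by rwa [he])).symm

theorem component_eq_iff (d d' : {d : DartOf S // OnBoundary d}) :
    component d = component d' ↔ (walk S).SameCycle d.1 d'.1 := by
  refine ⟨fun h => ?_, component_eq_of_sameCycle⟩
  refine (sameCycle_lastDart d.2).symm.trans (Equiv.Perm.SameCycle.trans ?_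
    (sameCycle_lastDart d'.2))
  exact sameCycle_of_reachable (SimpleGraph.ConnectedComponent.exact h) (right_lastDart d.2)
    (right_lastDart d'.2) rfl rfl

theorem component_surjective : Function.Surjective (component (S := S)) := by
  intro C
  induction C using SimpleGraph.ConnectedComponent.ind with
  | h e =>
    obtain ⟨d, hd, he⟩ := exists_dartOf e.2
    refine ⟨⟨d, fun h => hd h.1⟩, ?_⟩
    unfold component
    congr 1
    refine Subtype.ext ?_
    dsimp only
    rw [lastDart, if_neg hd, he]

variable (S)

/-- The cycles of `walk S` on the boundary correspond to the strings of `∂S`; the others have length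
three and do not contribute to the sign. -/
theorem sign_walk : Equiv.Perm.sign (walk S) =
    (-1) ^ (Fintype.card {d : DartOf S // OnBoundary d} + numStrings (boundary S)) := by
  classical
  rw [sign_eq_sign_subtypePerm (walk S) OnBoundary onBoundary_walk fun _ => walk_walk_walk]
  have : Finite (stringGraph (boundary S)).ConnectedComponent :=
    Finite.of_surjective _ component_surjective
  have := Fintype.ofFinite (stringGraph (boundary S)).ConnectedComponent
  rw [numStrings, Nat.card_eq_fintype_card]
  refine sign_eq_neg_one_pow_card_add _ (fun d h => walk_ne d.1 (congrArg Subtype.val h)) component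
    component_surjective fun d d' => ?_
  rw [component_eq_iff, Equiv.Perm.sameCycle_subtypePerm]

end Walk

/-! ### Flipping a hexagon -/

/-- The amplitude `(-1)^{♯Π}` of the string configuration `∂Π`. -/
def stringSign (S : Finset Hexagon) : ℤˣ := (-1) ^ numStrings (boundary S)

/-- The number of oriented edges between hexagons of `S`. -/
def innerCount (S : Finset Hexagon) : ℕ :=
  ∑ h ∈ S, ∑ k, if h + dir k ∈ S then 1 else 0

/-- Three times the number of vertices at which three hexagons of `S` meet. -/
def cornerCount (S : Finset Hexagon) : ℕ :=
  ∑ h ∈ S, ∑ k, if h + dir k ∈ S ∧ h + dir (k - 1) ∈ S then 1 else 0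

theorem card_filter_dartOf (S : Finset Hexagon) (p : Dart → Prop) [DecidablePred p] :
    (Finset.univ.filter fun d : DartOf S => p d.dart).card =
      ∑ h ∈ S, ∑ k, if p (h, k) then 1 else 0 := by
  rw [Finset.card_filter, Fintype.sum_prod_type]
  exact Finset.sum_coe_sort S fun h => ∑ k, if p (h, k) then 1 else 0

theorem sign_turnAround (S : Finset Hexagon) :
    Equiv.Perm.sign (turnAround S) = (-1) ^ S.card := by
  have : Equiv.Perm.sign (Equiv.addRight (1 : Fin 6)) = -1 := by decide
  rw [turnAround, Equiv.Perm.sign_prodCongrRight, Finset.prod_const, this]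
  simp

theorem reverseInner_reverseInner (S : Finset Hexagon) (d : DartOf S) :
    reverseInner S (reverseInner S d) = d :=
  (reverseInner S).left_inv d

theorem card_support_reverseInner (S : Finset Hexagon) :
    (reverseInner S).support.card = innerCount S := by
  refine Eq.trans ?_ (card_filter_dartOf S fun d => Dart.right d ∈ S)
  congr 1
  ext d
  simp only [Equiv.Perm.mem_support, Finset.mem_filter, Finset.mem_univ, true_and]
  by_cases h : Dart.right d.dart ∈ S
  · have : reverseInner S d = (⟨_, h⟩, d.2 + 3) := dif_pos h
    rw [this]
    refine iff_of_true (fun e => ?_) h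
    have := congrArg Prod.snd e
    dsimp only at this
    rw [add_eq_left] at this
    exact absurd this (by decide)
  · have : reverseInner S d = d := dif_neg h
    exact iff_of_false (fun h' => h' this) h

theorem card_onBoundary_add (S : Finset Hexagon) :
    Fintype.card {d : DartOf S // OnBoundary d} + cornerCount S = 6 * S.card := by
  have h0 : _ = cornerCount S :=
    card_filter_dartOf S fun d => Dart.right d ∈ S ∧ d.1 + dir (d.2 - 1) ∈ S
  rw [← h0, Fintype.card_subtype, add_comm]
  have := Finset.card_filter_add_card_filter_not (s := (Finset.univ : Finset (DartOf S)))
    (fun d : DartOf S => Dart.right d.dart ∈ S ∧ d.dart.1 + dir (d.dart.2 - 1) ∈ S)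
  rw [Finset.card_univ, Fintype.card_prod, Fintype.card_coe, Fintype.card_fin, mul_comm] at this
  exact this

/-- The number of strings in `∂Π` has the same parity as the Euler characteristic of `Π`, that is,
as the sum of the numbers of its hexagons, its inner edges and its inner vertices: both can be read
off from the sign of `walk`. -/
theorem stringSign_eq (S : Finset Hexagon) : ∃ m, innerCount S = 2 * m ∧
    stringSign S = (-1) ^ (S.card + m + cornerCount S) := by
  have h2 : 2 ∣ innerCount S := by
    rw [← card_support_reverseInner]
    exact Equiv.Perm.two_dvd_card_support (Equiv.ext (reverseInner_reverseInner S))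
  obtain ⟨m, hm⟩ := h2
  refine ⟨m, hm, ?_⟩
  have h1 := sign_walk S
  have h3 : Equiv.Perm.sign (walk S) = (-1) ^ (S.card + m) := by
    rw [walk, Equiv.Perm.sign_mul, sign_turnAround, pow_add,
      sign_of_involutive (reverseInner S) (reverseInner_reverseInner S) m
        ((card_support_reverseInner S).trans hm)]
  have h4 : (-1 : ℤˣ) ^ Fintype.card {d : DartOf S // OnBoundary d} =
      (-1) ^ cornerCount S := by
    have h5 : (-1 : ℤˣ) ^ (Fintype.card {d : DartOf S // OnBoundary d} + cornerCount S) = 1 := by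
      rw [card_onBoundary_add]
      exact Even.neg_one_pow ⟨3 * S.card, by ring⟩
    rw [pow_add] at h5
    rw [eq_inv_of_mul_eq_one_left h5, Int.units_inv_eq_self]
  rw [pow_add, h4, h3] at h1
  rw [stringSign, pow_add _ _ (cornerCount S), h1, mul_comm ((-1 : ℤˣ) ^ cornerCount S), mul_assoc,
    Int.units_mul_self, mul_one]

/-- The factor by which `(-1)^{♯Π}` changes when a hexagon is flipped whose neighbours in `Π` are
given by `b`. -/
def flipSign (b : Fin 6 → Bool) : ℤˣ :=
  (-1) ^ (1 + (∑ k, if b k then 1 else 0) + ∑ k, if b k ∧ b (k - 1) then 1 else 0)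

/-- The factor does not distinguish the neighbours inside from those outside. -/
theorem flipSign_not : ∀ b : Fin 6 → Bool, flipSign (fun k => !b k) = flipSign b := by
  decide

/-- Which of the neighbours of `h` belong to `S`. -/
def nbrs (S : Finset Hexagon) (h : Hexagon) : Fin 6 → Bool := fun k => h + dir k ∈ S

theorem sum_add_dir_eq (S : Finset Hexagon) (h v : Hexagon) (p : Hexagon → Prop)
    [DecidablePred p] : (∑ h' ∈ S, if h' + v = h ∧ p h' then 1 else 0) =
      if h - v ∈ S ∧ p (h - v) then 1 else 0 := by
  have : ∀ h', (h' + v = h ∧ p h') ↔ (h' = h - v ∧ p (h - v)) := by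
    intro h'
    rw [← eq_sub_iff_add_eq]
    constructor <;> rintro ⟨rfl, h2⟩ <;> exact ⟨rfl, h2⟩
  simp only [this]
  by_cases hp : p (h - v)
  · simp [hp, Finset.sum_ite_eq']
  · simp [hp]

theorem innerCount_insert {S : Finset Hexagon} {h : Hexagon} (hS : h ∉ S) :
    innerCount (insert h S) =
      innerCount S + 2 * ∑ k, if nbrs S h k then 1 else 0 := by
  have hne : ∀ k, h + dir k ≠ h := fun k => by
    rw [Ne, add_eq_left]
    revert k
    decide
  unfold innerCount
  rw [Finset.sum_insert hS]
  have h1 : ∀ k, (if h + dir k ∈ insert h S then 1 else 0) = if nbrs S h k then 1 else 0 := by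
    intro k
    simp [nbrs, hne k]
  have h2 : ∀ h', ∀ k, (if h' + dir k ∈ insert h S then 1 else 0) =
      (if h' + dir k ∈ S then 1 else 0) + if h' + dir k = h ∧ True then 1 else 0 := by
    intro h' k
    by_cases e : h' + dir k = h
    · simp [e, hS]
    · simp [e]
  simp only [h1, h2, Finset.sum_add_distrib]
  rw [Finset.sum_comm (s := S) (t := Finset.univ)
    (f := fun h' k => if h' + dir k = h ∧ True then 1 else 0)]
  simp only [sum_add_dir_eq]
  have h3 : (∑ k, if h - dir k ∈ S ∧ True then 1 else 0) = ∑ k, if nbrs S h k then 1 else 0 := by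
    refine Fintype.sum_equiv (Equiv.addRight 3) _ _ fun k => ?_
    simp [nbrs, dir_add_three, sub_eq_add_neg]
  rw [h3]
  ring

theorem cornerCount_insert {S : Finset Hexagon} {h : Hexagon} (hS : h ∉ S) :
    cornerCount (insert h S) =
      cornerCount S + 3 * ∑ k, if nbrs S h k ∧ nbrs S h (k - 1) then 1 else 0 := by
  have hne : ∀ k, h + dir k ≠ h := fun k => by
    rw [Ne, add_eq_left]
    revert k
    decide
  unfold cornerCount
  rw [Finset.sum_insert hS]
  have h1 : ∀ k, (if h + dir k ∈ insert h S ∧ h + dir (k - 1) ∈ insert h S then 1 else 0) =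
      if nbrs S h k ∧ nbrs S h (k - 1) then 1 else 0 := by
    intro k
    simp [nbrs, hne]
  have h2 : ∀ h', ∀ k,
      (if h' + dir k ∈ insert h S ∧ h' + dir (k - 1) ∈ insert h S then 1 else 0) =
      (if h' + dir k ∈ S ∧ h' + dir (k - 1) ∈ S then 1 else 0) +
        (if h' + dir k = h ∧ h' + dir (k - 1) ∈ S then 1 else 0) +
        if h' + dir (k - 1) = h ∧ h' + dir k ∈ S then 1 else 0 := by
    intro h' k
    have hd : dir k ≠ dir (k - 1) := by
      revert k
      decide
    by_cases e : h' + dir k = h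
    · have e' : h' + dir (k - 1) ≠ h := fun e' => hd (add_left_cancel (e.trans e'.symm))
      simp [e, e', hS]
    · by_cases e' : h' + dir (k - 1) = h
      · simp [e, e', hS]
      · simp [e, e']
  simp only [h1, h2, Finset.sum_add_distrib]
  rw [Finset.sum_comm (s := S) (t := Finset.univ)
    (f := fun h' k => if h' + dir k = h ∧ h' + dir (k - 1) ∈ S then 1 else 0),
    Finset.sum_comm (s := S) (t := Finset.univ)
    (f := fun h' k => if h' + dir (k - 1) = h ∧ h' + dir k ∈ S then 1 else 0)]
  simp only [sum_add_dir_eq]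
  have h3 : (∑ k, if h - dir k ∈ S ∧ h - dir k + dir (k - 1) ∈ S then 1 else 0) =
      ∑ k, if nbrs S h k ∧ nbrs S h (k - 1) then 1 else 0 := by
    refine Fintype.sum_equiv (Equiv.addRight 4) _ _ fun k => ?_
    have e2 : h - dir k + dir (k - 1) = h + dir (k + 4) := by
      rw [sub_eq_add_neg, add_assoc]
      congr 1
      revert k
      decide
    have e1 : h - dir k = h + dir (k + 4 - 1) := by
      rw [sub_eq_add_neg, ← dir_add_three]
      congr 2
      clear e2
      revert k
      decide
    rw [e2, e1]
    exact if_congr (and_comm.trans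
      (and_congr decide_eq_true_iff decide_eq_true_iff).symm) rfl rfl
  have h4 : (∑ k, if h - dir (k - 1) ∈ S ∧ h - dir (k - 1) + dir k ∈ S then 1 else 0) =
      ∑ k, if nbrs S h k ∧ nbrs S h (k - 1) then 1 else 0 := by
    refine Fintype.sum_equiv (Equiv.addRight 2) _ _ fun k => ?_
    have e2 : h - dir (k - 1) + dir k = h + dir (k + 2 - 1) := by
      rw [sub_eq_add_neg, add_assoc]
      congr 1
      revert k
      decide
    have e1 : h - dir (k - 1) = h + dir (k + 2) := by
      rw [sub_eq_add_neg, ← dir_add_three]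
      congr 2
      clear e2
      revert k
      decide
    rw [e2, e1]
    exact if_congr (and_congr decide_eq_true_iff decide_eq_true_iff).symm rfl rfl
  rw [h3, h4]
  ring

theorem stringSign_insert {S : Finset Hexagon} {h : Hexagon} (hS : h ∉ S) :
    stringSign (insert h S) = stringSign S * flipSign (nbrs S h) := by
  obtain ⟨m, hm, e⟩ := stringSign_eq S
  obtain ⟨m', hm', e'⟩ := stringSign_eq (insert h S)
  rw [innerCount_insert hS, hm, ← mul_add] at hm'
  have hm'' := Nat.eq_of_mul_eq_mul_left two_pos hm'
  rw [e, e', ← hm'', cornerCount_insert hS, Finset.card_insert_of_notMem hS, flipSign, ← pow_add]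
  generalize (∑ k, if nbrs S h k ∧ nbrs S h (k - 1) then 1 else 0) = a
  rw [show S.card + 1 + (m + ∑ k, if nbrs S h k then 1 else 0) + (cornerCount S + 3 * a) =
    S.card + m + cornerCount S + (1 + (∑ k, if nbrs S h k then 1 else 0) + a) + 2 * a by ring,
    pow_add _ _ (2 * a), pow_mul]
  simp

/-- The sign `(-1)^{♯Π}` changes by a factor that only depends on the neighbours of the flipped
hexagon. -/
theorem stringSign_symmDiff_singleton (S : Finset Hexagon) (h : Hexagon) :
    stringSign (symmDiff S {h}) = stringSign S * flipSign (nbrs S h) := by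
  by_cases hS : h ∈ S
  · have h1 : symmDiff S {h} = S.erase h := by
      ext x
      simp only [Finset.mem_symmDiff, Finset.mem_singleton, Finset.mem_erase]
      constructor
      · rintro (⟨h1, h2⟩ | ⟨rfl, h2⟩)
        · exact ⟨h2, h1⟩
        · exact absurd hS h2
      · exact fun ⟨h1, h2⟩ => Or.inl ⟨h2, h1⟩
    have h2 := stringSign_insert (Finset.notMem_erase h S)
    rw [Finset.insert_erase hS] at h2
    have h3 : nbrs (S.erase h) h = nbrs S h := by
      funext k
      have : h + dir k ≠ h := by
        rw [Ne, add_eq_left]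
        revert k
        decide
      simp [nbrs, this]
    rw [h1, h2, h3, mul_assoc, Int.units_mul_self, mul_one]
  · have h1 : symmDiff S {h} = insert h S := by
      rw [Disjoint.symmDiff_eq_sup (Finset.disjoint_singleton_right.2 hS), Finset.sup_eq_union,
        Finset.union_comm]
      rfl
    rw [h1, stringSign_insert hS]

/-! ### The relative sign of two string configurations -/

/-- The relative sign of the string configurations `∂S` and `∂S ∆ ∂T`. -/
def relSign (T S : Finset Hexagon) : ℤˣ := stringSign S * stringSign (symmDiff S T)

/-- The hexagons whose neighbours belong neither all to `T` nor all to the complement of `T`. -/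
def collar (T : Finset Hexagon) : Set Hexagon :=
  {h | ∃ k l, h + dir k ∈ T ∧ h + dir l ∉ T}

theorem nbrs_symmDiff_of_notMem_collar {T : Finset Hexagon} {h : Hexagon} (hT : h ∉ collar T)
    (S : Finset Hexagon) :
    flipSign (nbrs (symmDiff S T) h) = flipSign (nbrs S h) := by
  by_cases h0 : h + dir 0 ∈ T
  · have h1 : ∀ k, h + dir k ∈ T := fun k => by
      by_contra hk
      exact hT ⟨0, k, h0, hk⟩
    rw [← flipSign_not (nbrs S h)]
    congr 1
    funext k
    simp [nbrs, Finset.mem_symmDiff, h1 k]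
  · have h1 : ∀ k, h + dir k ∉ T := fun k hk => hT ⟨k, 0, hk, h0⟩
    congr 1
    funext k
    simp [nbrs, Finset.mem_symmDiff, h1 k]

/-- Flipping hexagons away from the collar of `T` does not change the sign relative to `T`. -/
theorem relSign_symmDiff {T R : Finset Hexagon} (hR : ∀ h ∈ R, h ∉ collar T)
    (S : Finset Hexagon) : relSign T (symmDiff S R) = relSign T S := by
  induction R using Finset.induction_on with
  | empty => rw [← Finset.bot_eq_empty, symmDiff_bot]
  | insert h R hh ih =>
    have h1 : insert h R = symmDiff R {h} := by
      rw [Disjoint.symmDiff_eq_sup (Finset.disjoint_singleton_right.2 hh), Finset.sup_eq_union,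
        Finset.union_comm]
      rfl
    rw [← ih fun x hx => hR x (Finset.mem_insert_of_mem hx), h1, ← symmDiff_assoc]
    unfold relSign
    rw [symmDiff_right_comm (symmDiff S R) {h} T, stringSign_symmDiff_singleton,
      stringSign_symmDiff_singleton,
      nbrs_symmDiff_of_notMem_collar (hR h (Finset.mem_insert_self _ _)), mul_mul_mul_comm,
      Int.units_mul_self, mul_one]

/-- The sign relative to `T` only depends on the hexagons in the collar of `T`. -/
theorem relSign_congr {T S S' : Finset Hexagon} (h : ∀ x ∈ collar T, (x ∈ S ↔ x ∈ S')) :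
    relSign T S = relSign T S' := by
  rw [← relSign_symmDiff (R := symmDiff S S') (T := T) ?_ S, symmDiff_symmDiff_cancel_left]
  intro x hx hxT
  rw [Finset.mem_symmDiff, h x hxT] at hx
  tauto

/-- The sign relative to `T` does not change when all hexagons of a region are flipped whose
collar does not meet `T`. This is `relSign_symmDiff` with the roles of the two regions exchanged. -/
theorem relSign_symmDiff_of_disjoint {T B : Finset Hexagon} (hB : ∀ h ∈ T, h ∉ collar B)
    (S : Finset Hexagon) : relSign T (symmDiff S B) = relSign T S := by
  have h := relSign_symmDiff hB S
  unfold relSign at h ⊢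
  rw [symmDiff_right_comm S B T]
  have h2 : stringSign (symmDiff S B) * stringSign (symmDiff (symmDiff S T) B) =
    (stringSign S * (stringSign S * stringSign (symmDiff S B))) *
      stringSign (symmDiff (symmDiff S T) B) := by
    rw [← mul_assoc, Int.units_mul_self, one_mul]
  rw [h2, ← h, mul_assoc, mul_assoc, Int.units_mul_self, mul_one]

theorem finite_collar (T : Finset Hexagon) : (collar T).Finite := by
  refine ((T ×ˢ (Finset.univ : Finset (Fin 6))).image
    fun d => d.1 - dir d.2).finite_toSet.subset ?_
  rintro h ⟨k, l, h1, -⟩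
  simp only [Finset.coe_image, Set.mem_image, Finset.mem_coe, Finset.mem_product, Finset.mem_univ,
    and_true]
  exact ⟨(h + dir k, k), h1, add_sub_cancel_right _ _⟩

/-! ### Boundaries of sets of hexagons -/

theorem exists_dart (e : Edge) : ∃ d : Dart, Dart.edge d = e := by
  obtain ⟨e, he⟩ := e
  induction e with
  | h a b =>
    obtain ⟨k, hk⟩ := (SimpleGraph.mem_edgeSet hexGraph).1 he
    subst hk
    exact ⟨(a, k), rfl⟩

theorem boundary_symmDiff (S T : Finset Hexagon) :
    boundary (symmDiff S T) = symmDiff (boundary S) (boundary T) := by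
  ext e
  obtain ⟨d, rfl⟩ := exists_dart e
  simp only [Finset.mem_symmDiff, edge_mem_boundary]
  tauto

theorem boundary_empty : boundary ∅ = ∅ := by simp [boundary]

/-- A nonempty finite set of hexagons has a boundary: the rightmost of its hexagons has a neighbour
outside. -/
theorem eq_empty_of_boundary_eq_empty {S : Finset Hexagon} (h : boundary S = ∅) : S = ∅ := by
  by_contra hS
  obtain ⟨x, hx, hmax⟩ := S.exists_max_image Prod.fst (Finset.nonempty_iff_ne_empty.2 hS)
  have h1 : Dart.right (x, 0) ∉ S := by
    intro h1
    have := hmax _ h1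
    change x.1 + 1 ≤ x.1 at this
    omega
  have h2 : Dart.edge (x, 0) ∈ boundary S := edge_mem_boundary.2 fun h => h1 (h.1 hx)
  rw [h] at h2
  exact absurd h2 (Finset.notMem_empty _)

theorem boundary_injective : Function.Injective boundary := by
  intro S T h
  have h1 : boundary (symmDiff S T) = ∅ := by
    rw [boundary_symmDiff, h, symmDiff_self, Finset.bot_eq_empty]
  exact symmDiff_eq_bot.1 (eq_empty_of_boundary_eq_empty h1)

theorem eventually_subset_patch (K : Finset Hexagon) :
    ∀ᶠ n in Filter.atTop, K ⊆ patch n := by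
  refine (Finset.eventually_all K).2 fun h _ => ?_
  filter_upwards [Filter.eventually_gt_atTop (|h.1| + |h.2|).toNat] with n hn
  have h3 := abs_add_le h.1 h.2
  have h1 := abs_nonneg h.1
  have h2 := abs_nonneg h.2
  have hn' : |h.1| + |h.2| < (n : ℤ) := by omega
  have h4 : |h.1| < (n : ℤ) := by omega
  have h5 : |h.2| < (n : ℤ) := by omega
  have h6 : |h.1 + h.2| < (n : ℤ) := by omega
  rw [patch, Finset.mem_filter, Finset.mem_product, Finset.mem_Icc, Finset.mem_Icc]
  exact ⟨⟨⟨(abs_lt.1 h4).1.le, (abs_lt.1 h4).2.le⟩, (abs_lt.1 h5).1.le, (abs_lt.1 h5).2.le⟩,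
    h4, h5, h6⟩

/-! ### Products of a flip and a diagonal operator -/

/-- `f` only depends on the edges in `E`. -/
def DependsOn (E : Finset Edge) (f : Config → Circle) : Prop :=
  ∀ c c' : Config, (∀ x ∈ E, x ∈ c ↔ x ∈ c') → f c = f c'

theorem op_ext {U V : unitary B₀} (h : ∀ (ψ : H₀) (c : Config), (U : B₀) ψ c = (V : B₀) ψ c) :
    U = V :=
  Subtype.ext (ContinuousLinearMap.ext fun ψ => lp.ext (funext fun c => h ψ c))

theorem flip_mul_diag_apply (F : Finset Edge) (f : Config → Circle) (ψ : H₀) (c : Config) :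
    ((flipX F * diag f : unitary B₀) : B₀) ψ c = f (symmDiff c F) * ψ (symmDiff c F) := by
  change (flipX F : B₀) ((diag f : B₀) ψ) c = _
  rw [flip_apply, diag_apply]

theorem flip_mul_diag_mul (F F' : Finset Edge) (f f' : Config → Circle) :
    (flipX F * diag f) * (flipX F' * diag f') =
      flipX (symmDiff F F') * diag (fun c => f (symmDiff c F') * f' c) := by
  refine op_ext fun ψ c => ?_
  change ((flipX F * diag f : unitary B₀) : B₀) (((flipX F' * diag f' : unitary B₀) : B₀) ψ) c = _
  rw [flip_mul_diag_apply, flip_mul_diag_apply, flip_mul_diag_apply, ← symmDiff_assoc,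
    symmDiff_symmDiff_cancel_right, Circle.coe_mul, mul_assoc]

theorem flip_empty : flipX ∅ = 1 :=
  op_ext fun ψ c => by
    rw [flip_apply, ← Finset.bot_eq_empty, symmDiff_bot]
    rfl

theorem diag_one : diag (fun _ => 1) = 1 :=
  op_ext fun ψ c => by
    rw [diag_apply, Circle.coe_one, one_mul]
    rfl

open Classical in
/-- Diagonal operators that depend on finitely many edges are local observables: one splits them
edge by edge with the projections `(1 ± σᶻ) / 2`. -/
theorem diag_mem {E : Finset Edge} {f : Config → Circle} (h : DependsOn E f) :
    (diag f : B₀) ∈ quasiLocal := by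
  induction E using Finset.induction_on generalizing f with
  | empty =>
    have : (diag f : B₀) = (f ∅ : ℂ) • (1 : B₀) := by
      refine ContinuousLinearMap.ext fun ψ => lp.ext (funext fun c => ?_)
      rw [diag_apply, h c ∅ fun x hx => absurd hx (Finset.notMem_empty x)]
      rfl
    rw [this]
    exact SMulMemClass.smul_mem _ (one_mem _)
  | insert x E hx ih =>
    have h1 : DependsOn E fun c => f (insert x c) := by
      refine fun c c' hc => h _ _ fun y hy => ?_
      by_cases hyx : y = x
      · simp [hyx]
      · simp [hyx, hc y ((Finset.mem_insert.1 hy).resolve_left hyx)]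
    have h0 : DependsOn E fun c => f (c.erase x) := by
      refine fun c c' hc => h _ _ fun y hy => ?_
      by_cases hyx : y = x
      · simp [hyx]
      · simp [hyx, hc y ((Finset.mem_insert.1 hy).resolve_left hyx)]
    have : (diag f : B₀) = (1 / 2 : ℂ) • ((1 - (σZ x : B₀)) * (diag fun c => f (insert x c) : B₀))
        + (1 / 2 : ℂ) • ((1 + (σZ x : B₀)) * (diag fun c => f (c.erase x) : B₀)) := by
      refine ContinuousLinearMap.ext fun ψ => lp.ext (funext fun c => ?_)
      change (diag f : B₀) ψ c = (1 / 2 : ℂ) * ((diag fun c => f (insert x c) : B₀) ψ c -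
        (σZ x : B₀) ((diag fun c => f (insert x c) : B₀) ψ) c) +
        (1 / 2 : ℂ) * ((diag fun c => f (c.erase x) : B₀) ψ c +
        (σZ x : B₀) ((diag fun c => f (c.erase x) : B₀) ψ) c)
      simp only [σZ, diag_apply]
      by_cases hc : x ∈ c
      · simp only [hc, if_true, Finset.insert_eq_of_mem]
        push_cast
        ring
      · simp only [hc, if_false, Finset.erase_eq_of_notMem, not_false_eq_true]
        push_cast
        ring
    rw [this]
    exact add_mem (SMulMemClass.smul_mem _ (mul_mem (sub_mem (one_mem _) (σZ_mem x)) (ih h1)))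
      (SMulMemClass.smul_mem _ (mul_mem (add_mem (one_mem _) (σZ_mem x)) (ih h0)))

theorem flip_mul_diag_mem {E : Finset Edge} {f : Config → Circle} (h : DependsOn E f)
    (F : Finset Edge) : ((flipX F * diag f : unitary B₀) : B₀) ∈ quasiLocal :=
  mul_mem (flip_mem F) (diag_mem h)

/-- The products of a flip and a local diagonal operator. -/
def monomials : Set B₀ :=
  {T | ∃ F E f, DependsOn E f ∧ T = ((flipX F * diag f : unitary B₀) : B₀)}

theorem σX_mem_monomials (x : Edge) : (σX x : B₀) ∈ monomials :=
  ⟨{x}, ∅, fun _ => 1, fun _ _ _ => rfl, by rw [diag_one, mul_one]; rfl⟩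

theorem σZ_mem_monomials (x : Edge) : (σZ x : B₀) ∈ monomials :=
  ⟨∅, {x}, fun c => if x ∈ c then -1 else 1,
    fun c c' h => by simp only [h x (Finset.mem_singleton_self x)],
    by rw [flip_empty, one_mul]; rfl⟩

theorem star_σX (x : Edge) : star (σX x : B₀) = σX x := star_flip _

theorem star_σZ (x : Edge) : star (σZ x : B₀) = σZ x := by
  refine ContinuousLinearMap.ext fun ψ => lp.ext (funext fun c => ?_)
  rw [σZ, star_diag_apply, diag_apply]
  split_ifs <;> simp

/-- The ⋆-algebra generated by the Pauli matrices. -/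
abbrev localAlgebra : StarSubalgebra ℂ B₀ :=
  StarAlgebra.adjoin ℂ {T : B₀ | ∃ x, T = σX x ∨ T = σZ x}

theorem localAlgebra_toSubalgebra : localAlgebra.toSubalgebra =
    Algebra.adjoin ℂ {T : B₀ | ∃ x, T = σX x ∨ T = σZ x} := by
  have hstar : star {T : B₀ | ∃ x, T = σX x ∨ T = σZ x} ⊆ {T : B₀ | ∃ x, T = σX x ∨ T = σZ x} := by
    rintro T ⟨x, h | h⟩
    · exact ⟨x, Or.inl (by rw [← star_σX, ← h, star_star])⟩
    · exact ⟨x, Or.inr (by rw [← star_σZ, ← h, star_star])⟩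
  rw [StarAlgebra.adjoin_toSubalgebra, Set.union_eq_self_of_subset_right hstar]

theorem localAlgebra_le_span :
    (localAlgebra : Set B₀) ⊆ Submodule.span ℂ monomials := by
  intro T hT
  have h1 : T ∈ localAlgebra.toSubalgebra := hT
  rw [localAlgebra_toSubalgebra, ← Subalgebra.mem_toSubmodule, Algebra.adjoin_eq_span] at h1
  refine Submodule.span_mono ?_ h1
  intro T hT
  induction hT using Submonoid.closure_induction with
  | mem T hT =>
    obtain ⟨x, rfl | rfl⟩ := hT
    · exact σX_mem_monomials x
    · exact σZ_mem_monomials x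
  | one => exact ⟨∅, ∅, fun _ => 1, fun _ _ _ => rfl, by rw [flip_empty, diag_one, one_mul]; rfl⟩
  | mul S T _ _ hS hT =>
    obtain ⟨F, E, f, hf, rfl⟩ := hS
    obtain ⟨F', E', f', hf', rfl⟩ := hT
    refine ⟨symmDiff F F', E ∪ E', _, fun c c' h => ?_,
      congrArg Subtype.val (flip_mul_diag_mul F F' f f')⟩
    congr 1
    · refine hf _ _ fun x hx => ?_
      simp only [Finset.mem_symmDiff, h x (Finset.mem_union_left _ hx)]
    · exact hf' _ _ fun x hx => h x (Finset.mem_union_right _ hx)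

/-! ### Expectation values in the finite volume states -/

theorem ket_apply (c b : Config) : ket c b = if b = c then 1 else 0 := by
  rw [ket, lp.single_apply, Pi.single_apply]

theorem flip_mul_diag_ket (F : Finset Edge) (f : Config → Circle) (c : Config) :
    ((flipX F * diag f : unitary B₀) : B₀) (ket c) = (f c : ℂ) • ket (symmDiff c F) := by
  refine lp.ext (funext fun b => ?_)
  rw [flip_mul_diag_apply]
  change _ = (f c : ℂ) * ket (symmDiff c F) b
  rw [ket_apply, ket_apply]
  have : symmDiff b F = c ↔ b = symmDiff c F := by
    constructor <;> rintro rfl <;> rw [symmDiff_symmDiff_cancel_right]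
  by_cases h : b = symmDiff c F
  · rw [if_pos (this.2 h), if_pos h, this.2 h]
  · rw [if_neg (mt this.1 h), if_neg h, mul_zero, mul_zero]

theorem flip_ket_empty (F : Finset Edge) : (flipX F : B₀) (ket ∅) = ket F := by
  have := flip_mul_diag_ket F (fun _ => 1) ∅
  rwa [diag_one, mul_one, Circle.coe_one, one_smul, ← Finset.bot_eq_empty, bot_symmDiff] at this

theorem inner_ket (c b : Config) : ⟪ket c, ket b⟫_ℂ = if b = c then 1 else 0 := by
  rw [ket, lp.inner_single_left, ket_apply]
  by_cases h : c = b <;> simp [h, eq_comm]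

/-- The sum of the `|∂S⟩` in a region `W`, with amplitudes `(-1)^{♯S}`. -/
def stringSum (W : Finset Hexagon) : H₀ :=
  ∑ S ∈ W.powerset, ((stringSign S : ℤ) : ℂ) • ket (boundary S)

theorem stringVector_eq (n : ℕ) : stringVector n =
    (Real.sqrt (1 / 2 ^ (patch n).card) : ℂ) • stringSum (patch n) := by
  unfold stringVector stringSum stringSign
  congr 1
  refine Finset.sum_congr rfl fun S _ => ?_
  rw [flip_ket_empty]
  push_cast
  rfl

/-- The matrix elements of a monomial between string configurations are phases or zero. -/
theorem inner_stringSum (W : Finset Hexagon) (F : Finset Edge) (f : Config → Circle) :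
    ⟪stringSum W, ((flipX F * diag f : unitary B₀) : B₀) (stringSum W)⟫_ℂ =
      ∑ S ∈ W.powerset, ∑ S' ∈ W.powerset,
        if boundary S' = symmDiff (boundary S) F then
          (((stringSign S * stringSign S' : ℤˣ) : ℤ) : ℂ) * f (boundary S) else 0 := by
  unfold stringSum
  rw [map_sum, inner_sum]
  refine Finset.sum_congr rfl fun S _ => ?_
  rw [sum_inner]
  refine Finset.sum_congr rfl fun S' _ => ?_
  rw [map_smul, flip_mul_diag_ket, inner_smul_left, inner_smul_right, inner_smul_right, inner_ket]
  by_cases h : boundary S' = symmDiff (boundary S) F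
  · rw [if_pos h.symm, if_pos h, Units.val_mul]
    push_cast
    rw [map_intCast]
    ring
  · rw [if_neg (Ne.symm h), if_neg h]
    ring

theorem inner_stringSum_boundary {W T : Finset Hexagon} (hT : T ⊆ W) (f : Config → Circle) :
    ⟪stringSum W, ((flipX (boundary T) * diag f : unitary B₀) : B₀) (stringSum W)⟫_ℂ =
      ∑ S ∈ W.powerset, ((relSign T S : ℤ) : ℂ) * f (boundary S) := by
  rw [inner_stringSum]
  refine Finset.sum_congr rfl fun S hS => ?_
  have : ∀ S', boundary S' = symmDiff (boundary S) (boundary T) ↔ S' = symmDiff S T := by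
    intro S'
    rw [← boundary_symmDiff]
    exact boundary_injective.eq_iff
  simp only [this]
  rw [Finset.sum_ite_eq', if_pos, relSign]
  rw [Finset.mem_powerset] at hS ⊢
  exact symmDiff_le_sup.trans (sup_le hS hT)

theorem inner_stringSum_of_ne {W : Finset Hexagon} {F : Finset Edge} (hF : ∀ T, F ≠ boundary T)
    (f : Config → Circle) :
    ⟪stringSum W, ((flipX F * diag f : unitary B₀) : B₀) (stringSum W)⟫_ℂ = 0 := by
  rw [inner_stringSum]
  refine Finset.sum_eq_zero fun S _ => Finset.sum_eq_zero fun S' _ => if_neg fun h => ?_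
  apply hF (symmDiff S S')
  rw [boundary_symmDiff, h, symmDiff_symmDiff_cancel_left]

theorem inner_stringVector (n : ℕ) (O : B₀) : ⟪stringVector n, O (stringVector n)⟫_ℂ =
    (1 / 2 ^ (patch n).card : ℂ) * ⟪stringSum (patch n), O (stringSum (patch n))⟫_ℂ := by
  rw [stringVector_eq, map_smul, inner_smul_left, inner_smul_right, ← mul_assoc,
    Complex.conj_ofReal, ← Complex.ofReal_mul, Real.mul_self_sqrt (by positivity)]
  push_cast
  rfl

theorem norm_stringVector (n : ℕ) : ‖stringVector n‖ = 1 := by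
  have h1 := inner_stringVector n ((1 : unitary B₀) : B₀)
  have h2 := inner_stringSum_boundary (Finset.empty_subset (patch n)) (fun _ => 1)
  have h3 : ∀ S, relSign ∅ S = 1 := fun S => by
    rw [relSign, ← Finset.bot_eq_empty, symmDiff_bot, Int.units_mul_self]
  rw [boundary_empty, flip_empty, diag_one, one_mul] at h2
  simp only [h3, Units.val_one, Int.cast_one, Circle.coe_one, mul_one, Finset.sum_const,
    Finset.card_powerset, nsmul_eq_mul] at h2
  rw [h2] at h1
  push_cast at h1
  rw [one_div, inv_mul_cancel₀ (by positivity)] at h1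
  change ⟪stringVector n, stringVector n⟫_ℂ = 1 at h1
  have h4 := norm_sq_eq_re_inner (𝕜 := ℂ) (stringVector n)
  rw [h1, RCLike.one_re, pow_eq_one_iff_of_nonneg (norm_nonneg _) two_ne_zero] at h4
  exact h4

/-- The average over the subsets of a region does not depend on the region, provided that it
contains the hexagons on which the averaged function depends. -/
theorem average_powerset {K W : Finset Hexagon} (hK : K ⊆ W) {q : Finset Hexagon → ℂ}
    (hq : ∀ S S' : Finset Hexagon, (∀ x ∈ K, x ∈ S ↔ x ∈ S') → q S = q S') :
    (1 / 2 ^ W.card : ℂ) * ∑ S ∈ W.powerset, q S =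
      (1 / 2 ^ K.card : ℂ) * ∑ S ∈ K.powerset, q S := by
  suffices ∀ R : Finset Hexagon, Disjoint R K → (1 / 2 ^ (R ∪ K).card : ℂ) *
      ∑ S ∈ (R ∪ K).powerset, q S = (1 / 2 ^ K.card : ℂ) * ∑ S ∈ K.powerset, q S by
    have h := this (W \ K) Finset.sdiff_disjoint
    rwa [Finset.sdiff_union_of_subset hK] at h
  intro R
  induction R using Finset.induction_on with
  | empty => simp
  | insert x R hx ih =>
    intro hR
    rw [Finset.disjoint_insert_left] at hR
    have hx' : x ∉ R ∪ K := by simp [hx, hR.1]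
    have h1 : ∀ S, q (insert x S) = q S := fun S => hq _ _ fun y hy => by
      have : y ≠ x := fun e => hR.1 (e ▸ hy)
      simp [this]
    rw [← ih hR.2, Finset.insert_union, Finset.card_insert_of_notMem hx',
      Finset.sum_powerset_insert hx']
    simp only [h1]
    rw [pow_succ]
    field_simp
    ring

open Classical in
/-- The expectation values of a monomial are eventually constant: they vanish unless a boundary is
flipped, and otherwise they are averages of a function of finitely many hexagons. -/
theorem exists_tendsto_of_mem_monomials {O : B₀} (hO : O ∈ monomials) :
    ∃ L, Filter.Tendsto (fun n => ⟪stringVector n, O (stringVector n)⟫_ℂ) Filter.atTop (𝓝 L) := by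
  obtain ⟨F, E, f, hf, rfl⟩ := hO
  by_cases hF : ∃ T, F = boundary T
  · obtain ⟨T, rfl⟩ := hF
    -- the relative sign depends on the collar of `T`, and `f` on the hexagons next to edges of `E`
    let K : Finset Hexagon := (finite_collar T).toFinset ∪ E.biUnion fun e => e.1.toFinset
    refine ⟨(1 / 2 ^ K.card : ℂ) * ∑ S ∈ K.powerset, ((relSign T S : ℤ) : ℂ) * f (boundary S),
      tendsto_const_nhds.congr' ?_⟩
    filter_upwards [eventually_subset_patch T, eventually_subset_patch K] with n hT hK
    rw [inner_stringVector, inner_stringSum_boundary hT]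
    refine (average_powerset hK fun S S' h => ?_).symm
    rw [relSign_congr (T := T) (S := S) (S' := S') fun x hx => h x
      (Finset.mem_union_left _ ((finite_collar T).mem_toFinset.2 hx)),
      hf (boundary S) (boundary S') fun e he => ?_]
    obtain ⟨d, rfl⟩ := exists_dart e
    have hm : ∀ x ∈ (Dart.edge d).1.toFinset, (x ∈ S ↔ x ∈ S') := fun x hx =>
      h x (Finset.mem_union_right _ (Finset.mem_biUnion.2 ⟨_, he, hx⟩))
    rw [edge_mem_boundary, edge_mem_boundary, hm (Dart.left d) (by simp [Dart.edge]),
      hm (Dart.right d) (by simp [Dart.edge])]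
  · push Not at hF
    refine ⟨0, tendsto_const_nhds.congr fun n => ?_⟩
    rw [inner_stringVector, inner_stringSum_of_ne hF, mul_zero]

theorem exists_tendsto_of_mem_span {O : B₀} (hO : O ∈ Submodule.span ℂ monomials) :
    ∃ L, Filter.Tendsto (fun n => ⟪stringVector n, O (stringVector n)⟫_ℂ) Filter.atTop (𝓝 L) := by
  induction hO using Submodule.span_induction with
  | mem O hO => exact exists_tendsto_of_mem_monomials hO
  | zero => exact ⟨0, by simp⟩
  | add S T _ _ hS hT =>
    obtain ⟨L, hL⟩ := hS
    obtain ⟨M, hM⟩ := hT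
    refine ⟨L + M, (hL.add hM).congr fun n => ?_⟩
    rw [add_apply, inner_add_right]
  | smul r T _ hT =>
    obtain ⟨L, hL⟩ := hT
    refine ⟨r * L, (hL.const_mul r).congr fun n => ?_⟩
    rw [smul_apply, inner_smul_right]

theorem norm_inner_stringVector_le (n : ℕ) (O : B₀) :
    ‖⟪stringVector n, O (stringVector n)⟫_ℂ‖ ≤ ‖O‖ := by
  refine (norm_inner_le_norm _ _).trans ?_
  have := O.le_opNorm (stringVector n)
  rwa [norm_stringVector, one_mul, ← mul_one ‖O‖, ← norm_stringVector n]

/-- The expectation values of a quasi-local observable converge: those of a local one are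
eventually constant. -/
theorem exists_tendsto_expectation {O : B₀} (hO : O ∈ quasiLocal) :
    ∃ L, Filter.Tendsto (fun n => ⟪stringVector n, O (stringVector n)⟫_ℂ) Filter.atTop (𝓝 L) := by
  refine cauchySeq_tendsto_of_complete (Metric.cauchySeq_iff'.2 fun ε hε => ?_)
  obtain ⟨T, hT, hd⟩ := Metric.mem_closure_iff.1 hO (ε / 4) (by positivity)
  obtain ⟨L, hL⟩ := exists_tendsto_of_mem_span (localAlgebra_le_span hT)
  obtain ⟨N, hN⟩ := Metric.cauchySeq_iff'.1 hL.cauchySeq (ε / 4) (by positivity)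
  refine ⟨N, fun n hn => ?_⟩
  have h1 : ∀ n, dist ⟪stringVector n, O (stringVector n)⟫_ℂ
      ⟪stringVector n, T (stringVector n)⟫_ℂ < ε / 4 := by
    intro n
    rw [dist_eq_norm, ← inner_sub_right, ← sub_apply]
    refine (norm_inner_stringVector_le n _).trans_lt ?_
    rwa [← dist_eq_norm]
  have h2 := dist_triangle4_right ⟪stringVector n, O (stringVector n)⟫_ℂ
    ⟪stringVector N, O (stringVector N)⟫_ℂ ⟪stringVector n, T (stringVector n)⟫_ℂ
    ⟪stringVector N, T (stringVector N)⟫_ℂ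
  linarith [h1 n, h1 N, hN n hn]

/-- The limit of the expectation values of `O` in the vectors `Ω_n`. -/
def limitValue (O : 𝒜) : ℂ := Classical.choose (exists_tendsto_expectation O.2)

theorem tendsto_limitValue (O : 𝒜) :
    Filter.Tendsto (fun n => ⟪stringVector n, (O : B₀) (stringVector n)⟫_ℂ)
      Filter.atTop (𝓝 (limitValue O)) :=
  Classical.choose_spec (exists_tendsto_expectation O.2)

/-- The double semion state. -/
def semionState : 𝒜 →ₚ[ℂ] ℂ :=
  PositiveLinearMap.mk₀
    { toFun := limitValue
      map_add' := fun S T => tendsto_nhds_unique (tendsto_limitValue (S + T))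
        (((tendsto_limitValue S).add (tendsto_limitValue T)).congr fun n => by
          change _ = ⟪_, ((S : B₀) + (T : B₀)) _⟫_ℂ
          rw [add_apply, inner_add_right])
      map_smul' := fun r T => tendsto_nhds_unique (tendsto_limitValue (r • T))
        (((tendsto_limitValue T).const_mul r).congr fun n => by
          change _ = ⟪_, (r • (T : B₀)) _⟫_ℂ
          rw [smul_apply, inner_smul_right]) }
    (fun O hO => by
      obtain ⟨T, rfl⟩ := CStarAlgebra.nonneg_iff_eq_star_mul_self.1 hO
      refine ge_of_tendsto' (tendsto_limitValue _) fun n => ?_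
      change 0 ≤ ⟪_, (star (T : B₀) * (T : B₀)) _⟫_ℂ
      change 0 ≤ ⟪_, (star (T : B₀)) ((T : B₀) _)⟫_ℂ
      rw [ContinuousLinearMap.star_eq_adjoint,
        ContinuousLinearMap.adjoint_inner_right, inner_self_eq_norm_sq_to_K]
      rw [← RCLike.ofReal_pow]
      exact Complex.zero_le_real.2 (sq_nonneg _))

theorem isDoubleSemionState_semionState : IsDoubleSemionState semionState :=
  tendsto_limitValue

/-! ### A criterion for inequivalence -/

/-- The GNS representation of the double semion state. -/
abbrev gns : 𝒜 →⋆ₐ[ℂ] (semionState.GNS →L[ℂ] semionState.GNS) := semionState.gnsStarAlgHom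

/-- The GNS vector of the double semion state. -/
def vacuumVector : semionState.GNS := (semionState.toPreGNS 1 : semionState.GNS)

theorem gns_vacuumVector (T : 𝒜) :
    gns T vacuumVector = (semionState.toPreGNS T : semionState.GNS) := by
  have : gns T vacuumVector = semionState.leftMulMapPreGNS T (semionState.toPreGNS 1) :=
    semionState.gnsNonUnitalStarAlgHom_apply_coe
  rw [this, PositiveLinearMap.leftMulMapPreGNS_apply]
  simp

theorem semionState_eq_of_eventually {T : 𝒜} {z : ℂ}
    (h : ∀ᶠ n in Filter.atTop, ⟪stringVector n, (T : B₀) (stringVector n)⟫_ℂ = z) :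
    semionState T = z :=
  tendsto_nhds_unique (isDoubleSemionState_semionState T)
    (tendsto_const_nhds.congr' (h.mono fun _ => Eq.symm))

theorem norm_vacuumVector : ‖vacuumVector‖ = 1 := by
  have h1 : semionState (star (1 : 𝒜) * 1) = 1 := by
    refine semionState_eq_of_eventually (Filter.Eventually.of_forall fun n => ?_)
    rw [star_one, one_mul]
    change ⟪stringVector n, stringVector n⟫_ℂ = 1
    rw [inner_self_eq_norm_sq_to_K, norm_stringVector]
    simp
  rw [vacuumVector, UniformSpace.Completion.norm_coe, PositiveLinearMap.preGNS_norm_def,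
    PositiveLinearMap.ofPreGNS_toPreGNS, h1]
  simp

/-- An observable that fixes the finite volume vectors fixes the GNS vector. -/
theorem gns_vacuumVector_of_eventually {L : 𝒜}
    (h : ∀ᶠ n in Filter.atTop, (L : B₀) (stringVector n) = stringVector n) :
    gns L vacuumVector = vacuumVector := by
  have h1 : semionState (star (L - 1) * (L - 1)) = 0 := by
    refine semionState_eq_of_eventually (h.mono fun n hn => ?_)
    change ⟪_, (star ((L : B₀) - 1)) (((L : B₀) - 1) (stringVector n))⟫_ℂ = 0
    have : ((L : B₀) - 1) (stringVector n) = 0 := by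
      rw [sub_apply, hn]
      exact sub_self _
    rw [this, map_zero, inner_zero_right]
  rw [gns_vacuumVector, vacuumVector, ← sub_eq_zero, ← norm_eq_zero,
    ← UniformSpace.Completion.coe_sub, UniformSpace.Completion.norm_coe, ← map_sub,
    PositiveLinearMap.preGNS_norm_def, PositiveLinearMap.ofPreGNS_toPreGNS, h1]
  simp

theorem exists_local_approx (ψ : semionState.GNS) {ε : ℝ} (hε : 0 < ε) :
    ∃ X : 𝒜, (X : B₀) ∈ localAlgebra ∧ ‖ψ - gns X vacuumVector‖ < ε := by
  obtain ⟨A, hA⟩ := UniformSpace.Completion.denseRange_coe.exists_dist_lt ψ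
    (half_pos hε)
  obtain ⟨T, hT, hd⟩ := Metric.mem_closure_iff.1 (semionState.ofPreGNS A).2 (ε / 2) (half_pos hε)
  let X : 𝒜 := ⟨T, StarSubalgebra.le_topologicalClosure _ hT⟩
  refine ⟨X, hT, ?_⟩
  have h1 : gns (semionState.ofPreGNS A) vacuumVector = A := gns_vacuumVector _
  have h2 : ‖gns (semionState.ofPreGNS A - X) vacuumVector‖ < ε / 2 := by
    refine ((gns _).le_opNorm _).trans_lt ?_
    rw [norm_vacuumVector, mul_one]
    refine (NonUnitalStarAlgHom.norm_apply_le gns (semionState.ofPreGNS A - X)).trans_lt ?_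
    rw [dist_eq_norm] at hd
    exact hd
  rw [map_sub, sub_apply, h1] at h2
  rw [dist_eq_norm] at hA
  have h3 := norm_add_le (ψ - A) (A - gns X vacuumVector)
  rw [sub_add_sub_cancel] at h3
  linarith

/-- A local observable commutes with everything that commutes with the Pauli matrices of a suitable
finite set of sites. -/
theorem exists_support {X : B₀} (hX : X ∈ localAlgebra) : ∃ K : Finset Edge, ∀ L : B₀,
    (∀ x ∈ K, Commute L (σX x : B₀) ∧ Commute L (σZ x : B₀)) → Commute L X := by
  have h1 : X ∈ localAlgebra.toSubalgebra := hX
  rw [localAlgebra_toSubalgebra] at h1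
  classical
  induction h1 using Algebra.adjoin_induction with
  | mem T hT =>
    obtain ⟨x, rfl | rfl⟩ := hT
    · exact ⟨{x}, fun L h => (h x (Finset.mem_singleton_self x)).1⟩
    · exact ⟨{x}, fun L h => (h x (Finset.mem_singleton_self x)).2⟩
  | algebraMap r => exact ⟨∅, fun L _ => (Algebra.commutes r L).symm⟩
  | add S T hS hT ihS ihT =>
    rw [← localAlgebra_toSubalgebra] at hS hT
    obtain ⟨K, hK⟩ := ihS hS
    obtain ⟨K', hK'⟩ := ihT hT
    exact ⟨K ∪ K', fun L h => (hK L fun x hx => h x (Finset.mem_union_left _ hx)).add_right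
      (hK' L fun x hx => h x (Finset.mem_union_right _ hx))⟩
  | mul S T hS hT ihS ihT =>
    rw [← localAlgebra_toSubalgebra] at hS hT
    obtain ⟨K, hK⟩ := ihS hS
    obtain ⟨K', hK'⟩ := ihT hT
    exact ⟨K ∪ K', fun L h => (hK L fun x hx => h x (Finset.mem_union_left _ hx)).mul_right
      (hK' L fun x hx => h x (Finset.mem_union_right _ hx))⟩

/-- If arbitrarily far away there are contractions that stabilise the ground state and to which `α`
and `β` give opposite signs, then they define inequivalent sectors: a unitary that intertwines the
sectors would map the GNS vector to an eigenvector of these contractions for the eigenvalue `-1`,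
whereas every vector is approximately fixed by them. -/
theorem not_unitarilyEquivalent {α β : 𝒜 →⋆ₐ[ℂ] 𝒜}
    (h : ∀ K : Finset Edge, ∃ (L : 𝒜) (s : ℂ), ‖L‖ ≤ 1 ∧ s ≠ 0 ∧ α L = s • L ∧ β L = -s • L ∧
      (∀ x ∈ K, Commute (L : B₀) (σX x : B₀) ∧ Commute (L : B₀) (σZ x : B₀)) ∧
      ∀ᶠ n in Filter.atTop, (L : B₀) (stringVector n) = stringVector n) :
    ¬ UnitarilyEquivalent (gns.comp α) (gns.comp β) := by
  rintro ⟨U, hU⟩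
  obtain ⟨X, hX, hψ⟩ := exists_local_approx (U vacuumVector) one_pos
  obtain ⟨K, hK⟩ := exists_support hX
  obtain ⟨L, s, hL, hs, hα, hβ, hcomm, hstab⟩ := h K
  have h0 := gns_vacuumVector_of_eventually hstab
  have h1 : gns L (U vacuumVector) = -U vacuumVector := by
    have h2 := hU L vacuumVector
    change U (gns (α L) vacuumVector) = gns (β L) (U vacuumVector) at h2
    rw [hα, hβ, map_smul, map_smul, smul_apply, smul_apply, h0, map_smul, neg_smul,
      ← smul_neg] at h2
    have h3 := smul_right_injective _ hs h2
    rw [← neg_eq_iff_eq_neg] at h3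
    exact h3.symm
  have h4 : gns L (gns X vacuumVector) = gns X vacuumVector := by
    have h5 : L * X = X * L := Subtype.ext (hK L hcomm)
    have h6 : ∀ S T : 𝒜, gns (S * T) vacuumVector = gns S (gns T vacuumVector) := fun S T => by
      rw [map_mul]
      rfl
    rw [← h6, h5, h6, h0]
  have h7 : ‖-U vacuumVector - gns X vacuumVector‖ < 1 := by
    have h8 : gns L (U vacuumVector - gns X vacuumVector) =
        -U vacuumVector - gns X vacuumVector := by rw [map_sub, h1, h4]
    rw [← h8]
    refine ((gns L).le_opNorm _).trans_lt ((mul_le_of_le_one_left (norm_nonneg _) ?_).trans_lt hψ)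
    exact (NonUnitalStarAlgHom.norm_apply_le gns L).trans hL
  have h8 := norm_sub_le (U vacuumVector - gns X vacuumVector)
    (-U vacuumVector - gns X vacuumVector)
  rw [sub_sub_sub_cancel_right, sub_neg_eq_add, ← two_smul ℝ, norm_smul, U.norm_map,
    norm_vacuumVector, Real.norm_ofNat, mul_one] at h8
  linarith

/-! ### The path along the axis of a cone -/

/-- The half-infinite zigzag between the columns `q - 1` and `q` of hexagons that comes down from
infinity, keeps the column `q` on its left and ends at the height `J`. -/
def rayPath (q J : ℤ) : Set Dart :=
  {d | d.1.1 = q ∧ (d.2 = 3 ∧ J ≤ 2 * d.1.2 ∨ d.2 = 2 ∧ J ≤ 2 * d.1.2 + 1)}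

theorem center_zero (h : Hexagon) : center h 0 = 3 / 2 * (h.1 : ℝ) := rfl

theorem center_one (h : Hexagon) : center h 1 = √3 * ((h.2 : ℝ) + (h.1 : ℝ) / 2) := rfl

theorem sqrt_three_sq : √3 * √3 = 3 := Real.mul_self_sqrt (by norm_num)

theorem plane_dist (x y : Plane) : dist x y = √((x 0 - y 0) ^ 2 + (x 1 - y 1) ^ 2) := by
  rw [EuclideanSpace.dist_eq, Fin.sum_univ_two, Real.dist_eq, Real.dist_eq, sq_abs, sq_abs]

/-- The perpendicular bisector of two centres of hexagons. -/
theorem dist_center_lt_iff (x : Plane) (h v : Hexagon) :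
    dist x (center h) < dist x (center (h + v)) ↔
      3 * v.1 * (x 0 - center h 0) + √3 * (2 * v.2 + v.1) * (x 1 - center h 1) <
        3 * (v.1 ^ 2 + v.1 * v.2 + v.2 ^ 2) := by
  rw [plane_dist, plane_dist, Real.sqrt_lt_sqrt_iff (by positivity)]
  simp only [center_zero, center_one, Prod.fst_add, Prod.snd_add]
  push_cast
  generalize x 0 = a
  generalize x 1 = b
  have h3 : √3 ^ 2 = 3 := Real.sq_sqrt (by norm_num)
  ring_nf
  rw [h3]
  constructor <;> intro h <;> nlinarith [h]

/-- The open hexagon in coordinates relative to its centre. -/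
theorem mem_openHexagon_iff (x : Plane) (h : Hexagon) : x ∈ openHexagon h ↔
    |√3 * (x 1 - center h 1)| < 3 / 2 ∧
      3 * |x 0 - center h 0| + |√3 * (x 1 - center h 1)| < 3 := by
  change (∀ k, dist x (center h) < dist x (center (h + dir k))) ↔ _
  simp only [dist_center_lt_iff]
  generalize x 0 - center h 0 = a
  generalize x 1 - center h 1 = b
  constructor
  · intro H
    have h0 := H 0
    have h1 := H 1
    have h2 := H 2
    have h3 := H 3
    have h4 := H 4
    have h5 := H 5
    simp [dir] at h0 h1 h2 h3 h4 h5
    constructor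
    · rw [abs_lt]
      constructor <;> linarith
    · rcases abs_cases a with ⟨e, -⟩ | ⟨e, -⟩ <;>
        rcases abs_cases (√3 * b) with ⟨e', -⟩ | ⟨e', -⟩ <;> rw [e, e'] <;> linarith
  · rintro ⟨h1, h2⟩ k
    have := abs_lt.1 h1
    have := le_abs_self a
    have := neg_abs_le a
    have := le_abs_self (√3 * b)
    have := neg_abs_le (√3 * b)
    fin_cases k <;> simp [dir] <;> linarith

theorem norm_sq_lt_of_mem_openHexagon {x : Plane} {h : Hexagon} (hx : x ∈ openHexagon h) :
    (x 0 - center h 0) ^ 2 + (x 1 - center h 1) ^ 2 < 1 := by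
  rw [mem_openHexagon_iff] at hx
  obtain ⟨h1, h2⟩ := hx
  generalize x 0 - center h 0 = a at *
  generalize x 1 - center h 1 = b at *
  have h3 : 3 * b ^ 2 = |√3 * b| ^ 2 := by
    rw [sq_abs, mul_pow, Real.sq_sqrt (by norm_num)]
  rw [← sq_abs a]
  have := abs_nonneg a
  have := abs_nonneg (√3 * b)
  nlinarith

theorem abs_lt_of_mem_openHexagon {x : Plane} {h : Hexagon} (hx : x ∈ openHexagon h) :
    |x 0 - center h 0| < 1 := by
  rw [mem_openHexagon_iff] at hx
  linarith [hx.2, abs_nonneg (√3 * (x 1 - center h 1))]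

theorem mid_zero (d : Dart) : Dart.mid d 0 = center d.1 0 + 3 / 4 * ((dir d.2).1 : ℝ) := by
  have : Dart.mid d 0 = midpoint ℝ (center (Dart.left d) 0) (center (Dart.right d) 0) := by
    simp [Dart.mid, midpoint_eq_smul_add, mul_add]
  rw [this, midpoint_eq_smul_add, center_zero, center_zero, Dart.left, Dart.right, Prod.fst_add,
    center_zero, smul_eq_mul, invOf_eq_inv]
  push_cast
  ring

theorem mid_one (d : Dart) : Dart.mid d 1 =
    center d.1 1 + √3 / 4 * (2 * ((dir d.2).2 : ℝ) + (dir d.2).1) := by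
  have : Dart.mid d 1 = midpoint ℝ (center (Dart.left d) 1) (center (Dart.right d) 1) := by
    simp [Dart.mid, midpoint_eq_smul_add, mul_add]
  rw [this, midpoint_eq_smul_add, center_one, center_one, Dart.left, Dart.right, Prod.fst_add,
    Prod.snd_add, center_one, smul_eq_mul, invOf_eq_inv]
  push_cast
  ring

/-- The axis of the right half-cone, turned clockwise by `φ` from the vertical. -/
theorem rotate_neg_up (φ : ℝ) : rotate (-φ) !₂[0, 1] = !₂[Real.sin φ, Real.cos φ] := by
  unfold rotate
  simp

theorem mem_cone_iff (p x : Plane) (θ : ℝ) : x ∈ cone p (rotate (-(θ / 4)) !₂[0, 1]) (θ / 2) ↔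
    √((x 0 - p 0) ^ 2 + (x 1 - p 1) ^ 2) * Real.cos (θ / 4) <
      (x 0 - p 0) * Real.sin (θ / 4) + (x 1 - p 1) * Real.cos (θ / 4) := by
  rw [rotate_neg_up, cone]
  change ‖x - p‖ * Real.cos (θ / 2 / 2) < _ ↔ _
  rw [← dist_eq_norm, plane_dist, show θ / 2 / 2 = θ / 4 by ring,
    EuclideanSpace.inner_eq_star_dotProduct]
  simp [Fin.sum_univ_two, mul_comm, dotProduct]

theorem pos_of_cone {a b s c : ℝ} (hs : 0 < s) (hc : 0 < c)
    (h : √(a ^ 2 + b ^ 2) * c < a * s + b * c) : 0 < a := by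
  have h1 : b ≤ √(a ^ 2 + b ^ 2) := Real.le_sqrt_of_sq_le (by nlinarith [sq_nonneg a])
  have h2 : b * c ≤ √(a ^ 2 + b ^ 2) * c := mul_le_mul_of_nonneg_right h1 hc.le
  exact pos_of_mul_pos_left (by linarith) hs.le

/-- The part of the cone to the left of its axis. -/
theorem cone_of_left {a b s c : ℝ} (hs : 0 < s) (hc : 0 < c) (ha : 0 < a) (h : c * a < s * b) :
    √(a ^ 2 + b ^ 2) * c < a * s + b * c := by
  have hb : 0 < b := pos_of_mul_pos_right (lt_trans (mul_pos hc ha) h) hs.le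
  have h1 : √(a ^ 2 + b ^ 2) * c = √((a ^ 2 + b ^ 2) * c ^ 2) := by
    rw [Real.sqrt_mul (by positivity), Real.sqrt_sq hc.le]
  rw [h1, Real.sqrt_lt' (by positivity)]
  nlinarith [mul_pos ha hs, mul_pos (mul_pos ha hc) (sub_pos.2 h), mul_pos ha hc,
    mul_pos (mul_pos ha hs) (mul_pos ha hs)]

/-- Points to the left of the axis of the cone and below its apex make an obtuse angle with all
points of the cone. -/
theorem inner_nonpos_of_cone {a b x y s c : ℝ} (hs : 0 < s) (hc : 0 < c)
    (h : √(x ^ 2 + y ^ 2) * c < x * s + y * c) (ha : a ≤ 0) (hb : b ≤ 0) (hab : c * a < s * b) :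
    a * x + b * y ≤ 0 := by
  have hx := pos_of_cone hs hc h
  rcases le_total 0 y with hy | hy
  · nlinarith
  · have h1 : 0 < x * s + y * c := lt_of_le_of_lt (by positivity) h
    have h2 : s * (a * x + b * y) ≤ a * (x * s + y * c) := by nlinarith
    have h3 : a * (x * s + y * c) ≤ 0 := mul_nonpos_of_nonpos_of_nonneg ha h1.le
    by_contra h4
    have := mul_pos hs (not_le.1 h4)
    linarith

section Axis

variable {p : Plane} {θ : ℝ}

/-- A hexagon above the apex on the vertical through it meets the cone. -/
theorem mem_overlapping_of_above (hs : 0 < Real.sin (θ / 4)) (hc : 0 < Real.cos (θ / 4))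
    {h : Hexagon} (h1 : center h 0 - 1 ≤ p 0) (h2 : p 0 < center h 0 + 1) (h3 : p 1 < center h 1) :
    h ∈ overlapping (cone p (rotate (-(θ / 4)) !₂[0, 1]) (θ / 2)) := by
  set s := Real.sin (θ / 4)
  set c := Real.cos (θ / 4)
  obtain ⟨ε, hε, hε'⟩ : ∃ ε, 0 < ε ∧ ε < min (center h 0 + 1 - p 0) (s * (center h 1 - p 1) / c) :=
    exists_between (lt_min (by linarith) (div_pos (mul_pos hs (by linarith)) hc))
  obtain ⟨h4, h5⟩ := lt_min_iff.1 hε'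
  rw [lt_div_iff₀ hc] at h5
  refine ⟨!₂[p 0 + ε, center h 1], ?_, ?_⟩
  · rw [mem_openHexagon_iff]
    have : |p 0 + ε - center h 0| < 1 := by
      rw [abs_lt]
      constructor <;> linarith
    simp
    linarith
  · rw [mem_cone_iff]
    refine cone_of_left hs hc (by simpa using hε) ?_
    simp
    linarith

/-- The hexagons that meet the cone lie to the right of its left leg. -/
theorem lt_of_mem_overlapping (hs : 0 < Real.sin (θ / 4)) (hc : 0 < Real.cos (θ / 4))
    {h : Hexagon} (hh : h ∈ overlapping (cone p (rotate (-(θ / 4)) !₂[0, 1]) (θ / 2))) :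
    p 0 < center h 0 + 1 := by
  obtain ⟨x, hx, hxc⟩ := hh
  rw [mem_cone_iff] at hxc
  have h1 := pos_of_cone hs hc hxc
  have h2 := (abs_lt.1 (abs_lt_of_mem_openHexagon hx)).2
  linarith

theorem exists_pos_combination {u u' w w' : ℝ} (hu : 0 < u) (hw : 0 < w) :
    ∃ t, 0 < t ∧ t < 1 ∧ 0 < (1 - t) * u + t * u' ∧ 0 < (1 - t) * w + t * w' := by
  have key : ∀ {u u' : ℝ}, 0 < u → ∀ᶠ t in 𝓝[>] (0 : ℝ), 0 < (1 - t) * u + t * u' := by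
    intro u u' hu
    have h1 : Continuous fun t : ℝ => (1 - t) * u + t * u' := by fun_prop
    refine (h1.tendsto 0).eventually (lt_mem_nhds ?_) |>.filter_mono nhdsWithin_le_nhds
    simpa using hu
  obtain ⟨t, h1, h2, h3⟩ :=
    (Filter.Eventually.and (Ioo_mem_nhdsGT (one_pos (α := ℝ)))
      ((key (u' := u') hu).and (key (u' := w') hw))).exists
  exact ⟨t, h1.1, h1.2, h2, h3⟩

theorem center_right_zero (d : Dart) :
    center (Dart.right d) 0 = center d.1 0 + 3 / 2 * ((dir d.2).1 : ℝ) := by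
  rw [center_zero, center_zero, Dart.right, Prod.fst_add]
  push_cast
  ring

theorem center_right_one (d : Dart) : center (Dart.right d) 1 =
    center d.1 1 + √3 / 2 * (2 * ((dir d.2).2 : ℝ) + (dir d.2).1) := by
  rw [center_one, center_one, Dart.right, Prod.fst_add, Prod.snd_add]
  push_cast
  ring

theorem dir_sq_add (k : Fin 6) : ((dir k).1 : ℝ) ^ 2 + ((dir k).1 : ℝ) * (dir k).2
    + ((dir k).2 : ℝ) ^ 2 = 1 := by
  fin_cases k <;> simp [dir]

/-- The interior of the segment from the midpoint of an edge to the centre of an adjacent hexagon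
lies in that hexagon. -/
theorem combination_mem_openHexagon (d : Dart) {t : ℝ} (h0 : 0 < t) (h1 : t < 1) :
    (!₂[(1 - t) * Dart.mid d 0 + t * center (Dart.right d) 0,
      (1 - t) * Dart.mid d 1 + t * center (Dart.right d) 1] : Plane) ∈
        openHexagon (Dart.right d) := by
  rw [mem_openHexagon_iff]
  have e0 : (1 - t) * Dart.mid d 0 + t * center (Dart.right d) 0 - center (Dart.right d) 0 =
      -((1 - t) * (3 / 4) * ((dir d.2).1 : ℝ)) := by
    rw [mid_zero, center_right_zero]
    ring
  have e1 : √3 * ((1 - t) * Dart.mid d 1 + t * center (Dart.right d) 1 -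
      center (Dart.right d) 1) = -((1 - t) * (3 / 4) * (2 * ((dir d.2).2 : ℝ) + (dir d.2).1)) := by
    rw [mid_one, center_right_one]
    have := sqrt_three_sq
    linear_combination (-(1 - t) / 4 * (2 * ((dir d.2).2 : ℝ) + (dir d.2).1)) * this
  change |√3 * ((1 - t) * Dart.mid d 1 + t * center (Dart.right d) 1 -
      center (Dart.right d) 1)| < 3 / 2 ∧
    3 * |(1 - t) * Dart.mid d 0 + t * center (Dart.right d) 0 - center (Dart.right d) 0| +
      |√3 * ((1 - t) * Dart.mid d 1 + t * center (Dart.right d) 1 -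
      center (Dart.right d) 1)| < 3
  rw [e0, e1, abs_neg, abs_neg, abs_mul, abs_mul ((1 - t) * (3 / 4)),
    abs_of_pos (by linarith : 0 < (1 - t) * (3 / 4))]
  generalize d.2 = k
  fin_cases k <;> norm_num [dir] <;> constructor <;> linarith

theorem mem_axisPath_iff {n : ℝ} (d : Dart) : d ∈ axisPath p !₂[0, 1] θ n ↔
    (Dart.left d ∈ overlapping (cone p (rotate (-(θ / 4)) !₂[0, 1]) (θ / 2)) ∧
      Dart.right d ∉ overlapping (cone p (rotate (-(θ / 4)) !₂[0, 1]) (θ / 2))) ∧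
    n < dist (Dart.mid d) p ∧ 0 < Real.sin (θ / 4) * (Dart.mid d 1 - p 1) -
      Real.cos (θ / 4) * (Dart.mid d 0 - p 0) := by
  rw [rotate_neg_up]
  unfold axisPath leftLegPath
  rw [rotate_neg_up]
  rfl

theorem lt_sq_of_lt_dist {d : Dart} {n : ℝ} (hn : 2 < n) (h : n < dist (Dart.mid d) p) :
    4 < (Dart.mid d 0 - p 0) ^ 2 + (Dart.mid d 1 - p 1) ^ 2 := by
  rw [plane_dist] at h
  have := (Real.lt_sqrt (by norm_num)).1 (hn.trans h)
  linarith

theorem abs_dir_le (k : Fin 6) : |((dir k).1 : ℝ)| ≤ 1 ∧ |2 * ((dir k).2 : ℝ) + (dir k).1| ≤ 2 := by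
  fin_cases k <;> norm_num [dir]

/-- If the column `q` is the leftmost one that extends to the right of the apex, then the path
consists of the edges on the left side of this column that lie above the apex and far enough from
it. -/
theorem mem_axisPath_iff_column (hs : 0 < Real.sin (θ / 4)) (hc : 0 < Real.cos (θ / 4)) {n : ℝ}
    (hn : 2 < n) {q : ℤ} (hq : 3 / 2 * ((q : ℝ) - 1) + 1 ≤ p 0) (hq' : p 0 < 3 / 2 * (q : ℝ) + 1)
    (d : Dart) : d ∈ axisPath p !₂[0, 1] θ n ↔
      (d.1.1 = q ∧ (d.2 = 2 ∨ d.2 = 3)) ∧ n < dist (Dart.mid d) p ∧ p 1 < Dart.mid d 1 := by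
  rw [mem_axisPath_iff]
  have hm0 := mid_zero d
  have hm1 := mid_one d
  have hr0 := center_right_zero d
  have hr1 := center_right_one d
  have h3 := sqrt_three_sq
  have h3' : 0 < √3 := by positivity
  obtain ⟨hk1, hk2⟩ := abs_dir_le d.2
  rw [abs_le] at hk1 hk2
  constructor
  · rintro ⟨⟨hl, hr⟩, hd, hleft⟩
    have h4 := lt_sq_of_lt_dist hn hd
    -- the midpoint lies in the closure of a hexagon that does not meet the cone
    have ha : Dart.mid d 0 - p 0 ≤ 0 := by
      by_contra ha
      obtain ⟨t, h0, h1, h5, h6⟩ := exists_pos_combination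
        (u' := center (Dart.right d) 0 - p 0)
        (w' := Real.sin (θ / 4) * (center (Dart.right d) 1 - p 1) -
          Real.cos (θ / 4) * (center (Dart.right d) 0 - p 0)) (not_le.1 ha) hleft
      refine hr ⟨_, combination_mem_openHexagon d h0 h1, ?_⟩
      rw [mem_cone_iff]
      refine cone_of_left hs hc ?_ ?_
      · simp only [Matrix.cons_val_zero]
        linarith
      · simp only [Matrix.cons_val_zero, Matrix.cons_val_one]
        linarith
    -- otherwise the midpoint would be below the apex, and the cone too far away to meet a hexagon
    -- that contains the midpoint in its closure
    have hb : 0 < Dart.mid d 1 - p 1 := by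
      by_contra hb
      obtain ⟨x, hx, hxc⟩ := hl
      rw [mem_cone_iff] at hxc
      have h5 := inner_nonpos_of_cone hs hc hxc ha (not_lt.1 hb) (by linarith)
      have h6 := norm_sq_lt_of_mem_openHexagon hx
      have h7 : (Dart.mid d 0 - center d.1 0) ^ 2 + (Dart.mid d 1 - center d.1 1) ^ 2 = 3 / 4 := by
        rw [hm0, hm1]
        have := dir_sq_add d.2
        have h8 : √3 ^ 2 = 3 := Real.sq_sqrt (by norm_num)
        linear_combination (3 / 4) * this +
          (1 / 16) * (2 * ((dir d.2).2 : ℝ) + (dir d.2).1) ^ 2 * h8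
      change (x 0 - center d.1 0) ^ 2 + (x 1 - center d.1 1) ^ 2 < 1 at h6
      nlinarith only [h4, h5, h6, h7, sq_nonneg (x 0 - p 0), sq_nonneg (x 1 - p 1),
        sq_nonneg (x 0 - center d.1 0 + (Dart.mid d 0 - center d.1 0)),
        sq_nonneg (x 1 - center d.1 1 + (Dart.mid d 1 - center d.1 1))]
    have h5 := lt_of_mem_overlapping hs hc hl
    rw [center_zero, Dart.left] at h5
    have h6 : q ≤ d.1.1 := by
      by_contra h7
      have : (d.1.1 : ℝ) ≤ q - 1 := by exact_mod_cast Int.le_sub_one_of_lt (not_le.1 h7)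
      linarith
    -- the hexagon on the right does not meet the cone, but all hexagons above the apex on the
    -- vertical through it do
    have h7 : (Dart.right d).1 < q := by
      by_contra h8
      have h9 : (q : ℝ) ≤ (Dart.right d).1 := by exact_mod_cast not_lt.1 h8
      have h6' : (q : ℝ) ≤ d.1.1 := by exact_mod_cast h6
      have e : ((Dart.right d).1 : ℝ) = d.1.1 + ((dir d.2).1 : ℝ) := by
        rw [Dart.right, Prod.fst_add]
        push_cast
        rfl
      have e' := center_zero d.1
      refine hr (mem_overlapping_of_above hs hc ?_ ?_ ?_)
      · linarith
      · rw [center_zero]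
        linarith
      · have h10 : -1 < Dart.mid d 0 - p 0 := by linarith
        have h11 : √3 < Dart.mid d 1 - p 1 := by
          refine (Real.sqrt_lt' hb).2 ?_
          nlinarith only [h4, h10, ha]
        have h12 := mul_le_mul_of_nonneg_left hk2.1 h3'.le
        rw [hr1]
        linarith
    rw [Dart.right, Prod.fst_add] at h7
    have h8 : -1 ≤ (dir d.2).1 := by exact_mod_cast hk1.1
    refine ⟨⟨by omega, ?_⟩, hd, by linarith⟩
    have h9 : (dir d.2).1 = -1 := by omega
    revert h9
    generalize d.2 = k
    revert k
    decide
  · rintro ⟨⟨h1, h2⟩, hd, hb⟩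
    have h4 := lt_sq_of_lt_dist hn hd
    have hk : ((dir d.2).1 : ℝ) = -1 ∧ |2 * ((dir d.2).2 : ℝ) + (dir d.2).1| ≤ 1 := by
      rcases h2 with h2 | h2
      · rw [h2, show dir 2 = (-1, 1) from rfl]
        norm_num
      · rw [h2, show dir 3 = (-1, 0) from rfl]
        norm_num
    have e' := center_zero d.1
    rw [h1] at e'
    rw [hk.1] at hm0 hr0
    have h5 : √3 / 2 < Dart.mid d 1 - p 1 := by
      have : √3 < 2 * (Dart.mid d 1 - p 1) := by
        refine (Real.sqrt_lt' (by linarith)).2 ?_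
        have h6 : -(7 / 4) < Dart.mid d 0 - p 0 := by linarith
        have h7 : Dart.mid d 0 - p 0 < 0 := by linarith
        nlinarith only [h4, h6, h7]
      linarith
    have hk' := abs_le.1 hk.2
    refine ⟨⟨mem_overlapping_of_above hs hc ?_ ?_ ?_, fun hr => ?_⟩, hd, ?_⟩
    · change center d.1 0 - 1 ≤ p 0
      linarith
    · change p 0 < center d.1 0 + 1
      linarith
    · have h6 := mul_le_mul_of_nonneg_left hk'.2 h3'.le
      change p 1 < center d.1 1
      linarith
    · have := lt_of_mem_overlapping hs hc hr
      linarith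
    · have h6 : Dart.mid d 0 - p 0 < 0 := by linarith
      have := mul_pos hs (by linarith : 0 < Dart.mid d 1 - p 1)
      have := mul_neg_of_pos_of_neg hc h6
      linarith

/-- The path along the axis of a cone is the upper part of a vertical zigzag. -/
theorem exists_axisPath_eq_rayPath (hθ : 0 < θ) (hθ' : θ < 2 * Real.pi) {n : ℝ} (hn : 2 < n) :
    ∃ q J, axisPath p !₂[0, 1] θ n = rayPath q J := by
  have hs : 0 < Real.sin (θ / 4) := Real.sin_pos_of_pos_of_lt_pi (by linarith) (by linarith)
  have hc : 0 < Real.cos (θ / 4) := Real.cos_pos_of_mem_Ioo ⟨by linarith, by linarith⟩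
  obtain ⟨q, hq, hq'⟩ : ∃ q : ℤ, 3 / 2 * ((q : ℝ) - 1) + 1 ≤ p 0 ∧ p 0 < 3 / 2 * (q : ℝ) + 1 := by
    refine ⟨⌊(p 0 - 1) / (3 / 2)⌋ + 1, ?_, ?_⟩
    · have := Int.floor_le ((p 0 - 1) / (3 / 2))
      rw [le_div_iff₀ (by norm_num)] at this
      push_cast
      linarith
    · have := Int.lt_floor_add_one ((p 0 - 1) / (3 / 2))
      rw [div_lt_iff₀ (by norm_num)] at this
      push_cast
      linarith
  -- the height of the midpoint of the `j`-th edge of the zigzag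
  let y : ℤ → ℝ := fun j => √3 * ((j : ℝ) / 2 + (q : ℝ) / 2 - 1 / 4)
  -- the condition for the `j`-th edge of the zigzag to belong to the path; it is upward closed
  let Q : ℤ → Prop := fun j => n < √((3 / 2 * (q : ℝ) - 3 / 4 - p 0) ^ 2 + (y j - p 1) ^ 2) ∧
    p 1 < y j
  have h3 : 0 < √3 := by positivity
  have hy : ∀ {i j : ℤ}, i ≤ j → y i ≤ y j := by
    intro i j h
    have : (i : ℝ) ≤ j := by exact_mod_cast h
    exact mul_le_mul_of_nonneg_left (by linarith) h3.le
  have hmono : ∀ {i j : ℤ}, i ≤ j → Q i → Q j := by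
    rintro i j h ⟨h1, h2⟩
    refine ⟨h1.trans_le (Real.sqrt_le_sqrt ?_), h2.trans_le (hy h)⟩
    have := hy h
    nlinarith
  have hlarge : ∀ r : ℝ, ∃ j : ℤ, r < y j := by
    intro r
    obtain ⟨j, hj⟩ := exists_int_gt (2 * (r / √3 - (q : ℝ) / 2 + 1 / 4))
    refine ⟨j, ?_⟩
    have : r / √3 < (j : ℝ) / 2 + (q : ℝ) / 2 - 1 / 4 := by linarith
    rwa [div_lt_iff₀' h3] at this
  have hbdd : ∃ b, ∀ j, Q j → b ≤ j := by
    obtain ⟨b, hb⟩ := exists_int_lt (2 * (p 1 / √3 - (q : ℝ) / 2 + 1 / 4))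
    refine ⟨b, fun j hj => ?_⟩
    by_contra hjb
    have h1 : (j : ℝ) < b := by exact_mod_cast not_le.1 hjb
    have h2 : (j : ℝ) / 2 + (q : ℝ) / 2 - 1 / 4 < p 1 / √3 := by linarith
    rw [lt_div_iff₀' h3] at h2
    exact lt_asymm h2 hj.2
  have hex : ∃ j, Q j := by
    obtain ⟨j, hj⟩ := hlarge (p 1 + |n|)
    have h0 := abs_nonneg n
    refine ⟨j, (le_abs_self n).trans_lt (Real.lt_sqrt_of_sq_lt ?_), by linarith⟩
    have : |n| < y j - p 1 := by linarith
    nlinarith [sq_nonneg (3 / 2 * (q : ℝ) - 3 / 4 - p 0)]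
  obtain ⟨J, hJ, hJmin⟩ := Int.exists_least_of_bdd hbdd hex
  have hQ : ∀ j, Q j ↔ J ≤ j := fun j => ⟨hJmin j, fun h => hmono h hJ⟩
  refine ⟨q, J, Set.ext fun d => ?_⟩
  rw [mem_axisPath_iff_column hs hc hn hq hq']
  obtain ⟨⟨h1, h2⟩, k⟩ := d
  have key : ∀ j : ℤ, h1 = q → (dir k).1 = -1 → ((j : ℝ) = 2 * (h2 : ℝ) + (dir k).2) →
      ((n < dist (Dart.mid ((h1, h2), k)) p ∧ p 1 < Dart.mid ((h1, h2), k) 1) ↔ J ≤ j) := by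
    rintro j rfl hk hj
    rw [← hQ, plane_dist, mid_zero, mid_one, center_zero, center_one]
    have e0 : 3 / 2 * (h1 : ℝ) + 3 / 4 * ((dir k).1 : ℝ) - p 0 =
        3 / 2 * (h1 : ℝ) - 3 / 4 - p 0 := by
      rw [hk]
      push_cast
      ring
    have e1 : √3 * ((h2 : ℝ) + (h1 : ℝ) / 2) + √3 / 4 * (2 * ((dir k).2 : ℝ) + (dir k).1) =
        y j := by
      change _ = √3 * ((j : ℝ) / 2 + (h1 : ℝ) / 2 - 1 / 4)
      rw [hk, hj]
      push_cast
      ring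
    dsimp only
    rw [e0, e1]
  change (h1 = q ∧ (k = 2 ∨ k = 3)) ∧ _ ↔ h1 = q ∧ (k = 3 ∧ J ≤ 2 * h2 ∨ k = 2 ∧ J ≤ 2 * h2 + 1)
  rw [and_assoc]
  refine and_congr_right fun hh => ?_
  constructor
  · rintro ⟨rfl | rfl, h⟩
    · exact Or.inr ⟨rfl, (key _ hh rfl (by simp [dir])).1 h⟩
    · exact Or.inl ⟨rfl, (key _ hh rfl (by simp [dir])).1 h⟩
  · rintro (⟨rfl, h⟩ | ⟨rfl, h⟩)
    · exact ⟨Or.inr rfl, (key _ hh rfl (by simp [dir])).2 h⟩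
    · exact ⟨Or.inl rfl, (key _ hh rfl (by simp [dir])).2 h⟩

end Axis

/-! ### Stabilisers of the ground state -/

/-- The action of the product of a flip and a diagonal operator on a finite volume vector: the
phases only have to be correct on boundaries. -/
theorem monomial_stringVector {T : Finset Hexagon} {f : Config → Circle}
    (hf : ∀ S, (f (boundary S) : ℂ) = ((relSign T S : ℤ) : ℂ)) {n : ℕ} (hT : T ⊆ patch n) :
    ((flipX (boundary T) * diag f : unitary B₀) : B₀) (stringVector n) = stringVector n := by
  rw [stringVector_eq, map_smul]
  congr 1
  unfold stringSum
  rw [map_sum]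
  have hmem : ∀ S ∈ (patch n).powerset, symmDiff S T ∈ (patch n).powerset := by
    intro S hS
    rw [Finset.mem_powerset] at hS ⊢
    exact symmDiff_le_sup.trans (sup_le hS hT)
  refine Finset.sum_nbij' (fun S => symmDiff S T) (fun S => symmDiff S T) hmem hmem
    (fun S _ => symmDiff_symmDiff_cancel_right _ _)
    (fun S _ => symmDiff_symmDiff_cancel_right _ _) fun S _ => ?_
  rw [map_smul, flip_mul_diag_ket, smul_smul, hf, ← boundary_symmDiff, ← Int.cast_mul,
    ← Units.val_mul, relSign, ← mul_assoc, Int.units_mul_self, one_mul]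

theorem norm_monomial_le (F : Finset Edge) (f : Config → Circle) :
    ‖((flipX F * diag f : unitary B₀) : B₀)‖ ≤ 1 := by
  have h := CStarRing.norm_coe_unitary_mul (flipX F * diag f) (1 : B₀)
  rw [mul_one] at h
  rw [h]
  exact ContinuousLinearMap.norm_id_le

/-- A monomial commutes with the Pauli matrices away from its flipped edges and the edges on which
its phases depend. -/
theorem commute_monomial {E F : Finset Edge} {f : Config → Circle} (hf : DependsOn E f) {x : Edge}
    (hE : x ∉ E) (hF : x ∉ F) :
    Commute ((flipX F * diag f : unitary B₀) : B₀) (σX x : B₀) ∧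
      Commute ((flipX F * diag f : unitary B₀) : B₀) (σZ x : B₀) := by
  have hX : σX x = flipX {x} * diag fun _ => 1 := by rw [diag_one, mul_one]; rfl
  have hZ : σZ x = flipX ∅ * diag fun c => if x ∈ c then -1 else 1 := by
    rw [flip_empty, one_mul]; rfl
  constructor
  · refine congrArg Subtype.val (?_ : (flipX F * diag f) * σX x = σX x * (flipX F * diag f))
    rw [hX, flip_mul_diag_mul, flip_mul_diag_mul, symmDiff_comm]
    congr 2
    funext c
    rw [one_mul, mul_one]
    refine hf _ _ fun y hy => ?_
    have : y ≠ x := fun e => hE (e ▸ hy)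
    simp [Finset.mem_symmDiff, this]
  · refine congrArg Subtype.val (?_ : (flipX F * diag f) * σZ x = σZ x * (flipX F * diag f))
    rw [hZ, flip_mul_diag_mul, flip_mul_diag_mul, symmDiff_comm]
    congr 2
    funext c
    rw [← Finset.bot_eq_empty, symmDiff_bot, mul_comm]
    simp [Finset.mem_symmDiff, hF]

/-! ### Conjugation by string operators -/

theorem stringAut_eq_of_eventually {a : Anyon} {P : Set Dart} {T R : 𝒜}
    (h : ∀ᶠ F in Filter.atTop, (stringOperator a (truncate P F) : B₀) * T *
      star (stringOperator a (truncate P F) : B₀) = R) : stringAut a P T = R :=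
  Subtype.ext (Filter.Tendsto.limUnder_eq (tendsto_const_nhds.congr' (h.mono fun _ => Eq.symm)))

theorem tendsto_stringAut (a : Anyon) (P : Set Dart) (T : 𝒜) :
    Filter.Tendsto (fun F => (stringOperator a (truncate P F) : B₀) * T *
      star (stringOperator a (truncate P F) : B₀)) Filter.atTop (𝓝 (stringAut a P T : B₀)) :=
  tendsto_conjLimit (exists_conjLimit (fun _ hT => (exists_limit_generator a P hT).1) T T.2)

theorem diag_mul_const (z : Circle) (F : Finset Edge) (f : Config → Circle) :
    ((flipX F * diag fun c => z * f c : unitary B₀) : B₀) =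
      (z : ℂ) • ((flipX F * diag f : unitary B₀) : B₀) := by
  refine ContinuousLinearMap.ext fun ψ => lp.ext (funext fun c => ?_)
  change _ = (z : ℂ) * ((flipX F * diag f : unitary B₀) : B₀) ψ c
  rw [flip_mul_diag_apply, flip_mul_diag_apply, Circle.coe_mul, mul_assoc]

/-- A monomial that commutes with another one up to a phase `s` multiplies it by `s` under
conjugation. -/
theorem conj_monomial {F G : Finset Edge} {f g : Config → Circle} {s : Circle}
    (h : ∀ c, g (symmDiff c F) * f c = s * f (symmDiff c G) * g c) :
    ((flipX G * diag g : unitary B₀) : B₀) * ((flipX F * diag f : unitary B₀) : B₀) *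
      star ((flipX G * diag g : unitary B₀) : B₀) =
        (s : ℂ) • ((flipX F * diag f : unitary B₀) : B₀) := by
  have h1 : (flipX G * diag g) * (flipX F * diag f) =
      (flipX F * diag fun c => s * f c) * (flipX G * diag g) := by
    rw [flip_mul_diag_mul, flip_mul_diag_mul, symmDiff_comm]
    congr 2
    exact funext h
  have h2 : ((flipX G * diag g : unitary B₀) : B₀) * ((flipX F * diag f : unitary B₀) : B₀) =
      ((flipX F * diag fun c => s * f c : unitary B₀) : B₀) *
        ((flipX G * diag g : unitary B₀) : B₀) := congrArg Subtype.val h1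
  have h3 : ((flipX G * diag g : unitary B₀) : B₀) *
      star ((flipX G * diag g : unitary B₀) : B₀) = 1 :=
    Unitary.coe_mul_star_self (flipX G * diag g)
  rw [h2, mul_assoc, h3, mul_one, diag_mul_const]

theorem phase_vacuum (Q : Finset Dart) (c : Config) : phase .vacuum Q c = 1 := by
  refine Finset.prod_eq_one fun d _ => ?_
  simp [Anyon.legPhase, Anyon.isSemionic]

theorem flipped_of_not_isSemionic {a : Anyon} (ha : ¬ a.isSemionic) (Q : Finset Dart) :
    flipped a Q = ∅ := if_neg ha

theorem stringAut_vacuum (P : Set Dart) (T : 𝒜) : stringAut .vacuum P T = T := by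
  refine stringAut_eq_of_eventually (Filter.Eventually.of_forall fun F => ?_)
  have h : stringOperator .vacuum (truncate P F) = 1 := by
    rw [stringOperator_eq, flipped_of_not_isSemionic (a := .vacuum) (fun h => h), flip_empty,
      one_mul, funext (phase_vacuum _), diag_one]
  rw [h]
  simp

/-- The string operator of the bound state is a product of `σᶻ`, so that its eigenvalues are
characters of the group of configurations. -/
theorem phase_bound_symmDiff (Q : Finset Dart) (c F : Config) :
    phase .bound Q (symmDiff c F) = phase .bound Q F * phase .bound Q c := by
  unfold phase
  rw [← Finset.prod_mul_distrib]
  refine Finset.prod_congr rfl fun d _ => ?_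
  by_cases h1 : Dart.turnLeft d ∈ Q <;> by_cases h2 : Dart.edge (Dart.turnRight d) ∈ c <;>
    by_cases h3 : Dart.edge (Dart.turnRight d) ∈ F <;>
    simp [h1, h2, h3, Finset.mem_symmDiff, Anyon.legPhase, Anyon.isSemionic]

theorem phase_antisemion (Q : Finset Dart) (c : Config) :
    phase .antisemion Q c = phase .bound Q c * phase .semion Q c := by
  unfold phase
  rw [← Finset.prod_mul_distrib]
  refine Finset.prod_congr rfl fun d _ => ?_
  by_cases h : Dart.turnLeft d ∈ Q ∧ Dart.edge (Dart.turnRight d) ∈ c <;>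
    simp [h, Anyon.legPhase, Anyon.isSemionic]

/-- Conjugation by the string operator of the antisemion is the composition of the conjugations by
those of the semion and the bound state, as these string operators commute up to a sign. -/
theorem conj_antisemion (Q : Finset Dart) (T : B₀) :
    (stringOperator .antisemion Q : B₀) * T * star (stringOperator .antisemion Q : B₀) =
      (stringOperator .bound Q : B₀) * ((stringOperator .semion Q : B₀) * T *
        star (stringOperator .semion Q : B₀)) * star (stringOperator .bound Q : B₀) := by
  have hG : flipped .antisemion Q = flipped .semion Q := by
    rw [flipped, flipped, if_pos (show Anyon.isSemionic .antisemion from trivial),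
      if_pos (show Anyon.isSemionic .semion from trivial)]
  set z := phase .bound Q (flipped .semion Q)
  have h1 : stringOperator .bound Q * stringOperator .semion Q =
      flipX (flipped .semion Q) * diag fun c => z * phase .antisemion Q c := by
    rw [stringOperator_eq, stringOperator_eq, flipped_of_not_isSemionic (a := .bound) (fun h => h),
      flip_mul_diag_mul, ← Finset.bot_eq_empty, bot_symmDiff]
    congr 2
    funext c
    rw [phase_bound_symmDiff, phase_antisemion, mul_assoc]
  have h2 : (stringOperator .bound Q : B₀) * (stringOperator .semion Q : B₀) =
      (z : ℂ) • (stringOperator .antisemion Q : B₀) := by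
    rw [stringOperator_eq .antisemion, hG, ← diag_mul_const, ← h1]
    rfl
  have h3 : (stringOperator .bound Q : B₀) * ((stringOperator .semion Q : B₀) * T *
        star (stringOperator .semion Q : B₀)) * star (stringOperator .bound Q : B₀) =
      ((stringOperator .bound Q : B₀) * (stringOperator .semion Q : B₀)) * T *
        star ((stringOperator .bound Q : B₀) * (stringOperator .semion Q : B₀)) := by
    rw [star_mul]
    simp only [mul_assoc]
  have h4 : (z : ℂ) * star (z : ℂ) = 1 := by
    rw [Complex.star_def, Complex.mul_conj, Circle.normSq_coe, Complex.ofReal_one]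
  rw [h3, h2, star_smul, smul_mul_assoc, smul_mul_assoc, mul_smul_comm, smul_smul, h4, one_smul]

theorem stringAut_antisemion (P : Set Dart) (T : 𝒜) :
    stringAut .antisemion P T = stringAut .bound P (stringAut .semion P T) := by
  refine Subtype.ext (tendsto_nhds_unique (tendsto_stringAut .antisemion P T) ?_)
  have h1 := tendsto_stringAut .bound P (stringAut .semion P T)
  have h2 := tendsto_iff_norm_sub_tendsto_zero.1 (tendsto_stringAut .semion P T)
  refine h1.congr_dist (h2.congr fun F => ?_)
  rw [conj_antisemion, dist_comm, dist_eq_norm, ← sub_mul, ← mul_sub, norm_conj]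

/-! ### Boxes of hexagons -/

/-- The box of hexagons whose axial coordinates are at most `R` in absolute value. -/
def box (R : ℤ) : Finset Hexagon := Finset.Icc (-R) R ×ˢ Finset.Icc (-R) R

theorem mem_box {R : ℤ} {h : Hexagon} :
    h ∈ box R ↔ (-R ≤ h.1 ∧ h.1 ≤ R) ∧ -R ≤ h.2 ∧ h.2 ≤ R := by
  rw [box, Finset.mem_product, Finset.mem_Icc, Finset.mem_Icc]

theorem abs_dir_int_le (k : Fin 6) : -1 ≤ (dir k).1 ∧ (dir k).1 ≤ 1 ∧ -1 ≤ (dir k).2 ∧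
    (dir k).2 ≤ 1 := by
  revert k
  decide

/-- The collar of a box is contained in an annulus of width two. -/
theorem mem_box_of_mem_collar {R : ℤ} {h : Hexagon} (hh : h ∈ collar (box R)) :
    h ∈ box (R + 1) ∧ h ∉ box (R - 1) := by
  obtain ⟨k, l, h1, h2⟩ := hh
  have hk := abs_dir_int_le k
  have hl := abs_dir_int_le l
  simp only [mem_box, Prod.fst_add, Prod.snd_add] at h1 h2 ⊢
  omega

/-- Finitely many edges lie inside all large boxes. -/
theorem exists_forall_mem_box (K : Finset Edge) (m : ℤ) :
    ∃ R : ℕ, m < R ∧ ∀ e ∈ K, ∀ h ∈ e.1, h ∈ box (R - 1) := by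
  classical
  let H : Finset Hexagon := K.biUnion fun e => e.1.toFinset
  refine ⟨m.toNat + (H.sup fun h => h.1.natAbs + h.2.natAbs) + 1, by push_cast; omega,
    fun e he h hh => ?_⟩
  have h1 : h ∈ H := Finset.mem_biUnion.2 ⟨e, he, by simpa using hh⟩
  have h2 : h.1.natAbs + h.2.natAbs ≤ H.sup fun h => h.1.natAbs + h.2.natAbs :=
    Finset.le_sup (f := fun h : Hexagon => h.1.natAbs + h.2.natAbs) h1
  rw [mem_box]
  push_cast
  omega

theorem left_mem_edge (d : Dart) : Dart.left d ∈ (Dart.edge d).1 := Sym2.mem_mk_left _ _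

theorem right_mem_edge (d : Dart) : Dart.right d ∈ (Dart.edge d).1 := Sym2.mem_mk_right _ _

/-! ### The loop that measures the semionic charge -/

open Classical in
/-- The eigenvalue of `σᶻ` at the edge that underlies `d`. -/
def edgeSign (d : Dart) (c : Config) : Circle := if Dart.edge d ∈ c then -1 else 1

theorem edgeSign_symmDiff (d : Dart) (c G : Config) :
    edgeSign d (symmDiff c G) = edgeSign d c * edgeSign d G := by
  unfold edgeSign
  by_cases h1 : Dart.edge d ∈ c <;> by_cases h2 : Dart.edge d ∈ G <;>
    simp [h1, h2, Finset.mem_symmDiff]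

/-- `-1` on the hexagons of `S`, and `1` elsewhere. -/
def hexSign (S : Finset Hexagon) (h : Hexagon) : Circle := if h ∈ S then -1 else 1

theorem hexSign_mul_self (S : Finset Hexagon) (h : Hexagon) : hexSign S h * hexSign S h = 1 := by
  unfold hexSign
  split_ifs <;> simp

theorem edgeSign_boundary (d : Dart) (S : Finset Hexagon) :
    edgeSign d (boundary S) = hexSign S (Dart.left d) * hexSign S (Dart.right d) := by
  unfold edgeSign hexSign
  simp only [edge_mem_boundary]
  by_cases h1 : Dart.left d ∈ S <;> by_cases h2 : Dart.right d ∈ S <;> simp [h1, h2]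

theorem prod_range_mul_succ {g : ℕ → Circle} (hg : ∀ i, g i * g i = 1) (n : ℕ) :
    ∏ i ∈ Finset.range n, g i * g (i + 1) = g 0 * g n := by
  induction n with
  | zero => rw [Finset.prod_range_zero, hg]
  | succ n ih =>
    rw [Finset.prod_range_succ, ih, mul_assoc, ← mul_assoc (g n), hg, one_mul]

/-- The product of `σᶻ` over the edges crossed by the square loop of hexagons that surrounds the
box of size `R - 1`. -/
def squareSign (R : ℕ) (c : Config) : Circle :=
  ∏ i ∈ Finset.range (2 * R),
    (edgeSign ((-R + i, R), 0) c * edgeSign ((-R + i, -R), 0) c *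
      (edgeSign ((R, -R + i), 1) c * edgeSign ((-R, -R + i), 1) c))

theorem squareSign_symmDiff (R : ℕ) (c G : Config) :
    squareSign R (symmDiff c G) = squareSign R c * squareSign R G := by
  unfold squareSign
  rw [← Finset.prod_mul_distrib]
  refine Finset.prod_congr rfl fun i _ => ?_
  simp only [edgeSign_symmDiff]
  ac_rfl

/-- A boundary crosses every closed loop an even number of times. -/
theorem squareSign_boundary (R : ℕ) (S : Finset Hexagon) : squareSign R (boundary S) = 1 := by
  have row : ∀ y : ℤ, ∏ i ∈ Finset.range (2 * R), edgeSign ((-R + i, y), 0) (boundary S) =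
      hexSign S (-R, y) * hexSign S (R, y) := by
    intro y
    have h := prod_range_mul_succ (g := fun i => hexSign S (-R + i, y))
      (fun i => hexSign_mul_self _ _) (2 * R)
    convert h using 2
    · rw [edgeSign_boundary]
      congr 2
      refine Prod.ext ?_ ?_
      · change -(R : ℤ) + _ + 1 = _
        push_cast
        ring
      · exact add_zero y
    · simp
    · congr 1
      refine Prod.ext ?_ rfl
      push_cast
      ring
  have column : ∀ x : ℤ, ∏ i ∈ Finset.range (2 * R), edgeSign ((x, -R + i), 1) (boundary S) =
      hexSign S (x, -R) * hexSign S (x, R) := by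
    intro x
    have h := prod_range_mul_succ (g := fun i => hexSign S (x, -R + i))
      (fun i => hexSign_mul_self _ _) (2 * R)
    convert h using 2
    · rw [edgeSign_boundary]
      congr 2
      refine Prod.ext ?_ ?_
      · exact add_zero x
      · change -(R : ℤ) + _ + 1 = _
        push_cast
        ring
    · simp
    · congr 1
      refine Prod.ext rfl ?_
      push_cast
      ring
  unfold squareSign
  rw [Finset.prod_mul_distrib, Finset.prod_mul_distrib, Finset.prod_mul_distrib, row, row, column,
    column]
  have h1 := hexSign_mul_self S (-R, R)
  have h2 := hexSign_mul_self S (R, R)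
  have h3 := hexSign_mul_self S (-R, -R)
  have h4 := hexSign_mul_self S (R, -R)
  calc _ = (hexSign S (-R, R) * hexSign S (-R, R)) * (hexSign S (R, R) * hexSign S (R, R)) *
        (hexSign S (-R, -R) * hexSign S (-R, -R)) * (hexSign S (R, -R) * hexSign S (R, -R)) := by
        ac_rfl
    _ = 1 := by rw [h1, h2, h3, h4]; simp

open Classical in
/-- The edges crossed by the square loop. -/
def squareEdges (R : ℕ) : Finset Edge :=
  (Finset.range (2 * R)).biUnion fun i =>
    {Dart.edge ((-R + i, R), 0), Dart.edge ((-R + i, -R), 0), Dart.edge ((R, -R + i), 1),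
      Dart.edge ((-R, -R + i), 1)}

theorem dependsOn_squareSign (R : ℕ) : DependsOn (squareEdges R) (squareSign R) := by
  classical
  intro c c' h
  refine Finset.prod_congr rfl fun i hi => ?_
  have h' : ∀ d ∈ ([((-R + i, R), 0), ((-R + i, -R), 0), ((R, -R + i), 1), ((-R, -R + i), 1)] :
      List Dart), edgeSign d c = edgeSign d c' := by
    intro d hd
    have : Dart.edge d ∈ squareEdges R := by
      refine Finset.mem_biUnion.2 ⟨i, hi, ?_⟩
      simp only [List.mem_cons, List.not_mem_nil, or_false] at hd
      simp only [Finset.mem_insert, Finset.mem_singleton]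
      rcases hd with rfl | rfl | rfl | rfl <;> simp
    unfold edgeSign
    simp only [h _ this]
  rw [h' _ (by simp), h' _ (by simp), h' _ (by simp), h' _ (by simp)]

theorem notMem_squareEdges {R : ℕ} {e : Edge} (he : ∀ h ∈ e.1, h ∈ box (R - 1)) :
    e ∉ squareEdges R := by
  intro h
  obtain ⟨i, -, hi⟩ := Finset.mem_biUnion.1 h
  simp only [Finset.mem_insert, Finset.mem_singleton] at hi
  rcases hi with rfl | rfl | rfl | rfl <;>
  · have := he _ (left_mem_edge _)
    rw [mem_box] at this
    simp only [Dart.left] at this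
    omega

section Ray

variable {q J : ℤ} {Q : Finset Dart}

open Classical in
/-- The ray crosses the step from `(x, y)` to `(x + 1, y)` only if that step enters its column. -/
theorem edgeSign_row (hQ : ∀ d ∈ Q, d ∈ rayPath q J) (x y : ℤ) :
    edgeSign ((x, y), 0) (Q.image Dart.edge) = if x + 1 = q ∧ ((q, y), 3) ∈ Q then -1 else 1 := by
  unfold edgeSign
  refine if_congr ?_ rfl rfl
  rw [Finset.mem_image]
  constructor
  · rintro ⟨⟨⟨q', r⟩, k⟩, hd, he⟩
    obtain ⟨h1, h2⟩ := hQ _ hd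
    dsimp only at h1 h2
    subst h1
    rcases edge_eq_edge_iff.1 he with ⟨h3, h4⟩ | ⟨h3, h4⟩
    · rcases h2 with ⟨rfl, -⟩ | ⟨rfl, -⟩ <;>
      · have e1 : q' = x := congrArg Prod.fst h3
        have e2 : q' + -1 = x + 1 := congrArg Prod.fst h4
        omega
    · rcases h2 with ⟨rfl, -⟩ | ⟨rfl, -⟩
      · have e1 : q' = x + 1 := congrArg Prod.fst h3
        have e2 : r = y + 0 := congrArg Prod.snd h3
        rw [add_zero] at e2
        subst e2
        exact ⟨e1.symm, hd⟩
      · have e1 : r = y + 0 := congrArg Prod.snd h3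
        have e2 : r + 1 = y := congrArg Prod.snd h4
        omega
  · rintro ⟨h1, h2⟩
    refine ⟨_, h2, edge_eq_edge_iff.2 (Or.inr ⟨Prod.ext ?_ ?_, Prod.ext ?_ ?_⟩)⟩
    · exact h1.symm
    · exact (add_zero y).symm
    · change q + -1 = x
      omega
    · exact add_zero y

/-- The ray does not cross vertical steps. -/
theorem edgeSign_column (hQ : ∀ d ∈ Q, d ∈ rayPath q J) (x y : ℤ) :
    edgeSign ((x, y), 1) (Q.image Dart.edge) = 1 := by
  refine if_neg fun h => ?_
  obtain ⟨⟨⟨q', r⟩, k⟩, hd, he⟩ := Finset.mem_image.1 h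
  obtain ⟨h1, h2⟩ := hQ _ hd
  dsimp only at h1 h2
  rcases edge_eq_edge_iff.1 he with ⟨h3, h4⟩ | ⟨h3, h4⟩ <;>
  · rcases h2 with ⟨rfl, -⟩ | ⟨rfl, -⟩ <;>
    · have e1 := congrArg Prod.fst h3
      have e2 := congrArg Prod.fst h4
      simp [Dart.left, Dart.right, dir] at e1 e2
      omega

/-- The ray leaves a large square exactly once. -/
theorem squareSign_ray (hQ : ∀ d ∈ Q, d ∈ rayPath q J) {R : ℕ} (hq : |q| < R) (hJ : |J| < R)
    (hR : ((q, (R : ℤ)), 3) ∈ Q) : squareSign R (Q.image Dart.edge) = -1 := by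
  have hbot : ((q, -(R : ℤ)), 3) ∉ Q := by
    intro h
    obtain ⟨-, h2⟩ := hQ _ h
    dsimp only at h2
    rcases h2 with ⟨-, h2⟩ | ⟨h2, -⟩
    · rw [abs_lt] at hJ
      omega
    · exact absurd h2 (by decide)
  unfold squareSign
  simp only [edgeSign_row hQ, edgeSign_column hQ, hR, hbot, and_true, and_false, if_false, mul_one]
  rw [abs_lt] at hq
  rw [Finset.prod_eq_single (q - 1 + R).toNat]
  · rw [if_pos]
    omega
  · intro i _ hi
    rw [if_neg]
    omega
  · intro h
    exact absurd (Finset.mem_range.2 (by omega)) h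

end Ray

open Classical in
theorem truncate_subset {P : Set Dart} {F : Finset Dart} : ∀ d ∈ truncate P F, d ∈ P :=
  fun _ hd => (Finset.mem_filter.1 hd).2

open Classical in
theorem mem_truncate {P : Set Dart} {F : Finset Dart} {d : Dart} (h1 : d ∈ P) (h2 : d ∈ F) :
    d ∈ truncate P F :=
  Finset.mem_filter.2 ⟨h2, h1⟩

/-- The square loop as an observable. -/
def squareLoop (R : ℕ) : 𝒜 :=
  ⟨((flipX ∅ * diag (squareSign R) : unitary B₀) : B₀),
    flip_mul_diag_mem (dependsOn_squareSign R) ∅⟩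

theorem stringAut_squareLoop_of_not_isSemionic {a : Anyon} (ha : ¬ a.isSemionic) (P : Set Dart)
    (R : ℕ) : stringAut a P (squareLoop R) = squareLoop R := by
  refine stringAut_eq_of_eventually (Filter.Eventually.of_forall fun F => ?_)
  rw [stringOperator_eq, flipped_of_not_isSemionic ha]
  refine (conj_monomial (s := 1) fun c => ?_).trans ?_
  · rw [← Finset.bot_eq_empty, symmDiff_bot, one_mul, mul_comm]
  · rw [Circle.coe_one, one_smul]
    rfl

theorem stringAut_squareLoop_of_isSemionic {a : Anyon} (ha : a.isSemionic) {q J : ℤ} {R : ℕ}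
    (hq : |q| < R) (hJ : |J| < R) :
    stringAut a (rayPath q J) (squareLoop R) = -squareLoop R := by
  have hmem : (((q, (R : ℤ)), 3) : Dart) ∈ rayPath q J := by
    refine ⟨rfl, Or.inl ⟨rfl, ?_⟩⟩
    dsimp only
    rw [abs_lt] at hJ
    omega
  refine stringAut_eq_of_eventually ?_
  filter_upwards [Filter.eventually_ge_atTop {(((q, (R : ℤ)), 3) : Dart)}] with F hF
  have hG : flipped a (truncate (rayPath q J) F) =
      (truncate (rayPath q J) F).image Dart.edge := if_pos ha
  rw [stringOperator_eq, hG]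
  refine (conj_monomial (s := -1) fun c => ?_).trans ?_
  · rw [squareSign_symmDiff, squareSign_ray truncate_subset hq hJ
      (mem_truncate hmem (hF (Finset.mem_singleton_self _))), ← Finset.bot_eq_empty, symmDiff_bot,
      mul_comm]
    simp
  · rw [Circle.coe_neg, Circle.coe_one, neg_smul, one_smul]
    rfl

/-- The square loops, which change sign under the semion and the antisemion only, separate the
sectors of the latter from the other two. -/
theorem not_unitarilyEquivalent_of_isSemionic {q J : ℤ} {a b : Anyon} (ha : ¬ a.isSemionic)
    (hb : b.isSemionic) : ¬ UnitarilyEquivalent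
      (gns.comp (stringAut a (rayPath q J) : 𝒜 →⋆ₐ[ℂ] 𝒜))
      (gns.comp (stringAut b (rayPath q J) : 𝒜 →⋆ₐ[ℂ] 𝒜)) := by
  refine not_unitarilyEquivalent fun K => ?_
  obtain ⟨R, hR, hK⟩ := exists_forall_mem_box K (|q| + |J|)
  have hq : |q| < R := by have := abs_nonneg J; omega
  have hJ : |J| < R := by have := abs_nonneg q; omega
  refine ⟨squareLoop R, 1, norm_monomial_le _ _, one_ne_zero, ?_, ?_, fun x hx => ?_, ?_⟩
  · rw [one_smul]
    exact stringAut_squareLoop_of_not_isSemionic ha _ _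
  · rw [neg_smul, one_smul]
    exact stringAut_squareLoop_of_isSemionic hb hq hJ
  · exact commute_monomial (dependsOn_squareSign R) (notMem_squareEdges (hK x hx))
      (Finset.notMem_empty x)
  · refine Filter.Eventually.of_forall fun n => ?_
    have := monomial_stringVector (T := ∅) (f := squareSign R) (n := n) (fun S => ?_)
      (Finset.empty_subset _)
    · rwa [boundary_empty] at this
    · rw [squareSign_boundary, relSign, ← Finset.bot_eq_empty, symmDiff_bot, Int.units_mul_self]
      simp

/-! ### The loop that measures the flux -/

/-- The square annulus of hexagons around the boundary of the box of size `R`. -/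
def annulus (R : ℤ) : Finset Hexagon := box (R + 1) \ box (R - 1)

open Classical in
/-- The edges between two hexagons of the annulus. -/
def annulusEdges (R : ℤ) : Finset Edge :=
  ((annulus R ×ˢ Finset.univ).filter fun d : Dart => Dart.right d ∈ annulus R).image Dart.edge

theorem edge_mem_annulusEdges {R : ℤ} {d : Dart} (h1 : Dart.left d ∈ annulus R)
    (h2 : Dart.right d ∈ annulus R) : Dart.edge d ∈ annulusEdges R :=
  Finset.mem_image_of_mem _ (Finset.mem_filter.2
    ⟨Finset.mem_product.2 ⟨h1, Finset.mem_univ _⟩, h2⟩)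

theorem notMem_annulusEdges {R : ℤ} {e : Edge} (he : ∀ h ∈ e.1, h ∈ box (R - 1)) :
    e ∉ annulusEdges R := by
  intro h
  obtain ⟨d, hd, rfl⟩ := Finset.mem_image.1 h
  have h1 := (Finset.mem_product.1 (Finset.mem_filter.1 hd).1).1
  exact (Finset.mem_sdiff.1 h1).2 (he _ (left_mem_edge d))

theorem notMem_boundary_box {R : ℤ} {e : Edge} (he : ∀ h ∈ e.1, h ∈ box (R - 1)) :
    e ∉ boundary (box R) := by
  obtain ⟨d, rfl⟩ := exists_dart e
  have h1 := he _ (left_mem_edge d)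
  have h2 := he _ (right_mem_edge d)
  rw [edge_mem_boundary, not_not]
  simp only [mem_box] at *
  omega

theorem iff_of_forall_step {g : ℤ → Prop} {a b : ℤ}
    (h : ∀ x, a ≤ x → x < b → (g x ↔ g (x + 1))) {x y : ℤ} (hx : a ≤ x) (hxb : x ≤ b) (hy : a ≤ y)
    (hyb : y ≤ b) : g x ↔ g y := by
  have key : ∀ x, a ≤ x → x ≤ b → (g a ↔ g x) := by
    intro x hx
    induction x, hx using Int.leInduction with
    | base => exact fun _ => Iff.rfl
    | succ n hn ih => exact fun hb => (ih (by omega)).trans (h n hn (by omega))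
  exact (key x hx hxb).symm.trans (key y hy hyb)

/-- The annulus is connected: a set of hexagons without boundary edges in it contains all of its
hexagons or none. -/
theorem annulus_connected {R : ℤ} (hR : 0 ≤ R) {D : Finset Hexagon}
    (hD : ∀ e ∈ annulusEdges R, e ∉ boundary D) {h : Hexagon} (hh : h ∈ annulus R) :
    h ∈ D ↔ (R, R) ∈ D := by
  have step : ∀ d : Dart, Dart.left d ∈ annulus R → Dart.right d ∈ annulus R →
      (Dart.left d ∈ D ↔ Dart.right d ∈ D) := by
    intro d h1 h2
    have := hD _ (edge_mem_annulusEdges h1 h2)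
    rwa [edge_mem_boundary, not_not] at this
  have mem : ∀ {x y : ℤ}, (x, y) ∈ annulus R ↔ (-(R + 1) ≤ x ∧ x ≤ R + 1 ∧ -(R + 1) ≤ y ∧ y ≤ R + 1)
      ∧ (x ≤ -R ∨ R ≤ x ∨ y ≤ -R ∨ R ≤ y) := by
    intro x y
    rw [annulus, Finset.mem_sdiff, mem_box, mem_box]
    dsimp only
    omega
  have row : ∀ {x x' y : ℤ}, (y ≤ -R ∨ R ≤ y) → -(R + 1) ≤ y → y ≤ R + 1 → -(R + 1) ≤ x →
      x ≤ R + 1 → -(R + 1) ≤ x' → x' ≤ R + 1 → ((x, y) ∈ D ↔ (x', y) ∈ D) := by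
    intro x x' y hy h1 h2 h3 h4 h5 h6
    refine iff_of_forall_step (g := fun x => (x, y) ∈ D) (fun z hz hz' => ?_) h3 h4 h5 h6
    have e : Dart.right (((z, y), 0) : Dart) = (z + 1, y) := Prod.ext rfl (add_zero y)
    have := step ((z, y), 0) (mem.2 (by omega)) (by rw [e]; exact mem.2 (by omega))
    rwa [e] at this
  have column : ∀ {x y y' : ℤ}, (x ≤ -R ∨ R ≤ x) → -(R + 1) ≤ x → x ≤ R + 1 → -(R + 1) ≤ y →
      y ≤ R + 1 → -(R + 1) ≤ y' → y' ≤ R + 1 → ((x, y) ∈ D ↔ (x, y') ∈ D) := by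
    intro x y y' hx h1 h2 h3 h4 h5 h6
    refine iff_of_forall_step (g := fun y => (x, y) ∈ D) (fun z hz hz' => ?_) h3 h4 h5 h6
    have e : Dart.right (((x, z), 1) : Dart) = (x, z + 1) := Prod.ext (add_zero x) rfl
    have := step ((x, z), 1) (mem.2 (by omega)) (by rw [e]; exact mem.2 (by omega))
    rwa [e] at this
  obtain ⟨x, y⟩ := h
  obtain ⟨h1, h2⟩ := mem.1 hh
  by_cases hy : y ≤ -R ∨ R ≤ y
  · exact (row (x' := R) hy (by omega) (by omega) (by omega) (by omega) (by omega) (by omega)).trans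
      (column (by omega) (by omega) (by omega) (by omega) (by omega) (by omega) (by omega))
  · exact (column (y' := R) (by omega) (by omega) (by omega) (by omega) (by omega) (by omega)
      (by omega)).trans
      (row (by omega) (by omega) (by omega) (by omega) (by omega) (by omega) (by omega))

/-- The sign relative to a box can be read off from the occupied edges in the annulus: they
determine the set of hexagons in the annulus up to its complement. -/
theorem relSign_box_congr {R : ℤ} (hR : 0 ≤ R) {S S' : Finset Hexagon}
    (h : ∀ e ∈ annulusEdges R, (e ∈ boundary S ↔ e ∈ boundary S')) :
    relSign (box R) S = relSign (box R) S' := by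
  have hD : ∀ e ∈ annulusEdges R, e ∉ boundary (symmDiff S S') := by
    intro e he
    rw [boundary_symmDiff, Finset.mem_symmDiff, h e he]
    tauto
  have hcollar : ∀ x ∈ collar (box R), x ∈ annulus R := fun x hx =>
    Finset.mem_sdiff.2 (mem_box_of_mem_collar hx)
  by_cases h0 : (R, R) ∈ symmDiff S S'
  -- `S'` is the complement of `S` in the annulus, and is complemented in a larger box
  · rw [← relSign_symmDiff_of_disjoint (B := box (R + 3)) ?_ S']
    · refine relSign_congr fun x hx => ?_
      have hx' := hcollar x hx
      have h1 := (annulus_connected hR hD hx').2 h0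
      have h2 : x ∈ box (R + 3) := by
        have := (Finset.mem_sdiff.1 hx').1
        rw [mem_box] at this ⊢
        omega
      rw [Finset.mem_symmDiff] at h1 ⊢
      tauto
    · intro x hx hx'
      have := (mem_box_of_mem_collar hx').2
      rw [mem_box] at hx this
      omega
  · refine relSign_congr fun x hx => ?_
    have h1 := mt (annulus_connected hR hD (hcollar x hx)).1 h0
    rw [Finset.mem_symmDiff] at h1
    tauto

open Classical in
/-- The phase of the flux loop: the sign relative to the box of any boundary that agrees with the
given configuration in the annulus. (It is irrelevant, and set to `1`, if there is none.) -/
def fluxPhase (R : ℤ) (c : Config) : Circle :=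
  if h : ∃ S : Finset Hexagon, ∀ e ∈ annulusEdges R, (e ∈ boundary S ↔ e ∈ c) then
    if relSign (box R) h.choose = 1 then 1 else -1
  else 1

theorem dependsOn_fluxPhase (R : ℤ) : DependsOn (annulusEdges R) (fluxPhase R) := by
  intro c c' h
  have : (fun S : Finset Hexagon => ∀ e ∈ annulusEdges R, (e ∈ boundary S ↔ e ∈ c)) =
      fun S => ∀ e ∈ annulusEdges R, (e ∈ boundary S ↔ e ∈ c') := by
    funext S
    exact propext (forall₂_congr fun e he => by rw [h e he])
  unfold fluxPhase
  rw [this]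

theorem fluxPhase_boundary {R : ℤ} (hR : 0 ≤ R) (S : Finset Hexagon) :
    (fluxPhase R (boundary S) : ℂ) = ((relSign (box R) S : ℤ) : ℂ) := by
  have h : ∃ S' : Finset Hexagon, ∀ e ∈ annulusEdges R, (e ∈ boundary S' ↔ e ∈ boundary S) :=
    ⟨S, fun _ _ => Iff.rfl⟩
  rw [fluxPhase, dif_pos h, relSign_box_congr hR h.choose_spec]
  rcases Int.units_eq_one_or (relSign (box R) S) with e | e <;> rw [e] <;> simp

/-- The flux loop: the product of the `σˣ` around a box, with the phases that make it stabilise the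
ground state. -/
def fluxLoop (R : ℤ) : 𝒜 :=
  ⟨((flipX (boundary (box R)) * diag (fluxPhase R) : unitary B₀) : B₀),
    flip_mul_diag_mem (dependsOn_fluxPhase R) _⟩

/-- The legs on the right of a ray cross the boundary of a large box exactly once. -/
theorem phase_bound_box {q J : ℤ} {Q : Finset Dart} (hQ : ∀ d ∈ Q, d ∈ rayPath q J) {R : ℤ}
    (hq : |q| < R) (hJ : |J| < R) (h2 : ((q, R), 2) ∈ Q) (h3 : ((q, R), 3) ∈ Q) :
    phase .bound Q (boundary (box R)) = -1 := by
  rw [abs_lt] at hq hJ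
  have hleg : ∀ r : ℤ, Dart.edge (Dart.turnRight ((q, r), 2)) ∈ boundary (box R) ↔
      (r = R ∨ r = -R - 1) := by
    intro r
    have e1 : Dart.left (Dart.turnRight ((q, r), 2)) = (q - 1, r) := Prod.ext rfl (add_zero r)
    have e2 : Dart.right (Dart.turnRight ((q, r), 2)) = (q - 1, r + 1) := by
      refine Prod.ext ?_ ?_
      · exact add_zero (q + -1)
      · change r + 0 + 1 = r + 1
        rw [add_zero]
    rw [edge_mem_boundary, e1, e2, mem_box, mem_box]
    dsimp only
    omega
  unfold phase
  rw [Finset.prod_eq_single ((q, R), 2)]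
  · have h4 : Dart.turnLeft ((q, R), 2) ∈ Q := h3
    rw [if_pos ⟨h4, (hleg R).2 (Or.inl rfl)⟩, if_neg fun h => h.1, mul_one]
    rfl
  · rintro ⟨⟨q', r⟩, k⟩ hd hne
    obtain ⟨h4, h5⟩ := hQ _ hd
    dsimp only at h4 h5
    subst h4
    rw [if_neg (c := Anyon.isSemionic .bound ∧ _) fun h => h.1, mul_one]
    refine if_neg fun h => ?_
    rcases h5 with ⟨rfl, h5⟩ | ⟨rfl, h5⟩
    -- the ray turns right at the head of `((q, r), 3)`, so that there is no leg
    · obtain ⟨-, h6⟩ := hQ _ h.1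
      rcases h6 with ⟨h6, -⟩ | ⟨h6, -⟩
      · exact absurd (show (4 : Fin 6) = 3 from h6) (by decide)
      · exact absurd (show (4 : Fin 6) = 2 from h6) (by decide)
    -- the leg that crosses the lower side of the box is below the end of the ray
    · rcases (hleg r).1 h.2 with rfl | rfl
      · exact hne rfl
      · omega
  · exact fun h => absurd h2 h

theorem stringAut_bound_fluxLoop {q J R : ℤ} (hq : |q| < R) (hJ : |J| < R) :
    stringAut .bound (rayPath q J) (fluxLoop R) = -fluxLoop R := by
  have hJ' := abs_lt.1 hJ
  have hm2 : (((q, R), 2) : Dart) ∈ rayPath q J := by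
    refine ⟨rfl, Or.inr ⟨rfl, ?_⟩⟩
    dsimp only
    omega
  have hm3 : (((q, R), 3) : Dart) ∈ rayPath q J := by
    refine ⟨rfl, Or.inl ⟨rfl, ?_⟩⟩
    dsimp only
    omega
  refine stringAut_eq_of_eventually ?_
  filter_upwards [Filter.eventually_ge_atTop {(((q, R), 2) : Dart), (((q, R), 3) : Dart)}]
    with F hF
  rw [stringOperator_eq, flipped_of_not_isSemionic (a := .bound) (fun h => h)]
  refine (conj_monomial (s := -1) fun c => ?_).trans ?_
  · rw [phase_bound_symmDiff, phase_bound_box truncate_subset hq hJ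
      (mem_truncate hm2 (hF (by simp))) (mem_truncate hm3 (hF (by simp))),
      ← Finset.bot_eq_empty, symmDiff_bot, mul_right_comm]
  · rw [Circle.coe_neg, Circle.coe_one, neg_smul, one_smul]
    rfl

/-- The flux loops, which change sign under the bound state, separate it from the vacuum. -/
theorem not_unitarilyEquivalent_vacuum_bound (q J : ℤ) : ¬ UnitarilyEquivalent
    (gns.comp (stringAut .vacuum (rayPath q J) : 𝒜 →⋆ₐ[ℂ] 𝒜))
    (gns.comp (stringAut .bound (rayPath q J) : 𝒜 →⋆ₐ[ℂ] 𝒜)) := by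
  refine not_unitarilyEquivalent fun K => ?_
  obtain ⟨R, hR, hK⟩ := exists_forall_mem_box K (|q| + |J|)
  have hq : |q| < (R : ℤ) := by have := abs_nonneg J; omega
  have hJ : |J| < (R : ℤ) := by have := abs_nonneg q; omega
  refine ⟨fluxLoop R, 1, norm_monomial_le _ _, one_ne_zero, ?_, ?_, fun x hx => ?_, ?_⟩
  · rw [one_smul]
    exact stringAut_vacuum _ _
  · rw [neg_smul, one_smul]
    exact stringAut_bound_fluxLoop hq hJ
  · exact commute_monomial (dependsOn_fluxPhase R) (notMem_annulusEdges (hK x hx))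
      (notMem_boundary_box (hK x hx))
  · filter_upwards [eventually_subset_patch (box R)] with n hn
    exact monomial_stringVector (fluxPhase_boundary (Int.natCast_nonneg R)) hn

/-! ### Inequivalence of the sectors -/

theorem UnitarilyEquivalent.symm {H K : Type*} [NormedAddCommGroup H] [InnerProductSpace ℂ H]
    [CompleteSpace H] [NormedAddCommGroup K] [InnerProductSpace ℂ K] [CompleteSpace K]
    {π : 𝒜 →⋆ₐ[ℂ] (H →L[ℂ] H)} {ρ : 𝒜 →⋆ₐ[ℂ] (K →L[ℂ] K)} (h : UnitarilyEquivalent π ρ) :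
    UnitarilyEquivalent ρ π := by
  obtain ⟨U, hU⟩ := h
  refine ⟨U.symm, fun O ψ => ?_⟩
  rw [LinearIsometryEquiv.symm_apply_eq, hU, LinearIsometryEquiv.apply_symm_apply]

/-- As the antisemion is the composite of the semion and the bound state, an equivalence of their
sectors would give one of the vacuum and the bound state. -/
theorem not_unitarilyEquivalent_semion_antisemion (q J : ℤ) : ¬ UnitarilyEquivalent
    (gns.comp (stringAut .semion (rayPath q J) : 𝒜 →⋆ₐ[ℂ] 𝒜))
    (gns.comp (stringAut .antisemion (rayPath q J) : 𝒜 →⋆ₐ[ℂ] 𝒜)) := by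
  rintro ⟨U, hU⟩
  refine not_unitarilyEquivalent_vacuum_bound q J ⟨U, fun O ψ => ?_⟩
  have h := hU ((stringAut .semion (rayPath q J)).symm O) ψ
  change U (gns (stringAut .semion (rayPath q J) ((stringAut .semion (rayPath q J)).symm O)) ψ) =
    gns (stringAut .antisemion (rayPath q J) ((stringAut .semion (rayPath q J)).symm O)) (U ψ) at h
  rw [stringAut_antisemion, StarAlgEquiv.apply_symm_apply] at h
  change U (gns (stringAut .vacuum (rayPath q J) O) ψ) =
    gns (stringAut .bound (rayPath q J) O) (U ψ)
  rw [stringAut_vacuum]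
  exact h

theorem isSemionic_iff {a : Anyon} : a.isSemionic ↔ a = .semion ∨ a = .antisemion := by
  cases a <;> simp [Anyon.isSemionic]

theorem not_isSemionic_iff {a : Anyon} : ¬ a.isSemionic ↔ a = .vacuum ∨ a = .bound := by
  cases a <;> simp [Anyon.isSemionic]

theorem eq_of_unitarilyEquivalent {q J : ℤ} {a b : Anyon} (h : UnitarilyEquivalent
    (gns.comp (stringAut a (rayPath q J) : 𝒜 →⋆ₐ[ℂ] 𝒜))
    (gns.comp (stringAut b (rayPath q J) : 𝒜 →⋆ₐ[ℂ] 𝒜))) : a = b := by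
  by_cases ha : a.isSemionic <;> by_cases hb : b.isSemionic
  · obtain rfl | rfl := isSemionic_iff.1 ha <;> obtain rfl | rfl := isSemionic_iff.1 hb
    · rfl
    · exact absurd h (not_unitarilyEquivalent_semion_antisemion q J)
    · exact absurd h.symm (not_unitarilyEquivalent_semion_antisemion q J)
    · rfl
  · exact absurd h.symm (not_unitarilyEquivalent_of_isSemionic hb ha)
  · exact absurd h (not_unitarilyEquivalent_of_isSemionic ha hb)
  · obtain rfl | rfl := not_isSemionic_iff.1 ha <;> obtain rfl | rfl := not_isSemionic_iff.1 hb
    · rfl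
    · exact absurd h (not_unitarilyEquivalent_vacuum_bound q J)
    · exact absurd h.symm (not_unitarilyEquivalent_vacuum_bound q J)
    · rfl

end DoubleSemion

end

theorem mainTheorem7 :
    ∃ ω : DoubleSemion.𝒜 →ₚ[ℂ] ℂ, DoubleSemion.IsDoubleSemionState ω ∧
      ∀ (p : DoubleSemion.Plane) (θ : ℝ), 0 < θ → θ < 2 * Real.pi → ∀ n : ℝ, 2 < n →
        ∀ a b : DoubleSemion.Anyon,
          DoubleSemion.UnitarilyEquivalent
            (DoubleSemion.sector ω p !₂[0, 1] θ n a)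
            (DoubleSemion.sector ω p !₂[0, 1] θ n b) ↔ a = b := by
  refine ⟨DoubleSemion.semionState, DoubleSemion.isDoubleSemionState_semionState,
    fun p θ h0 h1 n hn a b => ⟨fun h => ?_, ?_⟩⟩
  · obtain ⟨q, J, hP⟩ := DoubleSemion.exists_axisPath_eq_rayPath (p := p) h0 h1 hn
    unfold DoubleSemion.sector at h
    rw [hP] at h
    exact DoubleSemion.eq_of_unitarilyEquivalent h
  · rintro rfl
    exact ⟨LinearIsometryEquiv.refl ℂ _, fun _ _ => rfl⟩
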